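/- **Setting.** Let $L=E(5,10)$ be the Lie superalgebra over $\mathbb C$ whose even part is the Lie algebra $S_5$ of divergence-free formal vector fields $\sum_i P_i\partial_i$, $P_i\in\mathbb C[[x_1,\dots,x_5]]$, and whose odd part is the space of closed formal $2$-forms in $x_1,\dots,x_5$. Vector fields bracket by the commutator, a vector field acts on a $2$-form by the Lie derivative, and with $d_{ij}=dx_i\wedge dx_j$ two $2$-forms bracket by $[f d_{jk},g d_{lm}]=\sum_i\epsilon_{ijklm}\,fg\,\partial_i$, extended bilinearly, where $\epsilon_{ijklm}$ is the sign of the permutation $ijklm$ if the indices are distinct, and $0$ otherwise. Put $\deg x_i=2=-\deg\partial_i$, $\deg d_{ij}=-1$, and let $L_-=\mathfrak g_{-2}+\mathfrak g_{-1}=\langle\partial_i\rangle+\langle d_{ij}\rangle$, $\mathfrak g_0=\{\sum a_{ij}x_i\partial_j:\operatorname{tr}(a_{ij})=0\}\simeq\mathfrak{sl}_5(\mathbb C)$, $L_+$ the (closed) subalgebra of elements of positive degree, and $L_0=\mathfrak g_0+L_+$. Let $U$ be the universal enveloping algebra of $L$ and $U_-=U(L_-)\subset U$, graded by $\deg d_{ij}=1$,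 $\deg\partial_i=2$. For a $\mathfrak g_0$-module $V$, on which $L_+$ is made to act by $0$, let $M(V)=U\otimes_{U(L_0)}V$. A morphism $M(V)\to M(W)$ is a $U$-linear map. It has degree $k$ if its restriction to $1\otimes V$ has the form $1\otimes v\mapsto\sum_i u_i\otimes\ell_i(v)$ (a finite sum) with $u_i\in U_-$ homogeneous of degree $k$ and $\ell_i\in\operatorname{Hom}_{\mathbb C}(V,W)$. Let $F(n_1,n_2,n_3,n_4)$ be the finite-dimensional irreducible $\mathfrak g_0$-module of highest weight $(n_1,\dots,n_4)$ with respect to the Borel subalgebra spanned by the $x_i\partial_j$, $i<j$, and $h_i=x_i\partial_i-x_{i+1}\partial_{i+1}$, and let $M(n_1,n_2,n_3,n_4)=M(F(n_1,n_2,n_3,n_4))$. **Theorem 5.1.** For all $n\ge0$: * the space $\operatorname{Sym}^n(\mathbb C^5)$ of homogeneous polynomials of degree $n$ in $z_1,\dots,z_5$, on which $x_i\partial_j$ acts as $z_i\,\partial/\partial z_j$, is a realization of $F(n,0,0,0)$; * the space $\operatorname{Sym}^n(\mathbb C^{5*})$ of homogeneous polynomials of degree $n$ in $z_1^*,\dots,z_5^*$,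 on which $x_i\partial_j$ acts as $-z_j^*\,\partial/\partial z_i^*$, is a realization of $F(0,0,0,n)$. There is an injective linear map $\psi:\operatorname{Sym}^3(\mathbb C^5)\to U$ which has its values in the component of degree $4$ of $U_-$, is $\mathfrak g_0$-equivariant for the adjoint action of $\mathfrak g_0$ on $U$, and sends $z_1^3$ to $d_{12}d_{13}d_{14}d_{15}$ (so its image is an irreducible submodule $\operatorname{Sym}^3(\mathbb C^5)$ with this highest weight vector) such that the following holds. For a multi-index $a=(a_1,\dots,a_5)$ with $|a|=3$ put $u_a=\frac{3!}{a_1!\cdots a_5!}\,\psi(z^a)$; these elements form the basis of the image of $\psi$ dual to the monomial basis $\hat z^a$ of $\operatorname{Sym}^3(\mathbb C^{5*})$, for the invariant pairing normalized by $\langle\hat z_1^3,z_1^3\rangle=1$. (a) For each $n_1\ge3$ there is a non-zero morphism of degree $4$ $$t_{AB}:M(n_1,0,0,0)\to M(n_1-3,0,0,0),\qquad t_{AB}(1\otimes f)=\sum_{|a|=3}u_a\otimes\frac{\partial^{3} f}{\partial z_1^{a_1}\cdots\partial z_5^{a_5}}\quad(f\in\operatorname{Sym}^{n_1}(\mathbb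 C^5)).$$ (b) For each $n_4\ge0$ there is a non-zero morphism of degree $4$ $$t_{BC}:M(0,0,0,n_4)\to M(0,0,0,n_4+3),\qquad t_{BC}(1\otimes f)=\sum_{|a|=3}u_a\otimes (z^*)^a f\quad(f\in\operatorname{Sym}^{n_4}(\mathbb C^{5*})).$$ -/

import Mathlib

noncomputable section

namespace E510

/-- The ring of formal power series `ℂ[[x₁, …, x₅]]` (the indices are `0, …, 4`). -/
abbrev PS : Type := MvPowerSeries (Fin 5) ℂ

/-- The partial derivative `∂ᵢ` on formal power series. -/
abbrev pd (i : Fin 5) : Derivation ℂ PS PS := MvPowerSeries.pderiv ℂ i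

/-- A formal vector field `∑ Pⱼ ∂ⱼ`, given by its coefficients `Pⱼ`. -/
abbrev VField : Type := Fin 5 → PS

/-- The coefficient array of a formal `2`-form; a skew array `w` stands for
`∑_{j < k} w j k dxⱼ ∧ dxₖ`. -/
abbrev FormArray : Type := Fin 5 → Fin 5 → PS

/-- `1` if `a < b`, `-1` if `b < a`, and `0` if `a = b`. -/
def cmpSign (a b : Fin 5) : ℤ := if a < b then 1 else if b < a then -1 else 0

/-- The sign `ε_{ijklm}` of the permutation `(i j k l m)` if the indices are distinct, and `0`
otherwise: the product of the comparison signs over all pairs of positions. -/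
def levi (i j k l m : Fin 5) : ℤ :=
  cmpSign i j * cmpSign i k * cmpSign i l * cmpSign i m * cmpSign j k * cmpSign j l *
    cmpSign j m * cmpSign k l * cmpSign k m * cmpSign l m

/-- The divergence of a formal vector field. -/
def divergence (P : VField) : PS := ∑ i, pd i (P i)

/-- The divergence free formal vector fields: the space `S₅`. -/
def divFree : Submodule ℂ VField where
  carrier := {P | divergence P = 0}
  add_mem' := by
    intro P Q hP hQ
    simp only [Set.mem_ofPred_eq, divergence] at *
    simp [Finset.sum_add_distrib, hP, hQ]
  zero_mem' := by simp [divergence]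
  smul_mem' := by
    intro c P hP
    simp only [Set.mem_ofPred_eq, divergence] at *
    simp [← Finset.smul_sum, hP]

/-- The closed formal `2`-forms: skew arrays `w` with
`∂ₐ w_{bc} + ∂_b w_{ca} + ∂_c w_{ab} = 0`, i.e. `dw = 0`. -/
def closedForms : Submodule ℂ FormArray where
  carrier := {w | (∀ a b, w a b = - w b a) ∧
    ∀ a b c, pd a (w b c) + pd b (w c a) + pd c (w a b) = 0}
  add_mem' := by
    rintro v w ⟨hv, hv2⟩ ⟨hw, hw2⟩
    refine ⟨fun a b => ?_, fun a b c => ?_⟩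
    · simp only [Pi.add_apply]
      rw [hv a b, hw a b]; ring
    · simp only [Pi.add_apply, map_add]
      linear_combination hv2 a b c + hw2 a b c
  zero_mem' := by simp
  smul_mem' := by
    rintro r w ⟨hw, hw2⟩
    refine ⟨fun a b => ?_, fun a b c => ?_⟩
    · simp only [Pi.smul_apply]
      rw [hw a b, smul_neg]
    · simp only [Pi.smul_apply, Derivation.map_smul]
      rw [← smul_add, ← smul_add, hw2, smul_zero]

/-- The commutator of formal vector fields. -/
def fieldBracket (P Q : VField) : VField :=
  fun j => ∑ i, (P i * pd i (Q j) - Q i * pd i (P j))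

/-- The Lie derivative `L_P w` of a `2`-form `w` along a vector field `P`. -/
def lieDeriv (P : VField) (w : FormArray) : FormArray :=
  fun a b => ∑ i, (P i * pd i (w a b) + pd a (P i) * w i b + pd b (P i) * w a i)

/-- The vector field that corresponds to the `4`-form `v ∧ w` under `D ↦ ι_D (dx₁ ∧ … ∧ dx₅)`;
thus `f dxⱼ ∧ dxₖ` and `g dxₗ ∧ dxₘ` are sent to `∑ᵢ ε_{ijklm} f g ∂ᵢ`. The factor `1/4` is
there because each form `∑_{j < k}` is summed over all ordered pairs. -/
def formBracket (v w : FormArray) : VField :=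
  fun i => (1 / 4 : ℂ) • ∑ j, ∑ k, ∑ l, ∑ m, levi i j k l m • (v j k * w l m)

theorem pd_comm (i j : Fin 5) (f : PS) : pd i (pd j f) = pd j (pd i f) := by
  ext n
  simp only [pd, MvPowerSeries.coeff_pderiv]
  by_cases h : i = j
  · subst h; rfl
  · have e : n + Finsupp.single i 1 + Finsupp.single j 1
        = n + Finsupp.single j 1 + Finsupp.single i 1 := by abel
    rw [e]
    simp [h, Ne.symm h]
    ring

theorem fieldBracket_mem {P Q : VField} (hP : P ∈ divFree) (hQ : Q ∈ divFree) :
    fieldBracket P Q ∈ divFree := by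
  have hP0 : ∑ j, pd j (P j) = 0 := hP
  have hQ0 : ∑ j, pd j (Q j) = 0 := hQ
  change ∑ j, pd j (∑ i, (P i * pd i (Q j) - Q i * pd i (P j))) = 0
  have h1 : ∀ j, pd j (∑ i, (P i * pd i (Q j) - Q i * pd i (P j)))
      = ∑ i, (pd j (P i) * pd i (Q j) - pd j (Q i) * pd i (P j))
        + ∑ i, (P i * pd i (pd j (Q j)) - Q i * pd i (pd j (P j))) := by
    intro j
    rw [map_sum, ← Finset.sum_add_distrib]
    refine Finset.sum_congr rfl fun i _ => ?_
    simp only [map_sub, Derivation.leibniz, smul_eq_mul]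
    rw [pd_comm j i (Q j), pd_comm j i (P j)]
    ring
  rw [Finset.sum_congr rfl fun j _ => h1 j, Finset.sum_add_distrib]
  have h2 : ∑ j, ∑ i, (pd j (P i) * pd i (Q j) - pd j (Q i) * pd i (P j)) = 0 := by
    simp only [Finset.sum_sub_distrib]
    rw [sub_eq_zero, Finset.sum_comm]
    refine Finset.sum_congr rfl fun i _ => Finset.sum_congr rfl fun j _ => mul_comm _ _
  have h3 : ∑ j, ∑ i, (P i * pd i (pd j (Q j)) - Q i * pd i (pd j (P j))) = 0 := by
    rw [Finset.sum_comm]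
    refine Finset.sum_eq_zero fun i _ => ?_
    rw [Finset.sum_sub_distrib, ← Finset.mul_sum, ← Finset.mul_sum, ← map_sum, ← map_sum,
      hP0, hQ0]
    simp
  rw [h2, h3, add_zero]

theorem lieDeriv_mem {P : VField} {w : FormArray} (hw : w ∈ closedForms) :
    lieDeriv P w ∈ closedForms := by
  obtain ⟨hs, hc⟩ := hw
  refine ⟨fun a b => ?_, fun a b c => ?_⟩
  · simp only [lieDeriv]
    rw [← Finset.sum_neg_distrib]
    refine Finset.sum_congr rfl fun i _ => ?_
    rw [hs b a, hs b i, hs i a, map_neg]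
    ring
  · simp only [lieDeriv, map_sum]
    rw [← Finset.sum_add_distrib, ← Finset.sum_add_distrib]
    refine Finset.sum_eq_zero fun i _ => ?_
    simp only [map_add, Derivation.leibniz, smul_eq_mul]
    have e0 : pd i (pd a (w b c)) + pd i (pd b (w c a)) + pd i (pd c (w a b)) = 0 := by
      rw [← map_add, ← map_add, hc a b c, map_zero]
    have e1 := hc i b c
    have e2 := hc i c a
    have e3 := hc i a b
    rw [pd_comm a i, pd_comm b i (w c a), pd_comm c i (w a b), pd_comm b a (P i),
      pd_comm c a (P i), pd_comm c b (P i)]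
    have s1 := hs i a
    have s2 := hs i b
    have s3 := hs i c
    have t1 : ∀ p, pd p (w i a) = - pd p (w a i) := fun p => by rw [s1, map_neg]
    have t2 : ∀ p, pd p (w i b) = - pd p (w b i) := fun p => by rw [s2, map_neg]
    have t3 : ∀ p, pd p (w i c) = - pd p (w c i) := fun p => by rw [s3, map_neg]
    rw [t2] at e1
    rw [t3] at e2
    rw [t1] at e3
    rw [s1, s2, s3]
    simp only [map_neg]
    linear_combination P i * e0 + pd a (P i) * e1 + pd b (P i) * e2 + pd c (P i) * e3

theorem cmpSign_swap (a b : Fin 5) : cmpSign a b = - cmpSign b a := by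
  revert a b
  decide

theorem levi_cycle_left (i j k l m : Fin 5) : levi i j k l m = levi j k i l m := by
  rw [levi, levi, cmpSign_swap j i, cmpSign_swap k i]
  ring

theorem levi_swap (i j k l m : Fin 5) : levi i j k l m = levi i l m j k := by
  rw [levi, levi, cmpSign_swap l j, cmpSign_swap l k, cmpSign_swap m j, cmpSign_swap m k]
  ring

theorem sum_cycle (F : Fin 5 → Fin 5 → Fin 5 → PS) :
    ∑ i, ∑ j, ∑ k, F i j k = ∑ i, ∑ j, ∑ k, F j k i := by
  rw [Finset.sum_comm (f := fun i j => ∑ k, F j k i)]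
  exact Finset.sum_congr rfl fun j _ => Finset.sum_comm

theorem divergence_half {v w : FormArray} (hv : v ∈ closedForms) :
    ∑ i, ∑ j, ∑ k, ∑ l, ∑ m, levi i j k l m • (pd i (v j k) * w l m) = 0 := by
  have h1 : ∑ i, ∑ j, ∑ k, ∑ l, ∑ m, levi i j k l m • (pd i (v j k) * w l m)
      = ∑ i, ∑ j, ∑ k, ∑ l, ∑ m, levi i j k l m • (pd j (v k i) * w l m) := by
    rw [sum_cycle]
    simp only [← levi_cycle_left]
  have h2 : ∑ i, ∑ j, ∑ k, ∑ l, ∑ m, levi i j k l m • (pd i (v j k) * w l m)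
      = ∑ i, ∑ j, ∑ k, ∑ l, ∑ m, levi i j k l m • (pd k (v i j) * w l m) := by
    rw [h1, sum_cycle]
    simp only [← levi_cycle_left]
  have h3 : ∑ i, ∑ j, ∑ k, ∑ l, ∑ m, (levi i j k l m • (pd i (v j k) * w l m)
      + levi i j k l m • (pd j (v k i) * w l m)
      + levi i j k l m • (pd k (v i j) * w l m)) = 0 := by
    refine Finset.sum_eq_zero fun i _ => Finset.sum_eq_zero fun j _ =>
      Finset.sum_eq_zero fun k _ => Finset.sum_eq_zero fun l _ => Finset.sum_eq_zero fun m _ => ?_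
    rw [← smul_add, ← smul_add, ← add_mul, ← add_mul, hv.2 i j k, zero_mul, smul_zero]
  simp only [Finset.sum_add_distrib] at h3
  rw [← h1, ← h2] at h3
  have h4 : (3 : ℂ) • ∑ i, ∑ j, ∑ k, ∑ l, ∑ m, levi i j k l m • (pd i (v j k) * w l m) = 0 := by
    rw [← h3]
    module
  exact (smul_eq_zero.mp h4).resolve_left (by norm_num)

theorem formBracket_mem {v w : FormArray} (hv : v ∈ closedForms) (hw : w ∈ closedForms) :
    formBracket v w ∈ divFree := by
  change ∑ i, pd i ((1 / 4 : ℂ) • ∑ j, ∑ k, ∑ l, ∑ m, levi i j k l m • (v j k * w l m)) = 0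
  have h1 : ∀ i, pd i ((1 / 4 : ℂ) • ∑ j, ∑ k, ∑ l, ∑ m, levi i j k l m • (v j k * w l m))
      = (1 / 4 : ℂ) • (∑ j, ∑ k, ∑ l, ∑ m, levi i j k l m • (pd i (v j k) * w l m)
        + ∑ j, ∑ k, ∑ l, ∑ m, levi i j k l m • (pd i (w j k) * v l m)) := by
    intro i
    have e : ∑ j, ∑ k, ∑ l, ∑ m, levi i j k l m • (pd i (w j k) * v l m)
        = ∑ j, ∑ k, ∑ l, ∑ m, levi i j k l m • (v j k * pd i (w l m)) := by
      have c : ∀ G : Fin 5 → Fin 5 → Fin 5 → Fin 5 → PS,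
          ∑ j, ∑ k, ∑ l, ∑ m, G j k l m = ∑ j, ∑ k, ∑ l, ∑ m, G l m j k := by
        intro G
        have : ∀ H : Fin 5 × Fin 5 → Fin 5 × Fin 5 → PS,
            ∑ p, ∑ q, H p q = ∑ p, ∑ q, H q p := fun H => Finset.sum_comm
        simpa [Fintype.sum_prod_type] using this fun p q => G p.1 p.2 q.1 q.2
      rw [c]
      simp only [← levi_swap, mul_comm]
    rw [e, (pd i).map_smul]
    congr 1
    simp only [map_sum, map_zsmul, Derivation.leibniz, smul_eq_mul, ← Finset.sum_add_distrib,
      ← smul_add]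
    refine Finset.sum_congr rfl fun j _ => Finset.sum_congr rfl fun k _ =>
      Finset.sum_congr rfl fun l _ => Finset.sum_congr rfl fun m _ => ?_
    congr 1
    ring
  rw [Finset.sum_congr rfl fun i _ => h1 i, ← Finset.smul_sum, Finset.sum_add_distrib,
    divergence_half hv, divergence_half hw]
  simp

/-- The underlying space of the Lie superalgebra `E(5,10)`: its even part is `S₅` (the first
factor), its odd part is the space of closed formal `2`-forms (the second factor). -/
abbrev L : Type := divFree × closedForms

/-- The even element given by a divergence free vector field. -/
def even (P : divFree) : L := (P, 0)

/-- The odd element given by a closed `2`-form. -/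
def odd (w : closedForms) : L := (0, w)

/-- The superbracket of `E(5,10)`: the commutator on vector fields, the Lie derivative between
vector fields and forms, and `[v, w] = v ∧ w`, read as a vector field, on forms. -/
def bracket (x y : L) : L :=
  (⟨fieldBracket x.1 y.1, fieldBracket_mem x.1.2 y.1.2⟩
      + ⟨formBracket x.2 y.2, formBracket_mem x.2.2 y.2.2⟩,
    ⟨lieDeriv x.1 y.2, lieDeriv_mem y.2.2⟩ - ⟨lieDeriv y.1 x.2, lieDeriv_mem x.2.2⟩)

/-- The defining relations of the universal enveloping superalgebra:
`x y - (-1)^{|x||y|} y x = [x, y]` for homogeneous `x`, `y`. -/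
inductive UEA.Rel : TensorAlgebra ℂ L → TensorAlgebra ℂ L → Prop
  | even_left (P : divFree) (y : L) :
      UEA.Rel (TensorAlgebra.ι ℂ (even P) * TensorAlgebra.ι ℂ y
          - TensorAlgebra.ι ℂ y * TensorAlgebra.ι ℂ (even P))
        (TensorAlgebra.ι ℂ (bracket (even P) y))
  | odd_odd (v w : closedForms) :
      UEA.Rel (TensorAlgebra.ι ℂ (odd v) * TensorAlgebra.ι ℂ (odd w)
          + TensorAlgebra.ι ℂ (odd w) * TensorAlgebra.ι ℂ (odd v))
        (TensorAlgebra.ι ℂ (bracket (odd v) (odd w)))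

/-- The universal enveloping algebra `U = U(E(5,10))`. -/
def UEA : Type := (ringConGen UEA.Rel).Quotient

instance : Ring UEA := inferInstanceAs (Ring (ringConGen UEA.Rel).Quotient)

instance : Algebra ℂ UEA := inferInstanceAs (Algebra ℂ (ringConGen UEA.Rel).Quotient)

/-- The quotient map from the tensor algebra of `E(5,10)` to `U`. -/
def UEA.mk : TensorAlgebra ℂ L →ₐ[ℂ] UEA := RingCon.mkₐ ℂ (ringConGen UEA.Rel)

/-- The canonical map `E(5,10) → U`. -/
def ιU : L →ₗ[ℂ] UEA :=
  UEA.mk.toLinearMap ∘ₗ TensorAlgebra.ι ℂ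

/-- The subalgebra `L₀ = g₀ + L₊` of elements of non-negative degree, for the grading
`deg xᵢ = 2 = -deg ∂ᵢ`, `deg dxᵢ ∧ dxⱼ = -1`: all coefficients vanish at the origin. -/
def nonnegPart : Submodule ℂ L where
  carrier := {x | (∀ i, MvPowerSeries.constantCoeff (x.1.1 i) = 0) ∧
    ∀ i j, MvPowerSeries.constantCoeff (x.2.1 i j) = 0}
  add_mem' := by
    rintro x y ⟨hx, hx2⟩ ⟨hy, hy2⟩
    exact ⟨fun i => by simp [hx i, hy i], fun i j => by simp [hx2 i j, hy2 i j]⟩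
  zero_mem' := by simp
  smul_mem' := by
    rintro c x ⟨hx, hx2⟩
    exact ⟨fun i => by simp [hx i], fun i j => by simp [hx2 i j]⟩

/-- The Lie algebra `sl₅(ℂ)`. -/
abbrev sl5 : Type := LieAlgebra.SpecialLinear.sl (Fin 5) ℂ

/-- The projection of `L₀` to `g₀ ≅ sl₅(ℂ)` along `L₊`: it sends an element whose vector field has
linear part `∑ Aᵢⱼ xᵢ ∂ⱼ` to the matrix `A`. -/
def linPart (x : L) : sl5 :=
  ⟨Matrix.of fun i j => MvPowerSeries.coeff (Finsupp.single i 1) (x.1.1 j), by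
    have h : ∑ i, pd i (x.1.1 i) = 0 := x.1.2
    have h2 := congrArg (MvPowerSeries.coeff 0) h
    simpa [MvPowerSeries.coeff_pderiv, LieAlgebra.SpecialLinear.sl, Matrix.trace] using h2⟩

section Verma

variable (V W : Type) [AddCommGroup V] [Module ℂ V] [LieRingModule sl5 V] [LieModule ℂ sl5 V]
  [AddCommGroup W] [Module ℂ W] [LieRingModule sl5 W] [LieModule ℂ sl5 W]

/-- The relations `u x ⊗ v = u ⊗ x v` (`u ∈ U`, `x ∈ L₀`, `v ∈ V`) which turn `U ⊗_ℂ V` into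
`U ⊗_{U(L₀)} V`; here `L₀` acts on `V` through `L₀ → g₀`, i.e. `L₊` acts by zero. -/
def vermaRel : Submodule UEA (TensorProduct ℂ UEA V) :=
  Submodule.span UEA {t | ∃ (u : UEA) (x : L) (v : V), x ∈ nonnegPart ∧
    t = TensorProduct.tmul ℂ (u * ιU x) v - TensorProduct.tmul ℂ u ⁅linPart x, v⁆}

/-- The generalized Verma module `M(V) = U ⊗_{U(L₀)} V` of a `g₀`-module `V`. -/
abbrev Verma : Type := TensorProduct ℂ UEA V ⧸ vermaRel V

variable {V W}

/-- The element `u ⊗ v` of `M(V)`. -/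
def tmul (u : UEA) (v : V) : Verma V :=
  Submodule.Quotient.mk (TensorProduct.tmul ℂ u v)

end Verma

/-- The form `dxᵢ ∧ dxⱼ`. -/
def dForm (i j : Fin 5) : closedForms :=
  ⟨fun k l => (if k = i ∧ l = j then 1 else 0) - (if k = j ∧ l = i then 1 else 0), by
    refine ⟨fun a b => ?_, fun a b c => ?_⟩
    · rw [neg_sub]
      simp only [and_comm]
    · have h : ∀ (p : Prop) [Decidable p] (n : Fin 5), pd n (if p then 1 else 0) = 0 := by
        intro p _ n
        split_ifs <;> simp
      simp only [map_sub, h, sub_zero, add_zero]⟩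

/-- The constant vector field `∂ᵢ`. -/
def dField (i : Fin 5) : divFree :=
  ⟨fun j => if j = i then 1 else 0, by
    refine Finset.sum_eq_zero fun j _ => ?_
    change pd j (if j = i then 1 else 0) = 0
    split_ifs <;> simp⟩

/-- The element `dᵢⱼ = dxᵢ ∧ dxⱼ` of `U`. -/
def d (i j : Fin 5) : UEA := ιU (odd (dForm i j))

/-- The vector field `∑ Aᵢⱼ xᵢ ∂ⱼ` of degree zero given by a traceless matrix `A`. -/
def linField (A : sl5) : divFree :=
  ⟨fun j => ∑ i, A.1 i j • (MvPowerSeries.X i : PS), by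
    have hA : ∑ i, A.1 i i = 0 := by
      have := A.2
      simpa [LieAlgebra.SpecialLinear.sl, Matrix.trace] using this
    change ∑ j, pd j (∑ i, A.1 i j • (MvPowerSeries.X i : PS)) = 0
    have h : ∀ j, pd j (∑ i, A.1 i j • (MvPowerSeries.X i : PS)) = A.1 j j • (1 : PS) := by
      intro j
      rw [map_sum, Finset.sum_eq_single j]
      · rw [Derivation.map_smul, MvPowerSeries.pderiv_X_self]
      · intro i _ hij
        rw [Derivation.map_smul, MvPowerSeries.pderiv_X_of_ne hij, smul_zero]
      · simp
    rw [Finset.sum_congr rfl fun j _ => h j, ← Finset.sum_smul, hA, zero_smul]⟩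

/-- The generators of `L₋ = g₋₂ + g₋₁`: `inl (i, j)` stands for `dᵢⱼ`, `inr i` for `∂ᵢ`. -/
def negGen : (Fin 5 × Fin 5) ⊕ Fin 5 → UEA
  | Sum.inl p => d p.1 p.2
  | Sum.inr i => ιU (even (dField i))

/-- The natural (sign changed) degrees of these generators: `1` for `dᵢⱼ` and `2` for `∂ᵢ`. -/
def negGenDeg : (Fin 5 × Fin 5) ⊕ Fin 5 → ℕ
  | Sum.inl _ => 1
  | Sum.inr _ => 2

/-- The component of degree `k` of `U₋ = U(L₋) ⊆ U` for the natural grading. -/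
def uMinus (k : ℕ) : Submodule ℂ UEA :=
  Submodule.span ℂ {u | ∃ l : List ((Fin 5 × Fin 5) ⊕ Fin 5),
    (l.map negGenDeg).sum = k ∧ u = (l.map negGen).prod}

section Degree

variable {V W : Type} [AddCommGroup V] [Module ℂ V] [LieRingModule sl5 V] [LieModule ℂ sl5 V]
  [AddCommGroup W] [Module ℂ W] [LieRingModule sl5 W] [LieModule ℂ sl5 W]

/-- A morphism `φ : M(V) → M(W)` has degree `k` if `φ(1 ⊗ v) = ∑ᵢ uᵢ ⊗ ℓᵢ(v)` with finitely many
`uᵢ ∈ U₋` of degree `k` and linear maps `ℓᵢ : V → W`. -/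
def HasDegree (φ : Verma V →ₗ[UEA] Verma W) (k : ℕ) : Prop :=
  ∃ (N : ℕ) (u : Fin N → UEA) (l : Fin N → (V →ₗ[ℂ] W)),
    (∀ i, u i ∈ uMinus k) ∧ ∀ v, φ (tmul 1 v) = ∑ i, tmul (u i) (l i v)

end Degree

/-- The matrix unit `Eᵢⱼ` of `sl₅`, i.e. `xᵢ ∂ⱼ`, for `i ≠ j`. -/
def matE (i j : Fin 5) (h : i ≠ j) : sl5 := LieAlgebra.SpecialLinear.single i j h 1

/-- The element `Eᵢᵢ - Eⱼⱼ` of `sl₅`, i.e. `xᵢ ∂ᵢ - xⱼ ∂ⱼ`. -/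
def matH (i j : Fin 5) : sl5 := LieAlgebra.SpecialLinear.singleSubSingle i j 1

/-- `V` is a model of `F(n₁, n₂, n₃, n₄)`: a finite-dimensional irreducible `sl₅`-module with a
highest weight vector of weight `(n₁, n₂, n₃, n₄)`, for the Borel subalgebra spanned by the
`xᵢ ∂ⱼ` with `i < j` and the `hᵢ = xᵢ ∂ᵢ - xᵢ₊₁ ∂ᵢ₊₁`. -/
def IsIrreducibleOfHighestWeight (n : Fin 4 → ℕ) (V : Type) [AddCommGroup V] [Module ℂ V]
    [LieRingModule sl5 V] [LieModule ℂ sl5 V] : Prop :=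
  FiniteDimensional ℂ V ∧ LieModule.IsIrreducible ℂ sl5 V ∧
    ∃ v : V, v ≠ 0 ∧ (∀ (i j : Fin 5) (h : i < j), ⁅matE i j h.ne, v⁆ = 0) ∧
      ∀ i : Fin 4, ⁅matH i.castSucc i.succ, v⁆ = (n i : ℂ) • v

/-- The polynomial ring `ℂ[z₁, …, z₅]`. -/
abbrev Poly : Type := MvPolynomial (Fin 5) ℂ

/-- The derivation `∑ Aᵢⱼ zᵢ ∂/∂zⱼ` of the polynomial ring. -/
def matDer (A : Matrix (Fin 5) (Fin 5) ℂ) : Derivation ℂ Poly Poly :=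
  ∑ i, ∑ j, A i j • (MvPolynomial.X i : Poly) • MvPolynomial.pderiv j

theorem matDer_apply (A : Matrix (Fin 5) (Fin 5) ℂ) (f : Poly) :
    matDer A f = ∑ i, ∑ j, A i j • (MvPolynomial.X i * MvPolynomial.pderiv j f) := by
  simp only [matDer, ← Derivation.coeFnAddMonoidHom_apply, map_sum, Finset.sum_apply]
  simp

theorem matDer_X (A : Matrix (Fin 5) (Fin 5) ℂ) (k : Fin 5) :
    matDer A (MvPolynomial.X k) = ∑ i, A i k • MvPolynomial.X i := by
  rw [matDer_apply]
  refine Finset.sum_congr rfl fun i _ => ?_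
  rw [Finset.sum_eq_single k]
  · simp
  · intro j _ hj
    simp [MvPolynomial.pderiv_X_of_ne hj.symm]
  · simp

theorem matDer_add (A B : Matrix (Fin 5) (Fin 5) ℂ) : matDer (A + B) = matDer A + matDer B := by
  refine MvPolynomial.derivation_ext fun k => ?_
  simp [matDer_X, add_smul, Finset.sum_add_distrib]

theorem matDer_smul (c : ℂ) (A : Matrix (Fin 5) (Fin 5) ℂ) : matDer (c • A) = c • matDer A := by
  refine MvPolynomial.derivation_ext fun k => ?_
  simp [matDer_X, mul_smul, Finset.smul_sum]

theorem matDer_lie (A B : Matrix (Fin 5) (Fin 5) ℂ) :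
    matDer (A * B - B * A) = ⁅matDer A, matDer B⁆ := by
  refine MvPolynomial.derivation_ext fun k => ?_
  rw [Derivation.commutator_apply]
  simp only [matDer_X, map_sum, Derivation.map_smul, Matrix.sub_apply, Matrix.mul_apply, sub_smul,
    Finset.sum_sub_distrib, Finset.sum_smul, Finset.smul_sum, smul_smul]
  refine congrArg₂ _ ?_ ?_
  · rw [Finset.sum_comm]
    refine Finset.sum_congr rfl fun i _ => Finset.sum_congr rfl fun j _ => ?_
    rw [mul_comm]
  · rw [Finset.sum_comm]
    refine Finset.sum_congr rfl fun i _ => Finset.sum_congr rfl fun j _ => ?_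
    rw [mul_comm]

theorem matDer_mem (A : Matrix (Fin 5) (Fin 5) ℂ) (n : ℕ) {f : Poly}
    (hf : f ∈ MvPolynomial.homogeneousSubmodule (Fin 5) ℂ n) :
    matDer A f ∈ MvPolynomial.homogeneousSubmodule (Fin 5) ℂ n := by
  rw [matDer_apply]
  refine Submodule.sum_mem _ fun i _ => Submodule.sum_mem _ fun j _ => Submodule.smul_mem _ _ ?_
  have hf2 : f.IsHomogeneous n := hf
  rcases n with _ | n
  · have h0 : MvPolynomial.pderiv j f = 0 := by
      rw [← MvPolynomial.totalDegree_zero_iff_isHomogeneous,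
        MvPolynomial.totalDegree_eq_zero_iff_eq_C] at hf2
      rw [hf2, MvPolynomial.pderiv_C]
    rw [h0, mul_zero]
    exact Submodule.zero_mem _
  · have h := (MvPolynomial.isHomogeneous_X ℂ i).mul (hf2.pderiv (i := j))
    rw [Nat.add_sub_cancel, add_comm] at h
    exact h

/-- The `sl₅`-module `Symⁿ(ℂ⁵)`: homogeneous polynomials of degree `n` in the standard basis
`z₁, …, z₅` of `ℂ⁵`, on which `xᵢ ∂ⱼ` acts as `zᵢ ∂/∂zⱼ`. -/
def SymPow (n : ℕ) : Type := MvPolynomial.homogeneousSubmodule (Fin 5) ℂ n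

/-- The `sl₅`-module `Symⁿ(ℂ⁵*)`: homogeneous polynomials of degree `n` in the dual basis
`z₁*, …, z₅*` of `ℂ⁵*`, on which `xᵢ ∂ⱼ` acts as `-zⱼ* ∂/∂zᵢ*`. -/
def SymDual (n : ℕ) : Type := MvPolynomial.homogeneousSubmodule (Fin 5) ℂ n

instance (n : ℕ) : AddCommGroup (SymPow n) :=
  inferInstanceAs (AddCommGroup (MvPolynomial.homogeneousSubmodule (Fin 5) ℂ n))

instance (n : ℕ) : Module ℂ (SymPow n) :=
  inferInstanceAs (Module ℂ (MvPolynomial.homogeneousSubmodule (Fin 5) ℂ n))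

instance (n : ℕ) : AddCommGroup (SymDual n) :=
  inferInstanceAs (AddCommGroup (MvPolynomial.homogeneousSubmodule (Fin 5) ℂ n))

instance (n : ℕ) : Module ℂ (SymDual n) :=
  inferInstanceAs (Module ℂ (MvPolynomial.homogeneousSubmodule (Fin 5) ℂ n))

instance (n : ℕ) : LieRingModule sl5 (SymPow n) where
  bracket A f := ⟨matDer A.1 f.1, matDer_mem A.1 n f.2⟩
  add_lie A B f := Subtype.ext (by
    change matDer (A.1 + B.1) f.1 = matDer A.1 f.1 + matDer B.1 f.1
    rw [matDer_add, Derivation.add_apply])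
  lie_add A f g := Subtype.ext (map_add (matDer A.1) f.1 g.1)
  leibniz_lie A B f := Subtype.ext (by
    change matDer A.1 (matDer B.1 f.1)
      = matDer (A.1 * B.1 - B.1 * A.1) f.1 + matDer B.1 (matDer A.1 f.1)
    rw [matDer_lie, Derivation.commutator_apply]
    ring)

instance (n : ℕ) : LieModule ℂ sl5 (SymPow n) where
  smul_lie c A f := Subtype.ext (by
    change matDer (c • A.1) f.1 = c • matDer A.1 f.1
    rw [matDer_smul, Derivation.smul_apply])
  lie_smul c A f := Subtype.ext ((matDer A.1).map_smul c f.1)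

instance (n : ℕ) : LieRingModule sl5 (SymDual n) where
  bracket A f := ⟨matDer (-A.1.transpose) f.1, matDer_mem _ n f.2⟩
  add_lie A B f := Subtype.ext (by
    change matDer (-(A.1 + B.1).transpose) f.1
      = matDer (-A.1.transpose) f.1 + matDer (-B.1.transpose) f.1
    rw [Matrix.transpose_add, neg_add, matDer_add, Derivation.add_apply])
  lie_add A f g := Subtype.ext (map_add (matDer _) f.1 g.1)
  leibniz_lie A B f := Subtype.ext (by
    change matDer (-A.1.transpose) (matDer (-B.1.transpose) f.1)
      = matDer (-(A.1 * B.1 - B.1 * A.1).transpose) f.1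
        + matDer (-B.1.transpose) (matDer (-A.1.transpose) f.1)
    have h : -(A.1 * B.1 - B.1 * A.1).transpose
        = (-A.1.transpose) * (-B.1.transpose) - (-B.1.transpose) * (-A.1.transpose) := by
      rw [Matrix.transpose_sub, Matrix.transpose_mul, Matrix.transpose_mul]
      noncomm_ring
    rw [h, matDer_lie, Derivation.commutator_apply]
    ring)

instance (n : ℕ) : LieModule ℂ sl5 (SymDual n) where
  smul_lie c A f := Subtype.ext (by
    change matDer (-(c • A.1).transpose) f.1 = c • matDer (-A.1.transpose) f.1
    rw [Matrix.transpose_smul, ← smul_neg, matDer_smul, Derivation.smul_apply])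
  lie_smul c A f := Subtype.ext ((matDer _).map_smul c f.1)

/-- Multi-indices `a = (a₁, …, a₅)` with `∑ aᵢ = k`. -/
abbrev MultiIndex (k : ℕ) : Type := (Finset.univ : Finset (Fin 5)).piAntidiag k

theorem MultiIndex.sum_eq {k : ℕ} (a : MultiIndex k) : ∑ i, a.1 i = k :=
  (Finset.mem_piAntidiag.mp a.2).1

theorem isHomogeneous_monomial {k : ℕ} (a : MultiIndex k) :
    (∏ i, (MvPolynomial.X i : Poly) ^ a.1 i).IsHomogeneous k := by
  have h := MvPolynomial.IsHomogeneous.prod Finset.univ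
    (fun i => (MvPolynomial.X i : Poly) ^ a.1 i) a.1
    (fun i _ => by simpa using (MvPolynomial.isHomogeneous_X ℂ i).pow (a.1 i))
  rwa [a.sum_eq] at h

/-- The monomial `zᵃ` in `Symᵏ(ℂ⁵)`. -/
def monomial {k : ℕ} (a : MultiIndex k) : SymPow k :=
  ⟨∏ i, MvPolynomial.X i ^ a.1 i, isHomogeneous_monomial a⟩

/-- The element of `Symᵏ(ℂ⁵)` dual to the monomial `(z*)ᵃ` of `Symᵏ(ℂ⁵*)`, for the invariant
pairing normalized by `⟨(z₁*)ᵏ, z₁ᵏ⟩ = 1`, i.e. `⟨(z*)ᵃ, zᵇ⟩ = δ_{ab} a! / k!`. -/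
def dualMonomial {k : ℕ} (a : MultiIndex k) : SymPow k :=
  (Nat.multinomial Finset.univ a.1 : ℂ) • monomial a

/-- The differential operator `∂ᵃ = (∂/∂z₁)^{a₁} ⋯ (∂/∂z₅)^{a₅}` on polynomials. -/
def diffPoly (a : Fin 5 → ℕ) : Module.End ℂ Poly :=
  (List.ofFn fun i => ((MvPolynomial.pderiv i).toLinearMap : Module.End ℂ Poly) ^ a i).prod

theorem isHomogeneous_pderiv_pow (i : Fin 5) (m n : ℕ) {f : Poly} (hf : f.IsHomogeneous n) :
    ((((MvPolynomial.pderiv i).toLinearMap : Module.End ℂ Poly) ^ m) f).IsHomogeneous (n - m) := by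
  induction m with
  | zero => simpa using hf
  | succ m ih =>
    rw [pow_succ']
    have := ih.pderiv (i := i)
    rwa [Nat.sub_sub] at this

theorem isHomogeneous_diffPoly {k : ℕ} (a : MultiIndex k) (n : ℕ) {f : Poly}
    (hf : f.IsHomogeneous n) : (diffPoly a.1 f).IsHomogeneous (n - k) := by
  have hk := a.sum_eq
  rw [Fin.sum_univ_five] at hk
  have h := isHomogeneous_pderiv_pow 0 (a.1 0) _ (isHomogeneous_pderiv_pow 1 (a.1 1) _
    (isHomogeneous_pderiv_pow 2 (a.1 2) _ (isHomogeneous_pderiv_pow 3 (a.1 3) _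
    (isHomogeneous_pderiv_pow 4 (a.1 4) _ hf))))
  have e : n - a.1 4 - a.1 3 - a.1 2 - a.1 1 - a.1 0 = n - k := by omega
  rw [e] at h
  simpa [diffPoly, List.ofFn_succ, Module.End.mul_apply] using h

/-- The operator `∂ᵃ : Symⁿ(ℂ⁵) → Symⁿ⁻ᵏ(ℂ⁵)`, `k = |a|`. -/
def diffOp {k : ℕ} (a : MultiIndex k) (n : ℕ) : SymPow n →ₗ[ℂ] SymPow (n - k) where
  toFun f := ⟨diffPoly a.1 f.1, isHomogeneous_diffPoly a n f.2⟩
  map_add' f g := Subtype.ext (map_add (diffPoly a.1) f.1 g.1)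
  map_smul' c f := Subtype.ext (map_smul (diffPoly a.1) c f.1)

/-- Multiplication by the monomial `(z*)ᵃ`, `Symⁿ(ℂ⁵*) → Symⁿ⁺ᵏ(ℂ⁵*)`, `k = |a|`. -/
def mulOp {k : ℕ} (a : MultiIndex k) (n : ℕ) : SymDual n →ₗ[ℂ] SymDual (n + k) where
  toFun f := ⟨f.1 * ∏ i, MvPolynomial.X i ^ a.1 i,
    MvPolynomial.IsHomogeneous.mul f.2 (isHomogeneous_monomial a)⟩
  map_add' f g := Subtype.ext (add_mul f.1 g.1 _)
  map_smul' c f := Subtype.ext (smul_mul_assoc c f.1 _)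

/-- The multi-index `(k, 0, 0, 0, 0)`. -/
def firstIndex (k : ℕ) : MultiIndex k :=
  ⟨Pi.single 0 k, by simp⟩

end E510

end

/-!
The elements of `U(L₋) ⊗ W` carry an action of `E(5,10)` (`modelAct`), obtained from the coinduction
formula by moving an element of `E(5,10)` to the right through the generators of `U(L₋)`; verifying
the relations of `U` for it uses the super Jacobi identity. This model identifies `M(W)` with
`U(L₋) ⊗ W` (`mk_eq_zero_iff`), which is all that is needed of the Poincaré–Birkhoff–Witt theorem.

The map `ψ` is packaged in a generating element. Over the ring of polynomials in `z_0, …, z_4` let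
`y = ∑ z_p dx_p` be the generic covector and `D_k = y ∧ dx_k = ∑ z_p d_{pk}` (`gD`). The bracket of
two `2`-forms with the common factor `y` vanishes, so the `D_k` anticommute; also `∑ z_k D_k = 0`.
Hence the quartic products of the `D_k` are proportional to one another and `D₁ D₂ D₃ D₄` is
divisible by `z_0`: there is `Ψ` of degree `3` in `z` with `z_0 Ψ = D₁ D₂ D₃ D₄` (`smul_gPsi`).
It is `sl₅`-invariant (`nabla_Psi`), so its coefficients `u_a` in `Ψ = ∑ u_a zᵃ` span a copy of
`Sym³(ℂ⁵)`, and pairing with `Ψ` is the equivariant map `ψ` (`psi`, `psi_lie`). For an equivariant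
bilinear `β : Sym(ℂ⁵*) × V → W`, the assignment `1 ⊗ v ↦ ∑ u_a ⊗ β(zᵃ, v)` thus extends to a
morphism as soon as `L₊` annihilates its values (`exists_morphism_of_equivariant`).

The product `D₁ D₂ D₃ D₄` is accessible to direct computation: `L₊` annihilates it modulo a left
ideal containing `L₊` and certain combinations `∑ z_p Q_p` of fields `Q_p` in `L₀` whose
coefficients `Q_{pq}` are antisymmetric in `p` and `q` (`emb_mul_gD_mem`). For odd elements this
rests on closedness of the `2`-form, for even elements on the symmetry of second derivatives.

* For `M(n, 0, 0, 0) → M(n - 3, 0, 0, 0)`, the polynomial `f = z_0ⁿ` gives a multiple of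
  `d_{01} d_{02} d_{03} d_{04} ⊗ z_0ⁿ⁻³`, the specialization of the product at `z = (1, 0, 0, 0, 0)`,
  and `L₊` annihilates it (`smul_tmul_top`). The set of all `f` for which `L₊` annihilates the value
  is `sl₅`-stable, so irreducibility of `Symⁿ(ℂ⁵)` finishes the argument (`smul_actOn_diffBilin`).
* For `M(0, 0, 0, n) → M(0, 0, 0, n + 3)`, all `n` are treated together in `Sym(ℂ⁵*)`, where `z`
  acts by multiplication. There the combinations `∑ z_p Q_p` vanish, because the `Q_p` are
  divergence-free (`sum_dualDer_mul`), so `L₊` annihilates `∑ u_a ⊗ zᵃ f` if `z_0` divides `f`.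
  On the model `U(L₋) ⊗ Sym(ℂ⁵*)`, elements of `E(5,10)` act as differential operators of order at
  most one in the polynomial variables (`modelAct_mulModel_mulModel`), so a second difference
  permits the division by `z_0` (`smul_actOn_mulBilin`).

The morphisms do not vanish, because the component of a suitable value along
`d_{01} d_{02} d_{03} d_{04}` is detected by a functional on `U(L₋)` that factors through an
exterior algebra (`topCoeff`, `tmul_top_ne_zero`, `modelSum_ne_zero`).
-/

noncomputable section

namespace E510

open scoped TensorProduct

/-! ### The super Jacobi identity of `E(5,10)` -/

/-- The derivation `∑ Pᵢ ∂ᵢ` of the ring of power series given by a formal vector field. -/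
def fieldDer (P : VField) : Derivation ℂ PS PS := ∑ i, P i • pd i

theorem fieldDer_apply (P : VField) (f : PS) : fieldDer P f = ∑ i, P i * pd i f := by
  simp only [fieldDer, ← Derivation.coeFnAddMonoidHom_apply, map_sum, Finset.sum_apply]
  simp

theorem fieldBracket_apply (P Q : VField) (j : Fin 5) :
    fieldBracket P Q j = fieldDer P (Q j) - fieldDer Q (P j) := by
  simp only [fieldBracket, fieldDer_apply, Finset.sum_sub_distrib]

theorem pd_fieldDer (P : VField) (a : Fin 5) (f : PS) :
    pd a (fieldDer P f) = fieldDer P (pd a f) + ∑ i, pd a (P i) * pd i f := by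
  simp only [fieldDer_apply, map_sum, Derivation.leibniz, smul_eq_mul, ← Finset.sum_add_distrib]
  refine Finset.sum_congr rfl fun i _ => ?_
  rw [pd_comm a i]
  ring

theorem fieldDer_fieldBracket (P Q : VField) (f : PS) :
    fieldDer (fieldBracket P Q) f = fieldDer P (fieldDer Q f) - fieldDer Q (fieldDer P f) := by
  have h : ∀ P Q : VField, fieldDer P (fieldDer Q f)
      = ∑ i, fieldDer P (Q i) * pd i f + ∑ i, ∑ j, P j * Q i * pd j (pd i f) := by
    intro P Q
    rw [fieldDer_apply Q, map_sum, ← Finset.sum_add_distrib]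
    refine Finset.sum_congr rfl fun i _ => ?_
    rw [Derivation.leibniz, fieldDer_apply P (pd i f), smul_eq_mul, smul_eq_mul, Finset.mul_sum,
      add_comm]
    congr 1
    · ring
    · exact Finset.sum_congr rfl fun j _ => by ring
  have hs : ∑ i, ∑ j, P j * Q i * pd j (pd i f) = ∑ i, ∑ j, Q j * P i * pd j (pd i f) := by
    rw [Finset.sum_comm]
    refine Finset.sum_congr rfl fun i _ => Finset.sum_congr rfl fun j _ => ?_
    rw [pd_comm i j]; ring
  rw [h P Q, h Q P, hs, fieldDer_apply]
  simp only [fieldBracket_apply, sub_mul, Finset.sum_sub_distrib]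
  ring

theorem fieldBracket_jacobi (P Q R : VField) :
    fieldBracket (fieldBracket P Q) R
      = fieldBracket P (fieldBracket Q R) + fieldBracket (fieldBracket P R) Q := by
  funext j
  simp only [Pi.add_apply, fieldBracket_apply, fieldDer_fieldBracket, map_sub]
  ring

theorem lieDeriv_apply (P : VField) (w : FormArray) (a b : Fin 5) :
    lieDeriv P w a b
      = fieldDer P (w a b) + ∑ i, (pd a (P i) * w i b + pd b (P i) * w a i) := by
  simp only [lieDeriv, fieldDer_apply, ← Finset.sum_add_distrib]
  exact Finset.sum_congr rfl fun i _ => by ring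

theorem lieDeriv_fieldBracket (P Q : VField) (w : FormArray) :
    lieDeriv (fieldBracket P Q) w = lieDeriv P (lieDeriv Q w) - lieDeriv Q (lieDeriv P w) := by
  funext a b
  have h : ∀ P Q : VField, lieDeriv P (lieDeriv Q w) a b
      = fieldDer P (fieldDer Q (w a b))
        + ∑ i, ((fieldDer P (pd a (Q i)) + ∑ k, pd a (P k) * pd k (Q i)) * w i b
          + (fieldDer P (pd b (Q i)) + ∑ k, pd b (P k) * pd k (Q i)) * w a i)
        + (∑ i, (pd a (Q i) * fieldDer P (w i b) + pd b (Q i) * fieldDer P (w a i))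
          + ∑ i, (pd a (P i) * fieldDer Q (w i b) + pd b (P i) * fieldDer Q (w a i)))
        + (∑ i, ∑ k, pd a (P i) * pd b (Q k) * w i k
          + ∑ i, ∑ k, pd a (Q i) * pd b (P k) * w i k) := by
    intro P Q
    rw [lieDeriv_apply]
    simp only [lieDeriv_apply Q, map_add, map_sum, Derivation.leibniz, smul_eq_mul, add_mul,
      mul_add, Finset.sum_add_distrib, Finset.mul_sum, Finset.sum_mul]
    have e1 : ∑ i, ∑ k, pd a (P i) * (pd i (Q k) * w k b)
        = ∑ i, ∑ k, pd a (P k) * pd k (Q i) * w i b := by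
      rw [Finset.sum_comm]
      exact Finset.sum_congr rfl fun i _ => Finset.sum_congr rfl fun k _ => by ring
    have e2 : ∑ i, ∑ k, pd b (P i) * (pd i (Q k) * w a k)
        = ∑ i, ∑ k, pd b (P k) * pd k (Q i) * w a i := by
      rw [Finset.sum_comm]
      exact Finset.sum_congr rfl fun i _ => Finset.sum_congr rfl fun k _ => by ring
    have e3 : ∑ i, ∑ k, pd a (P i) * (pd b (Q k) * w i k)
        = ∑ i, ∑ k, pd a (P i) * pd b (Q k) * w i k :=
      Finset.sum_congr rfl fun i _ => Finset.sum_congr rfl fun k _ => by ring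
    have e4 : ∑ i, ∑ k, pd b (P i) * (pd a (Q k) * w k i)
        = ∑ i, ∑ k, pd a (Q i) * pd b (P k) * w i k := by
      rw [Finset.sum_comm]
      exact Finset.sum_congr rfl fun i _ => Finset.sum_congr rfl fun k _ => by ring
    have e5 : ∀ c : Fin 5 → PS, ∀ g : Fin 5 → PS,
        ∑ i, c i * fieldDer P (g i) = ∑ i, fieldDer P (g i) * c i :=
      fun c g => Finset.sum_congr rfl fun i _ => mul_comm _ _
    rw [e1, e2, e3, e4, e5 (fun i => w i b) (fun i => pd a (Q i)),
      e5 (fun i => w a i) (fun i => pd b (Q i))]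
    ring
  rw [Pi.sub_apply, Pi.sub_apply, h P Q, h Q P, lieDeriv_apply, fieldDer_fieldBracket]
  have e : ∀ c i, pd c (fieldBracket P Q i)
      = (fieldDer P (pd c (Q i)) + ∑ k, pd c (P k) * pd k (Q i))
        - (fieldDer Q (pd c (P i)) + ∑ k, pd c (Q k) * pd k (P i)) := by
    intro c i
    rw [fieldBracket_apply, map_sub, pd_fieldDer, pd_fieldDer]
  simp only [e, sub_mul, Finset.sum_add_distrib, Finset.sum_sub_distrib]
  ring

set_option linter.unusedSimpArgs false in
set_option maxHeartbeats 1000000 in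
/-- The components of the vector field of a product of two `2`-forms, without repetitions. -/
theorem formBracket_apply {v w : FormArray} (hv : ∀ a b, v a b = - v b a)
    (hw : ∀ a b, w a b = - w b a) (i : Fin 5) :
    formBracket v w i = (-1) ^ (i : ℕ) *
      (v (i.succAbove 0) (i.succAbove 1) * w (i.succAbove 2) (i.succAbove 3)
        - v (i.succAbove 0) (i.succAbove 2) * w (i.succAbove 1) (i.succAbove 3)
        + v (i.succAbove 0) (i.succAbove 3) * w (i.succAbove 1) (i.succAbove 2)
        + v (i.succAbove 2) (i.succAbove 3) * w (i.succAbove 0) (i.succAbove 1)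
        - v (i.succAbove 1) (i.succAbove 3) * w (i.succAbove 0) (i.succAbove 2)
        + v (i.succAbove 1) (i.succAbove 2) * w (i.succAbove 0) (i.succAbove 3)) := by
  suffices h : ∑ j, ∑ k, ∑ l, ∑ m, levi i j k l m • (v j k * w l m) = (4 : ℂ) • ((-1) ^ (i : ℕ) *
      (v (i.succAbove 0) (i.succAbove 1) * w (i.succAbove 2) (i.succAbove 3)
        - v (i.succAbove 0) (i.succAbove 2) * w (i.succAbove 1) (i.succAbove 3)
        + v (i.succAbove 0) (i.succAbove 3) * w (i.succAbove 1) (i.succAbove 2)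
        + v (i.succAbove 2) (i.succAbove 3) * w (i.succAbove 0) (i.succAbove 1)
        - v (i.succAbove 1) (i.succAbove 3) * w (i.succAbove 0) (i.succAbove 2)
        + v (i.succAbove 1) (i.succAbove 2) * w (i.succAbove 0) (i.succAbove 3))) by
    rw [formBracket, h, smul_smul]
    norm_num
  rw [show (4 : ℂ) = ((4 : ℕ) : ℂ) by norm_num, Nat.cast_smul_eq_nsmul]
  fin_cases i <;>
  · simp only [Fin.sum_univ_five]
    simp [levi, cmpSign, Fin.succAbove, Fin.lt_def]
    simp only [hv 1 0, hv 2 0, hv 3 0, hv 4 0, hv 2 1, hv 3 1, hv 4 1, hv 3 2, hv 4 2, hv 4 3,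
      hw 1 0, hw 2 0, hw 3 0, hw 4 0, hw 2 1, hw 3 1, hw 4 1, hw 3 2, hw 4 2, hw 4 3]
    ring

theorem skew_self {v : FormArray} (hv : ∀ a b, v a b = - v b a) (a : Fin 5) : v a a = 0 := by
  have h := hv a a
  have h2 : (2 : ℂ) • v a a = 0 := by
    rw [two_smul]
    nth_rewrite 1 [h]
    exact neg_add_cancel _
  exact (smul_eq_zero.mp h2).resolve_left two_ne_zero

theorem lieDeriv_skew {v : FormArray} (P : VField) (hv : ∀ a b, v a b = - v b a) (a b : Fin 5) :
    lieDeriv P v a b = - lieDeriv P v b a := by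
  simp only [lieDeriv]
  rw [← Finset.sum_neg_distrib]
  refine Finset.sum_congr rfl fun i _ => ?_
  rw [hv b a, hv b i, hv i a, map_neg]
  ring

set_option linter.unusedSimpArgs false in
set_option maxHeartbeats 1000000 in
theorem fieldBracket_formBracket {P : VField} {v w : FormArray} (hP : divergence P = 0)
    (hv : ∀ a b, v a b = - v b a) (hw : ∀ a b, w a b = - w b a) :
    fieldBracket P (formBracket v w)
      = formBracket (lieDeriv P v) w + formBracket v (lieDeriv P w) := by
  have h0 : pd 0 (P 0) = - (pd 1 (P 1) + pd 2 (P 2) + pd 3 (P 3) + pd 4 (P 4)) := by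
    rw [divergence, Fin.sum_univ_five] at hP
    linear_combination hP
  funext i
  rw [fieldBracket_apply, fieldDer_apply (formBracket v w), Pi.add_apply,
    formBracket_apply (lieDeriv_skew P hv) hw, formBracket_apply hv (lieDeriv_skew P hw)]
  simp only [formBracket_apply hv hw, lieDeriv_apply, Fin.sum_univ_five]
  fin_cases i <;>
  · simp [Fin.succAbove, Fin.lt_def]
    simp only [skew_self hv, skew_self hw,
      hv 1 0, hv 2 0, hv 3 0, hv 4 0, hv 2 1, hv 3 1, hv 4 1, hv 3 2, hv 4 2, hv 4 3,
      hw 1 0, hw 2 0, hw 3 0, hw 4 0, hw 2 1, hw 3 1, hw 4 1, hw 3 2, hw 4 2, hw 4 3, h0]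
    ring

/-- Contracting a `2`-form with the vector field of a product of two `2`-forms and summing
cyclically gives zero: the contraction of `u ∧ v ∧ w = 0` with the volume form. -/
theorem contraction_formBracket {u v w : FormArray} (hu : ∀ a b, u a b = - u b a)
    (hv : ∀ a b, v a b = - v b a) (hw : ∀ a b, w a b = - w b a) (b : Fin 5) :
    ∑ i, formBracket v w i * u i b + ∑ i, formBracket w u i * v i b
      + ∑ i, formBracket u v i * w i b = 0 := by
  simp only [formBracket_apply hv hw, formBracket_apply hw hu, formBracket_apply hu hv,
    Fin.sum_univ_five]
  fin_cases b <;>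
  · simp [Fin.succAbove, Fin.lt_def]
    simp only [skew_self hv, skew_self hw, skew_self hu,
      hu 1 0, hu 2 0, hu 3 0, hu 4 0, hu 2 1, hu 3 1, hu 4 1, hu 3 2, hu 4 2, hu 4 3,
      hv 1 0, hv 2 0, hv 3 0, hv 4 0, hv 2 1, hv 3 1, hv 4 1, hv 3 2, hv 4 2, hv 4 3,
      hw 1 0, hw 2 0, hw 3 0, hw 4 0, hw 2 1, hw 3 1, hw 4 1, hw 3 2, hw 4 2, hw 4 3]
    ring

/-- Cartan's formula for the Lie derivative of a closed `2`-form. -/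
theorem lieDeriv_eq_exact (P : VField) {w : FormArray} (hw : w ∈ closedForms) (a b : Fin 5) :
    lieDeriv P w a b = pd a (∑ i, P i * w i b) - pd b (∑ i, P i * w i a) := by
  simp only [lieDeriv, map_sum, ← Finset.sum_sub_distrib]
  refine Finset.sum_congr rfl fun i _ => ?_
  have h := hw.2 i a b
  simp only [Derivation.leibniz, smul_eq_mul]
  rw [hw.1 b i, map_neg] at h
  rw [hw.1 a i]
  linear_combination P i * h

theorem lieDeriv_formBracket_cyclic {u v w : FormArray} (hu : u ∈ closedForms)
    (hv : v ∈ closedForms) (hw : w ∈ closedForms) :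
    lieDeriv (formBracket v w) u + lieDeriv (formBracket w u) v
      + lieDeriv (formBracket u v) w = 0 := by
  funext a b
  have h := contraction_formBracket hu.1 hv.1 hw.1
  simp only [Pi.add_apply, lieDeriv_eq_exact _ hu, lieDeriv_eq_exact _ hv, lieDeriv_eq_exact _ hw,
    Pi.zero_apply]
  have ha := congrArg (pd b) (h a)
  have hb := congrArg (pd a) (h b)
  rw [map_add, map_add, map_zero] at ha hb
  linear_combination hb - ha

theorem formBracket_comm (v w : FormArray) : formBracket v w = formBracket w v := by
  funext i
  have c : ∀ G : Fin 5 → Fin 5 → Fin 5 → Fin 5 → PS,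
      ∑ j, ∑ k, ∑ l, ∑ m, G j k l m = ∑ j, ∑ k, ∑ l, ∑ m, G l m j k := by
    intro G
    have : ∀ H : Fin 5 × Fin 5 → Fin 5 × Fin 5 → PS,
        ∑ p, ∑ q, H p q = ∑ p, ∑ q, H q p := fun H => Finset.sum_comm
    simpa [Fintype.sum_prod_type] using this fun p q => G p.1 p.2 q.1 q.2
  rw [formBracket, formBracket, c]
  refine congrArg _ (Finset.sum_congr rfl fun j _ => Finset.sum_congr rfl fun k _ =>
    Finset.sum_congr rfl fun l _ => Finset.sum_congr rfl fun m _ => ?_)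
  rw [levi_swap i l m j k, mul_comm]

/-! ### The superbracket as a bilinear map -/

theorem fieldDer_add (P Q : VField) (f : PS) :
    fieldDer (P + Q) f = fieldDer P f + fieldDer Q f := by
  simp only [fieldDer_apply, Pi.add_apply, add_mul, Finset.sum_add_distrib]

theorem fieldDer_smul (c : ℂ) (P : VField) (f : PS) :
    fieldDer (c • P) f = c • fieldDer P f := by
  simp only [fieldDer_apply, Pi.smul_apply, smul_mul_assoc, Finset.smul_sum]

theorem fieldBracket_add_left (P P' Q : VField) :
    fieldBracket (P + P') Q = fieldBracket P Q + fieldBracket P' Q := by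
  funext j
  simp only [fieldBracket_apply, Pi.add_apply, fieldDer_add, map_add]
  ring

theorem fieldBracket_smul_left (c : ℂ) (P Q : VField) :
    fieldBracket (c • P) Q = c • fieldBracket P Q := by
  funext j
  simp only [fieldBracket_apply, Pi.smul_apply, fieldDer_smul, Derivation.map_smul, smul_sub]

theorem fieldBracket_skew (P Q : VField) : fieldBracket P Q = - fieldBracket Q P := by
  funext j
  simp only [fieldBracket_apply, Pi.neg_apply, neg_sub]

theorem lieDeriv_add_left (P P' : VField) (w : FormArray) :
    lieDeriv (P + P') w = lieDeriv P w + lieDeriv P' w := by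
  funext a b
  simp only [lieDeriv, Pi.add_apply, map_add, ← Finset.sum_add_distrib]
  exact Finset.sum_congr rfl fun i _ => by ring

theorem lieDeriv_smul_left (c : ℂ) (P : VField) (w : FormArray) :
    lieDeriv (c • P) w = c • lieDeriv P w := by
  funext a b
  simp only [lieDeriv, Pi.smul_apply, Derivation.map_smul, Finset.smul_sum, smul_add,
    smul_mul_assoc]

theorem lieDeriv_add_right (P : VField) (w w' : FormArray) :
    lieDeriv P (w + w') = lieDeriv P w + lieDeriv P w' := by
  funext a b
  simp only [lieDeriv, Pi.add_apply, map_add, ← Finset.sum_add_distrib]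
  exact Finset.sum_congr rfl fun i _ => by ring

theorem lieDeriv_smul_right (c : ℂ) (P : VField) (w : FormArray) :
    lieDeriv P (c • w) = c • lieDeriv P w := by
  funext a b
  simp only [lieDeriv, Pi.smul_apply, Derivation.map_smul, Finset.smul_sum, smul_add,
    mul_smul_comm]

theorem formBracket_add_left (v v' w : FormArray) :
    formBracket (v + v') w = formBracket v w + formBracket v' w := by
  funext i
  simp only [formBracket, Pi.add_apply, add_mul, smul_add, Finset.sum_add_distrib]

theorem formBracket_smul_left (c : ℂ) (v w : FormArray) :
    formBracket (c • v) w = c • formBracket v w := by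
  funext i
  simp only [formBracket, Pi.smul_apply, smul_mul_assoc, smul_comm _ c, ← Finset.smul_sum]

/-- The superbracket of `E(5,10)` as a bilinear map. -/
def lieB : L →ₗ[ℂ] L →ₗ[ℂ] L :=
  LinearMap.mk₂ ℂ bracket
    (by
      intro x x' y
      refine Prod.ext (Subtype.ext ?_) (Subtype.ext ?_)
      · change fieldBracket (x.1.1 + x'.1.1) y.1.1 + formBracket (x.2.1 + x'.2.1) y.2.1
          = fieldBracket x.1.1 y.1.1 + formBracket x.2.1 y.2.1
            + (fieldBracket x'.1.1 y.1.1 + formBracket x'.2.1 y.2.1)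
        rw [fieldBracket_add_left, formBracket_add_left]
        abel
      · change lieDeriv (x.1.1 + x'.1.1) y.2.1 - lieDeriv y.1.1 (x.2.1 + x'.2.1)
          = lieDeriv x.1.1 y.2.1 - lieDeriv y.1.1 x.2.1
            + (lieDeriv x'.1.1 y.2.1 - lieDeriv y.1.1 x'.2.1)
        rw [lieDeriv_add_left, lieDeriv_add_right]
        abel)
    (by
      intro c x y
      refine Prod.ext (Subtype.ext ?_) (Subtype.ext ?_)
      · change fieldBracket (c • x.1.1) y.1.1 + formBracket (c • x.2.1) y.2.1
          = c • (fieldBracket x.1.1 y.1.1 + formBracket x.2.1 y.2.1)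
        rw [fieldBracket_smul_left, formBracket_smul_left, smul_add]
      · change lieDeriv (c • x.1.1) y.2.1 - lieDeriv y.1.1 (c • x.2.1)
          = c • (lieDeriv x.1.1 y.2.1 - lieDeriv y.1.1 x.2.1)
        rw [lieDeriv_smul_left, lieDeriv_smul_right, smul_sub])
    (by
      intro y x x'
      refine Prod.ext (Subtype.ext ?_) (Subtype.ext ?_)
      · change fieldBracket y.1.1 (x.1.1 + x'.1.1) + formBracket y.2.1 (x.2.1 + x'.2.1)
          = fieldBracket y.1.1 x.1.1 + formBracket y.2.1 x.2.1
            + (fieldBracket y.1.1 x'.1.1 + formBracket y.2.1 x'.2.1)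
        rw [fieldBracket_skew, fieldBracket_skew y.1.1 x.1.1, fieldBracket_skew y.1.1 x'.1.1,
          fieldBracket_add_left, formBracket_comm, formBracket_add_left,
          formBracket_comm y.2.1 x.2.1, formBracket_comm y.2.1 x'.2.1]
        abel
      · change lieDeriv y.1.1 (x.2.1 + x'.2.1) - lieDeriv (x.1.1 + x'.1.1) y.2.1
          = lieDeriv y.1.1 x.2.1 - lieDeriv x.1.1 y.2.1
            + (lieDeriv y.1.1 x'.2.1 - lieDeriv x'.1.1 y.2.1)
        rw [lieDeriv_add_left, lieDeriv_add_right]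
        abel)
    (by
      intro c y x
      refine Prod.ext (Subtype.ext ?_) (Subtype.ext ?_)
      · change fieldBracket y.1.1 (c • x.1.1) + formBracket y.2.1 (c • x.2.1)
          = c • (fieldBracket y.1.1 x.1.1 + formBracket y.2.1 x.2.1)
        rw [fieldBracket_skew, fieldBracket_skew y.1.1 x.1.1, fieldBracket_smul_left,
          formBracket_comm, formBracket_smul_left, formBracket_comm y.2.1 x.2.1, smul_add, smul_neg]
      · change lieDeriv y.1.1 (c • x.2.1) - lieDeriv (c • x.1.1) y.2.1
          = c • (lieDeriv y.1.1 x.2.1 - lieDeriv x.1.1 y.2.1)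
        rw [lieDeriv_smul_left, lieDeriv_smul_right, smul_sub])

theorem lieB_fst (x y : L) :
    (lieB x y).1.1 = fieldBracket x.1.1 y.1.1 + formBracket x.2.1 y.2.1 := rfl

theorem even_add_odd (x : L) : even x.1 + odd x.2 = x :=
  Prod.ext (add_zero _) (zero_add _)

theorem fieldBracket_zero_left (Q : VField) : fieldBracket 0 Q = 0 := by
  simpa using fieldBracket_smul_left 0 0 Q

theorem fieldBracket_zero_right (Q : VField) : fieldBracket Q 0 = 0 := by
  rw [fieldBracket_skew, fieldBracket_zero_left, neg_zero]

theorem lieDeriv_zero_left (w : FormArray) : lieDeriv 0 w = 0 := by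
  simpa using lieDeriv_smul_left 0 0 w

theorem lieDeriv_zero_right (P : VField) : lieDeriv P 0 = 0 := by
  simpa using lieDeriv_smul_right 0 P 0

theorem formBracket_zero_left (w : FormArray) : formBracket 0 w = 0 := by
  simpa using formBracket_smul_left 0 0 w

theorem formBracket_zero_right (w : FormArray) : formBracket w 0 = 0 := by
  rw [formBracket_comm, formBracket_zero_left]

theorem lieB_even_even (P Q : divFree) :
    lieB (even P) (even Q) = even ⟨fieldBracket P.1 Q.1, fieldBracket_mem P.2 Q.2⟩ := by
  refine Prod.ext (Subtype.ext ?_) (Subtype.ext ?_)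
  · change fieldBracket P.1 Q.1 + formBracket 0 0 = fieldBracket P.1 Q.1
    rw [formBracket_zero_left, add_zero]
  · change lieDeriv P.1 0 - lieDeriv Q.1 0 = 0
    rw [lieDeriv_zero_right, lieDeriv_zero_right, sub_zero]

theorem lieB_even_odd (P : divFree) (w : closedForms) :
    lieB (even P) (odd w) = odd ⟨lieDeriv P.1 w.1, lieDeriv_mem w.2⟩ := by
  refine Prod.ext (Subtype.ext ?_) (Subtype.ext ?_)
  · change fieldBracket P.1 0 + formBracket 0 w.1 = 0
    rw [formBracket_zero_left, fieldBracket_zero_right, add_zero]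
  · change lieDeriv P.1 w.1 - lieDeriv 0 0 = lieDeriv P.1 w.1
    rw [lieDeriv_zero_right, sub_zero]

theorem lieB_odd_odd (v w : closedForms) :
    lieB (odd v) (odd w) = even ⟨formBracket v.1 w.1, formBracket_mem v.2 w.2⟩ := by
  refine Prod.ext (Subtype.ext ?_) (Subtype.ext ?_)
  · change fieldBracket 0 0 + formBracket v.1 w.1 = formBracket v.1 w.1
    rw [fieldBracket_zero_right, zero_add]
  · change lieDeriv 0 w.1 - lieDeriv 0 v.1 = 0
    rw [lieDeriv_zero_left, lieDeriv_zero_left, sub_zero]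

theorem lieB_even_skew (P : divFree) (y : L) : lieB (even P) y = - lieB y (even P) := by
  refine Prod.ext (Subtype.ext ?_) (Subtype.ext ?_)
  · change fieldBracket P.1 y.1.1 + formBracket 0 y.2.1
      = -(fieldBracket y.1.1 P.1 + formBracket y.2.1 0)
    rw [fieldBracket_skew, formBracket_zero_left, formBracket_zero_right, add_zero, add_zero]
  · change lieDeriv P.1 y.2.1 - lieDeriv y.1.1 0 = -(lieDeriv y.1.1 0 - lieDeriv P.1 y.2.1)
    rw [neg_sub]

theorem lieB_odd_comm (v w : closedForms) : lieB (odd v) (odd w) = lieB (odd w) (odd v) := by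
  rw [lieB_odd_odd, lieB_odd_odd]
  exact congrArg even (Subtype.ext (formBracket_comm _ _))

/-- The super Jacobi identity with an even element in the middle. -/
theorem lieB_jacobi_even (x : L) (P : divFree) (y : L) :
    lieB (lieB x (even P)) y = lieB x (lieB (even P) y) + lieB (lieB x y) (even P) := by
  refine Prod.ext (Subtype.ext ?_) (Subtype.ext ?_)
  · change fieldBracket (fieldBracket x.1.1 P.1 + formBracket x.2.1 0) y.1.1
        + formBracket (lieDeriv x.1.1 0 - lieDeriv P.1 x.2.1) y.2.1
      = fieldBracket x.1.1 (fieldBracket P.1 y.1.1 + formBracket 0 y.2.1)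
        + formBracket x.2.1 (lieDeriv P.1 y.2.1 - lieDeriv y.1.1 0)
        + (fieldBracket (fieldBracket x.1.1 y.1.1 + formBracket x.2.1 y.2.1) P.1
          + formBracket (lieDeriv x.1.1 y.2.1 - lieDeriv y.1.1 x.2.1) 0)
    have h := fieldBracket_formBracket P.2 x.2.2.1 y.2.2.1
    rw [formBracket_zero_right, formBracket_zero_left, formBracket_zero_right,
      lieDeriv_zero_right, lieDeriv_zero_right, add_zero, add_zero, add_zero, sub_zero, zero_sub,
      fieldBracket_add_left, fieldBracket_jacobi, fieldBracket_skew (formBracket x.2.1 y.2.1), h,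
      ← neg_one_smul ℂ (lieDeriv P.1 x.2.1), formBracket_smul_left]
    module
  · change lieDeriv (fieldBracket x.1.1 P.1 + formBracket x.2.1 0) y.2.1
        - lieDeriv y.1.1 (lieDeriv x.1.1 0 - lieDeriv P.1 x.2.1)
      = lieDeriv x.1.1 (lieDeriv P.1 y.2.1 - lieDeriv y.1.1 0)
        - lieDeriv (fieldBracket P.1 y.1.1 + formBracket 0 y.2.1) x.2.1
        + (lieDeriv (fieldBracket x.1.1 y.1.1 + formBracket x.2.1 y.2.1) 0
          - lieDeriv P.1 (lieDeriv x.1.1 y.2.1 - lieDeriv y.1.1 x.2.1))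
    rw [formBracket_zero_right, formBracket_zero_left, lieDeriv_zero_right,
      lieDeriv_zero_right, lieDeriv_zero_right, add_zero, add_zero, sub_zero, zero_sub,
      lieDeriv_fieldBracket, lieDeriv_fieldBracket, sub_eq_add_neg (lieDeriv x.1.1 y.2.1),
      lieDeriv_add_right, ← neg_one_smul ℂ (lieDeriv P.1 x.2.1),
      ← neg_one_smul ℂ (lieDeriv y.1.1 x.2.1), lieDeriv_smul_right, lieDeriv_smul_right]
    module

/-- The super Jacobi identity with two odd elements on the right. -/
theorem lieB_jacobi_odd (x : L) (v w : closedForms) :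
    lieB (lieB x (odd v)) (odd w) + lieB (lieB x (odd w)) (odd v)
      = lieB x (lieB (odd v) (odd w)) := by
  refine Prod.ext (Subtype.ext ?_) (Subtype.ext ?_)
  · change fieldBracket (fieldBracket x.1.1 0 + formBracket x.2.1 v.1) 0
        + formBracket (lieDeriv x.1.1 v.1 - lieDeriv 0 x.2.1) w.1
        + (fieldBracket (fieldBracket x.1.1 0 + formBracket x.2.1 w.1) 0
        + formBracket (lieDeriv x.1.1 w.1 - lieDeriv 0 x.2.1) v.1)
      = fieldBracket x.1.1 (fieldBracket 0 0 + formBracket v.1 w.1)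
        + formBracket x.2.1 (lieDeriv 0 w.1 - lieDeriv 0 v.1)
    rw [lieDeriv_zero_left, lieDeriv_zero_left, lieDeriv_zero_left, sub_zero, sub_zero, sub_zero,
      formBracket_zero_right, fieldBracket_zero_right, fieldBracket_zero_right,
      fieldBracket_zero_right, zero_add, zero_add, zero_add, add_zero,
      fieldBracket_formBracket x.1.2 v.2.1 w.2.1,
      formBracket_comm v.1 (lieDeriv _ _)]
  · change lieDeriv (fieldBracket x.1.1 0 + formBracket x.2.1 v.1) w.1
        - lieDeriv 0 (lieDeriv x.1.1 v.1 - lieDeriv 0 x.2.1)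
        + (lieDeriv (fieldBracket x.1.1 0 + formBracket x.2.1 w.1) v.1
        - lieDeriv 0 (lieDeriv x.1.1 w.1 - lieDeriv 0 x.2.1))
      = lieDeriv x.1.1 (lieDeriv 0 w.1 - lieDeriv 0 v.1)
        - lieDeriv (fieldBracket 0 0 + formBracket v.1 w.1) x.2.1
    have h := lieDeriv_formBracket_cyclic x.2.2 v.2 w.2
    rw [formBracket_comm w.1] at h
    simp only [lieDeriv_zero_left, fieldBracket_zero_right, zero_add, sub_zero,
      lieDeriv_zero_right, zero_sub]
    rw [eq_neg_iff_add_eq_zero, ← h]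
    abel

/-- The parity operator: `1` on the even part, `-1` on the odd part. -/
def parity : L →ₗ[ℂ] L :=
  LinearMap.prodMap LinearMap.id (-LinearMap.id)

@[simp] theorem parity_even (P : divFree) : parity (even P) = even P :=
  Prod.ext rfl neg_zero

@[simp] theorem parity_odd (w : closedForms) : parity (odd w) = - odd w :=
  Prod.ext neg_zero.symm rfl

@[simp] theorem parity_parity (x : L) : parity (parity x) = x :=
  Prod.ext rfl (neg_neg x.2)

theorem parity_lieB_even (x : L) (P : divFree) :
    parity (lieB x (even P)) = lieB (parity x) (even P) := by
  obtain ⟨Q, v⟩ := x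
  have e : ((Q, v) : L) = even Q + odd v := (even_add_odd (Q, v)).symm
  simp only [e, map_add, parity_odd, parity_even, LinearMap.add_apply, lieB_even_even, map_neg,
    LinearMap.neg_apply, neg_eq_iff_eq_neg.mp (lieB_even_skew P (odd v)).symm, lieB_even_odd]

theorem parity_lieB_odd (x : L) (w : closedForms) :
    parity (lieB x (odd w)) = - lieB (parity x) (odd w) := by
  obtain ⟨Q, v⟩ := x
  have e : ((Q, v) : L) = even Q + odd v := (even_add_odd (Q, v)).symm
  simp only [e, map_add, parity_odd, parity_even, LinearMap.add_apply, lieB_odd_odd, map_neg,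
    LinearMap.neg_apply, lieB_even_odd, neg_add, neg_neg]

/-! ### Constant and linear parts -/

theorem constantCoeff_pd (i : Fin 5) (f : PS) :
    MvPowerSeries.constantCoeff (pd i f) = MvPowerSeries.coeff (Finsupp.single i 1) f := by
  rw [← MvPowerSeries.coeff_zero_eq_constantCoeff_apply, MvPowerSeries.coeff_pderiv]
  simp

theorem linPart_apply (x : L) (i j : Fin 5) :
    (linPart x).1 i j = MvPowerSeries.constantCoeff (pd i (x.1.1 j)) := by
  rw [constantCoeff_pd]
  rfl

/-- `linPart` as a linear map. -/
def linPartL : L →ₗ[ℂ] sl5 where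
  toFun := linPart
  map_add' x y := Subtype.ext (Matrix.ext fun i j => by
    change (linPart (x + y)).1 i j = (linPart x).1 i j + (linPart y).1 i j
    simp [linPart_apply])
  map_smul' c x := Subtype.ext (Matrix.ext fun i j => by
    change (linPart (c • x)).1 i j = c * (linPart x).1 i j
    simp [linPart_apply])

@[simp] theorem linPartL_apply (x : L) : linPartL x = linPart x := rfl

theorem lieB_mem_nonnegPart {x y : L} (hx : x ∈ nonnegPart) (hy : y ∈ nonnegPart) :
    lieB x y ∈ nonnegPart := by
  obtain ⟨hx1, hx2⟩ := hx
  obtain ⟨hy1, hy2⟩ := hy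
  refine ⟨fun i => ?_, fun i j => ?_⟩
  · change MvPowerSeries.constantCoeff (fieldBracket x.1.1 y.1.1 i + formBracket x.2.1 y.2.1 i) = 0
    simp [fieldBracket, formBracket, hx1, hy1, hx2]
  · change MvPowerSeries.constantCoeff (lieDeriv x.1.1 y.2.1 i j - lieDeriv y.1.1 x.2.1 i j) = 0
    simp [lieDeriv, hx1, hy1, hx2, hy2]

theorem linPart_lieB {x y : L} (hx : x ∈ nonnegPart) (hy : y ∈ nonnegPart) :
    linPart (lieB x y) = ⁅linPart x, linPart y⁆ := by
  obtain ⟨hx1, hx2⟩ := hx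
  obtain ⟨hy1, hy2⟩ := hy
  refine Subtype.ext (Matrix.ext fun i j => ?_)
  have e : (⁅linPart x, linPart y⁆ : sl5).1 i j
      = ∑ l, ((linPart x).1 i l * (linPart y).1 l j - (linPart y).1 i l * (linPart x).1 l j) := by
    change ((linPart x).1 * (linPart y).1 - (linPart y).1 * (linPart x).1) i j = _
    rw [Matrix.sub_apply, Matrix.mul_apply, Matrix.mul_apply, Finset.sum_sub_distrib]
  rw [e, linPart_apply, lieB_fst, Pi.add_apply]
  have h2 : MvPowerSeries.constantCoeff (pd i (formBracket x.2.1 y.2.1 j)) = 0 := by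
    simp [formBracket, hx2, hy2, Derivation.leibniz]
  rw [map_add, map_add, h2, add_zero]
  simp only [linPart_apply, fieldBracket, map_sum, map_sub, map_add, Derivation.leibniz,
    smul_eq_mul,
    map_mul, hx1, hy1]
  refine Finset.sum_congr rfl fun l _ => ?_
  ring


/-! ### The enveloping algebra of the negative part -/

/-- The formal symbols for the generators `dᵢⱼ` and `∂ᵢ` of the negative part. -/
abbrev NegGen : Type := (Fin 5 × Fin 5) ⊕ Fin 5

/-- The defining relations of the enveloping algebra of `L₋` in terms of its generators. -/
inductive NegRel : FreeAlgebra ℂ NegGen → FreeAlgebra ℂ NegGen → Prop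
  | skew (i j : Fin 5) :
      NegRel (FreeAlgebra.ι ℂ (Sum.inl (i, j)) + FreeAlgebra.ι ℂ (Sum.inl (j, i))) 0
  | odd_odd (p q : Fin 5 × Fin 5) :
      NegRel (FreeAlgebra.ι ℂ (Sum.inl p) * FreeAlgebra.ι ℂ (Sum.inl q)
          + FreeAlgebra.ι ℂ (Sum.inl q) * FreeAlgebra.ι ℂ (Sum.inl p))
        (∑ i, (levi i p.1 p.2 q.1 q.2 : ℂ) • FreeAlgebra.ι ℂ (Sum.inr i))
  | central (g : NegGen) (i : Fin 5) :
      NegRel (FreeAlgebra.ι ℂ g * FreeAlgebra.ι ℂ (Sum.inr i))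
        (FreeAlgebra.ι ℂ (Sum.inr i) * FreeAlgebra.ι ℂ g)

/-- The enveloping algebra `U(L₋)`, given by generators and relations. -/
def NegUEA : Type := RingQuot NegRel

instance : Ring NegUEA := inferInstanceAs (Ring (RingQuot NegRel))

instance : Algebra ℂ NegUEA := inferInstanceAs (Algebra ℂ (RingQuot NegRel))

/-- The quotient map onto `U(L₋)`. -/
def NegUEA.mk : FreeAlgebra ℂ NegGen →ₐ[ℂ] NegUEA := RingQuot.mkAlgHom ℂ NegRel

theorem NegUEA.mk_rel {a b : FreeAlgebra ℂ NegGen} (h : NegRel a b) :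
    NegUEA.mk a = NegUEA.mk b := RingQuot.mkAlgHom_rel ℂ h

/-- The generators of `U(L₋)`. -/
def ng (g : NegGen) : NegUEA := NegUEA.mk (FreeAlgebra.ι ℂ g)

theorem ng_skew (i j : Fin 5) : ng (Sum.inl (i, j)) + ng (Sum.inl (j, i)) = 0 := by
  have h := NegUEA.mk_rel (NegRel.skew i j)
  rwa [map_add, map_zero] at h

theorem ng_odd_odd (p q : Fin 5 × Fin 5) :
    ng (Sum.inl p) * ng (Sum.inl q) + ng (Sum.inl q) * ng (Sum.inl p)
      = ∑ i, (levi i p.1 p.2 q.1 q.2 : ℂ) • ng (Sum.inr i) := by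
  have h := NegUEA.mk_rel (NegRel.odd_odd p q)
  simp only [map_add, map_mul, map_sum, map_smul] at h
  exact h

theorem ng_central (g : NegGen) (i : Fin 5) :
    ng g * ng (Sum.inr i) = ng (Sum.inr i) * ng g := by
  have h := NegUEA.mk_rel (NegRel.central g i)
  rwa [map_mul, map_mul] at h

/-- The universal property of `U(L₋)`. -/
def NegUEA.lift {A : Type*} [Ring A] [Algebra ℂ A] (f : NegGen → A)
    (h1 : ∀ i j, f (Sum.inl (i, j)) + f (Sum.inl (j, i)) = 0)
    (h2 : ∀ p q, f (Sum.inl p) * f (Sum.inl q) + f (Sum.inl q) * f (Sum.inl p)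
      = ∑ i, (levi i p.1 p.2 q.1 q.2 : ℂ) • f (Sum.inr i))
    (h3 : ∀ g i, f g * f (Sum.inr i) = f (Sum.inr i) * f g) : NegUEA →ₐ[ℂ] A :=
  RingQuot.liftAlgHom ℂ ⟨FreeAlgebra.lift ℂ f, by
    intro x y h
    cases h with
    | skew i j => simpa using h1 i j
    | odd_odd p q => simpa using h2 p q
    | central g i => simpa using h3 g i⟩

@[simp] theorem NegUEA.lift_ng {A : Type*} [Ring A] [Algebra ℂ A] (f : NegGen → A) (h1 h2 h3)
    (g : NegGen) : NegUEA.lift f h1 h2 h3 (ng g) = f g :=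
  (RingQuot.liftAlgHom_mkAlgHom_apply ℂ _ _ _).trans (FreeAlgebra.lift_ι_apply f g)

theorem NegUEA.induction {S : Set NegUEA} (h0 : ∀ c : ℂ, algebraMap ℂ NegUEA c ∈ S)
    (hg : ∀ g, ng g ∈ S) (hadd : ∀ a b, a ∈ S → b ∈ S → a + b ∈ S)
    (hmul : ∀ a b, a ∈ S → b ∈ S → a * b ∈ S) (u : NegUEA) : u ∈ S := by
  obtain ⟨x, rfl⟩ : ∃ x, NegUEA.mk x = u := RingQuot.mkAlgHom_surjective ℂ NegRel u
  induction x using FreeAlgebra.induction with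
  | grade0 c => simpa using h0 c
  | grade1 g => exact hg g
  | mul a b ha hb => rw [map_mul]; exact hmul _ _ ha hb
  | add a b ha hb => rw [map_add]; exact hadd _ _ ha hb

/-- The element of `E(5,10)` that belongs to a generator of `U(L₋)`. -/
def negElt : NegGen → L
  | Sum.inl p => odd (dForm p.1 p.2)
  | Sum.inr i => even (dField i)

/-- The sign change `x ↦ (-1)^{|x| |g|} x` for a generator `g`. -/
def genSign : NegGen → (L →ₗ[ℂ] L)
  | Sum.inl _ => parity
  | Sum.inr _ => LinearMap.id

theorem dForm_swap (i j : Fin 5) : dForm j i = - dForm i j :=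
  Subtype.ext (by
    funext k l
    change (if k = j ∧ l = i then (1 : PS) else 0) - (if k = i ∧ l = j then 1 else 0)
      = -((if k = i ∧ l = j then 1 else 0) - (if k = j ∧ l = i then 1 else 0))
    rw [neg_sub])

theorem odd_neg (w : closedForms) : odd (-w) = - odd w := Prod.ext neg_zero.symm rfl

theorem levi_swap_right (i j k l m : Fin 5) : levi i j k m l = - levi i j k l m := by
  rw [levi, levi, cmpSign_swap m l]
  ring

theorem sum_dForm (F : Fin 5 → Fin 5 → PS) (c : Fin 5 → Fin 5 → ℂ) (j k : Fin 5) :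
    ∑ l, ∑ m, c l m • (F l m * (dForm j k).1 l m)
      = c j k • F j k - c k j • F k j := by
  have h : ∀ l m, c l m • (F l m * (dForm j k).1 l m)
      = (if l = j then (if m = k then c l m • F l m else 0) else 0)
        - (if l = k then (if m = j then c l m • F l m else 0) else 0) := by
    intro l m
    change c l m • (F l m * ((if l = j ∧ m = k then 1 else 0) - (if l = k ∧ m = j then 1 else 0)))
      = _
    rw [mul_sub, smul_sub]
    congr 1
    · by_cases h1 : l = j <;> by_cases h2 : m = k <;> simp [h1, h2]
    · by_cases h1 : l = k <;> by_cases h2 : m = j <;> simp [h1, h2]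
  simp only [h, Finset.sum_sub_distrib, Finset.sum_ite_eq', Finset.sum_ite_irrel,
    Finset.sum_const_zero, Finset.mem_univ, if_true]

/-- The product of a `2`-form with `dxⱼ ∧ dxₖ`. -/
theorem formBracket_dForm (v : FormArray) (j k i : Fin 5) :
    formBracket v (dForm j k).1 i
      = (1 / 2 : ℂ) • ∑ a, ∑ b, (levi i a b j k : ℂ) • v a b := by
  rw [formBracket]
  have h : ∀ a b, ∑ l, ∑ m, levi i a b l m • (v a b * (dForm j k).1 l m)
      = (2 * levi i a b j k : ℂ) • v a b := by
    intro a b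
    have := sum_dForm (fun _ _ => v a b) (fun l m => (levi i a b l m : ℂ)) j k
    simp only [Int.cast_smul_eq_zsmul] at this
    rw [this, levi_swap_right i a b j k, neg_smul, sub_neg_eq_add, mul_smul, two_smul,
      Int.cast_smul_eq_zsmul]
  simp only [h, mul_smul, ← Finset.smul_sum]
  rw [smul_smul]
  norm_num

theorem formBracket_dForm_dForm (j k l m i : Fin 5) :
    formBracket (dForm j k).1 (dForm l m).1 i = (levi i j k l m : ℂ) • (1 : PS) := by
  rw [formBracket_dForm]
  have := sum_dForm (fun _ _ => 1) (fun a b => (levi i a b l m : ℂ)) j k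
  simp only [one_mul] at this
  have e : levi i k j l m = - levi i j k l m := by
    rw [levi_swap i k j, levi_swap_right, levi_swap i l m]
  rw [this, e, Int.cast_neg]
  module

theorem lieB_dForm_dForm (p q : Fin 5 × Fin 5) :
    lieB (odd (dForm p.1 p.2)) (odd (dForm q.1 q.2))
      = ∑ i, (levi i p.1 p.2 q.1 q.2 : ℂ) • even (dField i) := by
  rw [lieB_odd_odd]
  have e : ∀ i, even (dField i) = LinearMap.inl ℂ divFree closedForms (dField i) := fun _ => rfl
  simp only [e, ← map_smul, ← map_sum]
  refine congrArg even (Subtype.ext (funext fun i => ?_))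
  change formBracket _ _ i = _
  rw [formBracket_dForm_dForm, LinearMap.id_apply, AddSubmonoidClass.coe_finsetSum,
    Finset.sum_apply,
    Finset.sum_eq_single i]
  · change _ = (levi i p.1 p.2 q.1 q.2 : ℂ) • (if i = i then (1 : PS) else 0)
    rw [if_pos rfl]
  · intro j _ hj
    change (levi j p.1 p.2 q.1 q.2 : ℂ) • (if i = j then (1 : PS) else 0) = 0
    rw [if_neg hj.symm, smul_zero]
  · simp

theorem pd_dForm (i j k a b : Fin 5) : pd i ((dForm j k).1 a b) = 0 := by
  change pd i ((if a = j ∧ b = k then 1 else 0) - (if a = k ∧ b = j then 1 else 0)) = 0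
  split_ifs <;> simp

theorem pd_dField (i j k : Fin 5) : pd i ((dField j).1 k) = 0 := by
  change pd i (if k = j then 1 else 0) = 0
  split_ifs <;> simp

theorem lieB_negElt_dField (g : NegGen) (i : Fin 5) : lieB (negElt g) (even (dField i)) = 0 := by
  rw [← neg_eq_zero, ← lieB_even_skew]
  rcases g with p | j
  · refine (lieB_even_odd _ _).trans ?_
    refine Prod.ext rfl (Subtype.ext (funext fun a => funext fun b => ?_))
    change lieDeriv _ _ a b = 0
    simp only [lieDeriv, pd_dForm, pd_dField]
    simp
  · refine (lieB_even_even _ _).trans ?_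
    refine Prod.ext (Subtype.ext (funext fun a => ?_)) rfl
    change fieldBracket _ _ a = 0
    simp only [fieldBracket, pd_dField]
    simp

/-! ### The coinduction action -/

section Coind

variable (N : Type) [AddCommGroup N] [Module ℂ N] [Module NegUEA N] [IsScalarTower ℂ NegUEA N]

/-- The action of a generator of `U(L₋)` on linear maps `φ : L → N`: it is designed so that the
operators `x ↦ φ x = x n` transform as in an `L`-module, `x (g n) = [x, g] n ± g (x n)`. -/
def coindGen (g : NegGen) : Module.End ℂ (L →ₗ[ℂ] N) where
  toFun φ := φ ∘ₗ lieB.flip (negElt g) + (Algebra.lsmul ℂ ℂ N (ng g)) ∘ₗ φ ∘ₗ genSign g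
  map_add' φ ψ := by
    ext x <;> simp <;> abel
  map_smul' c φ := by
    ext x <;> simp [smul_comm c]

variable {N}

theorem coindGen_apply (g : NegGen) (φ : L →ₗ[ℂ] N) (x : L) :
    coindGen N g φ x = φ (lieB x (negElt g)) + ng g • φ (genSign g x) := rfl

variable (N)

/-- The action of `U(L₋)` on linear maps `L → N`. -/
def coind : NegUEA →ₐ[ℂ] Module.End ℂ (L →ₗ[ℂ] N) :=
  NegUEA.lift (coindGen N)
    (by
      intro i j
      refine LinearMap.ext fun φ => LinearMap.ext fun x => ?_
      change coindGen N _ φ x + coindGen N _ φ x = 0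
      have h : negElt (Sum.inl (j, i)) = - negElt (Sum.inl (i, j)) := by
        change odd (dForm j i) = - odd (dForm i j)
        rw [dForm_swap, odd_neg]
      have h2 := ng_skew i j
      rw [coindGen_apply, coindGen_apply, h, map_neg, map_neg, add_add_add_comm, add_neg_cancel,
        zero_add]
      change _ • φ (parity x) + _ • φ (parity x) = 0
      rw [← add_smul, h2, zero_smul])
    (by
      intro p q
      refine LinearMap.ext fun φ => LinearMap.ext fun x => ?_
      rw [LinearMap.sum_apply, LinearMap.sum_apply]
      change coindGen N _ (coindGen N _ φ) x + coindGen N _ (coindGen N _ φ) x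
        = ∑ i, (levi i p.1 p.2 q.1 q.2 : ℂ) • coindGen N _ φ x
      simp only [coindGen_apply]
      change φ (lieB (lieB x (odd _)) (odd _)) + ng _ • φ (parity (lieB x (odd _)))
          + ng _ • (φ (lieB (parity x) (odd _)) + ng _ • φ (parity (parity x)))
          + (φ (lieB (lieB x (odd _)) (odd _)) + ng _ • φ (parity (lieB x (odd _)))
          + ng _ • (φ (lieB (parity x) (odd _)) + ng _ • φ (parity (parity x))))
        = ∑ i, (levi i p.1 p.2 q.1 q.2 : ℂ) • (φ (lieB x (even (dField i))) + ng _ • φ x)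
      have h1 := congrArg φ (lieB_jacobi_odd x (dForm p.1 p.2) (dForm q.1 q.2))
      rw [lieB_dForm_dForm, map_sum, map_sum, map_add] at h1
      simp only [map_smul] at h1
      have h2 := congrArg (fun u => u • φ x) (ng_odd_odd p q)
      simp only [add_smul, Finset.sum_smul, smul_assoc, mul_smul] at h2
      simp only [smul_add, Finset.sum_add_distrib, ← h1, ← h2, parity_lieB_odd, map_neg, smul_neg,
        parity_parity]
      abel)
    (by
      intro g i
      refine LinearMap.ext fun φ => LinearMap.ext fun x => ?_
      change coindGen N _ (coindGen N _ φ) x = coindGen N _ (coindGen N _ φ) x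
      simp only [coindGen_apply]
      change φ (lieB (lieB x (negElt g)) (even _)) + ng _ • φ (lieB x (negElt g))
          + ng g • (φ (lieB (genSign g x) (even (dField i))) + ng _ • φ (genSign g x))
        = φ (lieB (lieB x (even (dField i))) (negElt g))
          + ng g • φ (genSign g (lieB x (even (dField i))))
          + ng _ • (φ (lieB x (negElt g)) + ng g • φ (genSign g x))
      have h1 : lieB (lieB x (even (dField i))) (negElt g)
          = lieB (lieB x (negElt g)) (even (dField i)) := by
        rw [lieB_jacobi_even, lieB_even_skew, lieB_negElt_dField]
        simp
      have h2 : genSign g (lieB x (even (dField i))) = lieB (genSign g x) (even (dField i)) := by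
        rcases g with p | j
        · exact parity_lieB_even x _
        · rfl
      rw [h1, h2, smul_add, smul_add, ← mul_smul, ← mul_smul, ng_central]
      abel)

variable {N}

theorem coind_ng (g : NegGen) (φ : L →ₗ[ℂ] N) (x : L) :
    coind N (ng g) φ x = φ (lieB x (negElt g)) + ng g • φ (genSign g x) := by
  rw [coind, NegUEA.lift_ng, coindGen_apply]

end Coind

/-! ### A model of the generalized Verma module -/

section Model

variable (W : Type) [AddCommGroup W] [Module ℂ W]

/-- The model `U(L₋) ⊗ W` of the generalized Verma module `M(W)`. -/
abbrev Model : Type := NegUEA ⊗[ℂ] W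

variable {W}

/-- Induction on the model: every vector arises from the `1 ⊗ w` by the generators of `U(L₋)`. -/
theorem Model.induction {p : Model W → Prop} (h1 : ∀ w, p ((1 : NegUEA) ⊗ₜ w))
    (hadd : ∀ m n, p m → p n → p (m + n)) (hsmul : ∀ (c : ℂ) m, p m → p (c • m))
    (hg : ∀ g m, p m → p (ng g • m)) (m : Model W) : p m := by
  have key : ∀ u : NegUEA, u ∈ {u : NegUEA | ∀ m, p m → p (u • m)} := by
    refine NegUEA.induction ?_ hg ?_ ?_
    · intro c m hm
      rw [algebraMap_smul]
      exact hsmul c m hm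
    · intro a b ha hb m hm
      rw [add_smul]
      exact hadd _ _ (ha m hm) (hb m hm)
    · intro a b ha hb m hm
      rw [mul_smul]
      exact ha _ (hb m hm)
  induction m using TensorProduct.induction_on with
  | zero => simpa using h1 0
  | add a b ha hb => exact hadd _ _ ha hb
  | tmul u w =>
    have := key u _ (h1 w)
    rwa [TensorProduct.smul_tmul', smul_eq_mul, mul_one] at this

/-- The constant part of an element of `E(5,10)`, as an element of `U(L₋)`. -/
def constPart : L →ₗ[ℂ] NegUEA where
  toFun x := ∑ i, MvPowerSeries.constantCoeff (x.1.1 i) • ng (Sum.inr i)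
    + (1 / 2 : ℂ) • ∑ i, ∑ j, MvPowerSeries.constantCoeff (x.2.1 i j) • ng (Sum.inl (i, j))
  map_add' x y := by
    simp only [Prod.fst_add, Prod.snd_add, Submodule.coe_add, Pi.add_apply, map_add, add_smul,
      Finset.sum_add_distrib, smul_add]
    abel
  map_smul' c x := by
    have h : ∀ f : PS, MvPowerSeries.constantCoeff (c • f)
        = c * MvPowerSeries.constantCoeff f := by simp
    simp only [Prod.smul_fst, Prod.smul_snd, Submodule.coe_smul, Pi.smul_apply, h, mul_smul,
      ← Finset.smul_sum, smul_add, RingHom.id_apply, smul_comm c (1 / 2 : ℂ)]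

variable [LieRingModule sl5 W] [LieModule ℂ sl5 W]

/-- The action of `L` on the vectors `1 ⊗ w`. -/
def baseAct : W →ₗ[ℂ] L →ₗ[ℂ] Model W :=
  LinearMap.mk₂ ℂ (fun w x => constPart x ⊗ₜ w + 1 ⊗ₜ ⁅linPart x, w⁆)
    (fun w w' x => by simp only [TensorProduct.tmul_add, lie_add]; abel)
    (fun c w x => by simp only [TensorProduct.tmul_smul, lie_smul, smul_add])
    (fun w x x' => by
      simp only [map_add, TensorProduct.add_tmul, ← linPartL_apply, add_lie,
        TensorProduct.tmul_add]
      abel)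
    (fun c w x => by
      simp only [map_smul, TensorProduct.smul_tmul', ← linPartL_apply, smul_lie,
        TensorProduct.tmul_smul, smul_add])

variable (W)

/-- The action of `E(5,10)` on the model, with the arguments exchanged. -/
def modelActFlip : Model W →ₗ[ℂ] L →ₗ[ℂ] Model W :=
  TensorProduct.lift
    (LinearMap.mk₂ ℂ (fun u w => coind (Model W) u (baseAct w))
      (fun u u' w => by rw [map_add, LinearMap.add_apply])
      (fun c u w => by rw [map_smul, LinearMap.smul_apply])
      (fun u w w' => by rw [map_add, map_add])
      (fun c u w => by rw [map_smul, map_smul]))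

/-- The action of `E(5,10)` on the model. -/
def modelAct : L →ₗ[ℂ] Module.End ℂ (Model W) := (modelActFlip W).flip

variable {W}

theorem modelAct_one_tmul (x : L) (w : W) :
    modelAct W x (1 ⊗ₜ w) = constPart x ⊗ₜ w + 1 ⊗ₜ ⁅linPart x, w⁆ := by
  change coind (Model W) 1 (baseAct w) x = _
  rw [map_one]
  rfl

theorem modelActFlip_smul (u : NegUEA) (m : Model W) :
    modelActFlip W (u • m) = coind (Model W) u (modelActFlip W m) := by
  induction m using TensorProduct.induction_on with
  | zero => simp
  | add a b ha hb => rw [smul_add, map_add, map_add, map_add, ha, hb]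
  | tmul v w =>
    rw [TensorProduct.smul_tmul']
    change coind (Model W) (u * v) (baseAct w) = _
    rw [map_mul]
    rfl

theorem modelAct_smul (x : L) (g : NegGen) (m : Model W) :
    modelAct W x (ng g • m)
      = modelAct W (lieB x (negElt g)) m + ng g • modelAct W (genSign g x) m := by
  change modelActFlip W (ng g • m) x = _
  rw [modelActFlip_smul, coind_ng]
  rfl

theorem constPart_negElt (g : NegGen) : constPart (negElt g) = ng g := by
  rcases g with ⟨i, j⟩ | i
  · change ∑ k, MvPowerSeries.constantCoeff (0 : PS) • ng (Sum.inr k)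
      + (1 / 2 : ℂ) • ∑ k, ∑ l,
          MvPowerSeries.constantCoeff ((dForm i j).1 k l) • ng (Sum.inl (k, l))
      = ng (Sum.inl (i, j))
    have h : ∀ k l, MvPowerSeries.constantCoeff ((dForm i j).1 k l) • ng (Sum.inl (k, l))
        = (if k = i then (if l = j then ng (Sum.inl (k, l)) else 0) else 0)
          - (if k = j then (if l = i then ng (Sum.inl (k, l)) else 0) else 0) := by
      intro k l
      change MvPowerSeries.constantCoeff
        ((if k = i ∧ l = j then (1 : PS) else 0) - (if k = j ∧ l = i then 1 else 0)) • _ = _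
      rw [map_sub, sub_smul]
      congr 1
      · by_cases h1 : k = i <;> by_cases h2 : l = j <;> simp [h1, h2]
      · by_cases h1 : k = j <;> by_cases h2 : l = i <;> simp [h1, h2]
    simp only [h, Finset.sum_sub_distrib, Finset.sum_ite_eq', Finset.sum_ite_irrel,
      Finset.sum_const_zero, Finset.mem_univ, if_true]
    have e : ng (Sum.inl (j, i)) = - ng (Sum.inl (i, j)) :=
      eq_neg_of_add_eq_zero_right (ng_skew i j)
    rw [e, map_zero]
    simp only [zero_smul, Finset.sum_const_zero]
    module
  · change ∑ k, MvPowerSeries.constantCoeff (if k = i then (1 : PS) else 0) • ng (Sum.inr k)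
      + (1 / 2 : ℂ) • ∑ k, ∑ l, MvPowerSeries.constantCoeff (0 : PS) • ng (Sum.inl (k, l))
      = ng (Sum.inr i)
    simp [apply_ite, ite_smul]

theorem linPart_negElt (g : NegGen) : linPart (negElt g) = 0 := by
  refine Subtype.ext (Matrix.ext fun k l => ?_)
  rw [linPart_apply]
  rcases g with p | i
  · change MvPowerSeries.constantCoeff (pd k 0) = 0
    simp
  · change MvPowerSeries.constantCoeff (pd k ((dField i).1 l)) = 0
    rw [pd_dField, map_zero]

theorem modelAct_negElt (g : NegGen) (m : Model W) : modelAct W (negElt g) m = ng g • m := by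
  revert g
  refine Model.induction (p := fun m => ∀ g, modelAct W (negElt g) m = ng g • m) ?_ ?_ ?_ ?_ m
  · intro w g
    rw [modelAct_one_tmul, constPart_negElt, linPart_negElt, zero_lie, TensorProduct.tmul_zero,
      add_zero, TensorProduct.smul_tmul', smul_eq_mul, mul_one]
  · intro m n hm hn g
    rw [map_add, hm, hn, smul_add]
  · intro c m hm g
    rw [map_smul, hm, smul_comm]
  · intro h m hm g
    rw [modelAct_smul]
    rcases h with q | j
    · rcases g with p | i
      · change modelAct W (lieB (odd _) (odd _)) m + _ • modelAct W (parity (odd _)) m = _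
        rw [lieB_dForm_dForm, parity_odd, map_neg, LinearMap.neg_apply, smul_neg]
        have h1 : modelAct W (odd (dForm p.1 p.2)) m = ng (Sum.inl p) • m := hm (Sum.inl p)
        have h2 : ∀ i, modelAct W (even (dField i)) m = ng (Sum.inr i) • m :=
          fun i => hm (Sum.inr i)
        have h3 := congrArg (fun u => u • m) (ng_odd_odd p q)
        simp only [add_smul, Finset.sum_smul, smul_assoc, mul_smul] at h3
        simp only [map_sum, map_smul, LinearMap.sum_apply, LinearMap.smul_apply, h1, h2, ← h3]
        abel
      · have h1 : lieB (negElt (Sum.inr i)) (negElt (Sum.inl q)) = 0 :=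
          (lieB_even_skew _ _).trans (by rw [lieB_negElt_dField, neg_zero])
        rw [h1, map_zero, LinearMap.zero_apply, zero_add]
        change _ • modelAct W (parity (even _)) m = _
        rw [parity_even]
        have h2 : modelAct W (even (dField i)) m = ng (Sum.inr i) • m := hm (Sum.inr i)
        rw [h2, ← mul_smul, ← mul_smul, ng_central]
    · have h1 : lieB (negElt g) (negElt (Sum.inr j)) = 0 := lieB_negElt_dField g j
      rw [h1, map_zero, LinearMap.zero_apply, zero_add]
      change _ • modelAct W (negElt g) m = _
      rw [hm, ← mul_smul, ← mul_smul, ng_central]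

end Model


/-! ### The relations of the enveloping algebra in the model -/

section Model

variable {W : Type} [AddCommGroup W] [Module ℂ W] [LieRingModule sl5 W] [LieModule ℂ sl5 W]

theorem modelAct_smul_dField (x : L) (i : Fin 5) (m : Model W) :
    modelAct W x (ng (Sum.inr i) • m)
      = modelAct W (lieB x (even (dField i))) m + ng (Sum.inr i) • modelAct W x m :=
  modelAct_smul x (Sum.inr i) m

theorem modelAct_smul_dForm (x : L) (p : Fin 5 × Fin 5) (m : Model W) :
    modelAct W x (ng (Sum.inl p) • m)
      = modelAct W (lieB x (odd (dForm p.1 p.2))) m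
        + ng (Sum.inl p) • modelAct W (parity x) m :=
  modelAct_smul x (Sum.inl p) m

theorem even_sub (P Q : divFree) : even (P - Q) = even P - even Q := Prod.ext rfl (sub_zero _).symm

theorem odd_sub (P Q : closedForms) : odd (P - Q) = odd P - odd Q := Prod.ext (sub_zero _).symm rfl

theorem even_add (P Q : divFree) : even (P + Q) = even P + even Q := Prod.ext rfl (add_zero _).symm

theorem odd_add (P Q : closedForms) : odd (P + Q) = odd P + odd Q := Prod.ext (add_zero _).symm rfl

/-- The constant part of a vector field. -/
def constField (P : divFree) : divFree :=
  ∑ i, MvPowerSeries.constantCoeff (P.1 i) • dField i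

/-- The constant part of a `2`-form. -/
def constForm (w : closedForms) : closedForms :=
  (1 / 2 : ℂ) • ∑ i, ∑ j, MvPowerSeries.constantCoeff (w.1 i j) • dForm i j

theorem even_constField (P : divFree) :
    even (constField P) = ∑ i, MvPowerSeries.constantCoeff (P.1 i) • even (dField i) := by
  have e : ∀ P, even P = LinearMap.inl ℂ divFree closedForms P := fun _ => rfl
  simp only [e, constField, map_sum, map_smul]

theorem odd_constForm (w : closedForms) :
    odd (constForm w)
      = (1 / 2 : ℂ) • ∑ i, ∑ j, MvPowerSeries.constantCoeff (w.1 i j) • odd (dForm i j) := by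
  have e : ∀ P, odd P = LinearMap.inr ℂ divFree closedForms P := fun _ => rfl
  simp only [e, constForm, map_sum, map_smul]

theorem constantCoeff_constField (P : divFree) (k : Fin 5) :
    MvPowerSeries.constantCoeff ((constField P).1 k) = MvPowerSeries.constantCoeff (P.1 k) := by
  rw [constField, AddSubmonoidClass.coe_finsetSum, Finset.sum_apply, Finset.sum_eq_single k]
  · change MvPowerSeries.constantCoeff (MvPowerSeries.constantCoeff (P.1 k) •
      (if k = k then (1 : PS) else 0)) = _
    simp
  · intro j _ hj
    change MvPowerSeries.constantCoeff (P.1 j) • (if k = j then (1 : PS) else 0) = 0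
    rw [if_neg hj.symm, smul_zero]
  · simp

theorem constantCoeff_constForm (w : closedForms) (k l : Fin 5) :
    MvPowerSeries.constantCoeff ((constForm w).1 k l) = MvPowerSeries.constantCoeff (w.1 k l) := by
  have h : (constForm w).1 k l
      = (1 / 2 : ℂ) • ∑ i, ∑ j, MvPowerSeries.constantCoeff (w.1 i j) • (dForm i j).1 k l := by
    simp only [constForm, Submodule.coe_smul, Pi.smul_apply, AddSubmonoidClass.coe_finsetSum,
      Finset.sum_apply]
  have h2 : ∀ i j, MvPowerSeries.constantCoeff (w.1 i j) • (dForm i j).1 k l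
      = (if k = i then (if l = j then MvPowerSeries.constantCoeff (w.1 i j) • (1 : PS) else 0)
          else 0)
        - (if l = i then (if k = j then MvPowerSeries.constantCoeff (w.1 i j) • (1 : PS) else 0)
          else 0) := by
    intro i j
    change _ • ((if k = i ∧ l = j then (1 : PS) else 0) - (if k = j ∧ l = i then 1 else 0)) = _
    rw [smul_sub]
    congr 1
    · by_cases h1 : k = i <;> by_cases h2 : l = j <;> simp [h1, h2]
    · by_cases h1 : k = j <;> by_cases h2 : l = i <;> simp [h1, h2]
  simp only [h, h2, Finset.sum_sub_distrib, Finset.sum_ite_eq, Finset.sum_ite_irrel,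
    Finset.sum_const_zero, Finset.mem_univ, if_true, w.2.1 l k]
  simp
  ring

theorem odd_sub_constForm_mem (w : closedForms) : odd (w - constForm w) ∈ nonnegPart := by
  refine ⟨fun i => map_zero _, fun i j => ?_⟩
  change MvPowerSeries.constantCoeff (w.1 i j - (constForm w).1 i j) = 0
  rw [map_sub, constantCoeff_constForm, sub_self]

theorem even_sub_constField_mem (P : divFree) : even (P - constField P) ∈ nonnegPart := by
  refine ⟨fun i => ?_, fun i j => map_zero _⟩
  change MvPowerSeries.constantCoeff (P.1 i - (constField P).1 i) = 0
  rw [map_sub, constantCoeff_constField, sub_self]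

theorem modelAct_nonneg {x : L} (hx : x ∈ nonnegPart) (w : W) :
    modelAct W x (1 ⊗ₜ w) = 1 ⊗ₜ ⁅linPart x, w⁆ := by
  have h : constPart x = 0 := by
    change ∑ i, MvPowerSeries.constantCoeff (x.1.1 i) • ng (Sum.inr i)
      + (1 / 2 : ℂ) • ∑ i, ∑ j, MvPowerSeries.constantCoeff (x.2.1 i j) • ng (Sum.inl (i, j)) = 0
    simp [hx.1, hx.2]
  rw [modelAct_one_tmul, h, TensorProduct.zero_tmul, zero_add]

theorem linPart_odd (w : closedForms) : linPart (odd w) = 0 := by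
  refine Subtype.ext (Matrix.ext fun k l => ?_)
  rw [linPart_apply]
  change MvPowerSeries.constantCoeff (pd k 0) = 0
  simp

theorem modelAct_dField (i : Fin 5) (m : Model W) :
    modelAct W (even (dField i)) m = ng (Sum.inr i) • m := modelAct_negElt (Sum.inr i) m

theorem modelAct_dForm (i j : Fin 5) (m : Model W) :
    modelAct W (odd (dForm i j)) m = ng (Sum.inl (i, j)) • m := modelAct_negElt (Sum.inl (i, j)) m

/-- The commutation relation for a constant vector field. -/
theorem modelAct_comm_dField (i : Fin 5) (y : L) (m : Model W) :
    modelAct W (even (dField i)) (modelAct W y m) - modelAct W y (modelAct W (even (dField i)) m)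
      = modelAct W (lieB (even (dField i)) y) m := by
  rw [modelAct_dField, modelAct_dField, modelAct_smul_dField, lieB_even_skew, map_neg,
    LinearMap.neg_apply]
  abel

theorem modelAct_comm_constField (P : divFree) (y : L) (m : Model W) :
    modelAct W (even (constField P)) (modelAct W y m)
        - modelAct W y (modelAct W (even (constField P)) m)
      = modelAct W (lieB (even (constField P)) y) m := by
  simp only [even_constField, map_sum, map_smul, LinearMap.sum_apply, LinearMap.smul_apply,
    ← modelAct_comm_dField, smul_sub, Finset.sum_sub_distrib]

theorem modelAct_comm_even_constForm (P : divFree) (w : closedForms) (m : Model W) :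
    modelAct W (even P) (modelAct W (odd (constForm w)) m)
        - modelAct W (odd (constForm w)) (modelAct W (even P) m)
      = modelAct W (lieB (even P) (odd (constForm w))) m := by
  have h : ∀ i j, modelAct W (even P) (modelAct W (odd (dForm i j)) m)
      - modelAct W (odd (dForm i j)) (modelAct W (even P) m)
      = modelAct W (lieB (even P) (odd (dForm i j))) m := by
    intro i j
    rw [modelAct_dForm, modelAct_dForm, modelAct_smul_dForm, parity_even]
    abel
  simp only [odd_constForm, map_sum, map_smul, LinearMap.sum_apply, LinearMap.smul_apply,
    ← h, smul_sub, Finset.sum_sub_distrib]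

theorem modelAct_anticomm_constForm (v w : closedForms) (m : Model W) :
    modelAct W (odd v) (modelAct W (odd (constForm w)) m)
        + modelAct W (odd (constForm w)) (modelAct W (odd v) m)
      = modelAct W (lieB (odd v) (odd (constForm w))) m := by
  have h : ∀ i j, modelAct W (odd v) (modelAct W (odd (dForm i j)) m)
      + modelAct W (odd (dForm i j)) (modelAct W (odd v) m)
      = modelAct W (lieB (odd v) (odd (dForm i j))) m := by
    intro i j
    rw [modelAct_dForm, modelAct_dForm, modelAct_smul_dForm, parity_odd, map_neg,
      LinearMap.neg_apply, smul_neg]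
    abel
  simp only [odd_constForm, map_sum, map_smul, LinearMap.sum_apply, LinearMap.smul_apply,
    ← h, smul_add, Finset.sum_add_distrib]

/-- The commutation relation of two elements of `L₀` on the vectors `1 ⊗ w`. -/
theorem modelAct_comm_nonneg {x y : L} (hx : x ∈ nonnegPart) (hy : y ∈ nonnegPart) (w : W) :
    modelAct W x (modelAct W y (1 ⊗ₜ w)) - modelAct W y (modelAct W x (1 ⊗ₜ w))
      = modelAct W (lieB x y) (1 ⊗ₜ w) := by
  rw [modelAct_nonneg hx, modelAct_nonneg hy, modelAct_nonneg hx, modelAct_nonneg hy,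
    modelAct_nonneg (lieB_mem_nonnegPart hx hy), linPart_lieB hx hy, ← TensorProduct.tmul_sub,
    lie_lie]

/-- The relations of `U(E(5,10))` hold on the vectors `1 ⊗ w`. -/
theorem modelAct_rel_one_tmul (w : W) :
    (∀ P Q, modelAct W (even P) (modelAct W (even Q) (1 ⊗ₜ w))
      - modelAct W (even Q) (modelAct W (even P) (1 ⊗ₜ w))
      = modelAct W (lieB (even P) (even Q)) (1 ⊗ₜ w)) ∧
    (∀ P v, modelAct W (even P) (modelAct W (odd v) (1 ⊗ₜ w))
      - modelAct W (odd v) (modelAct W (even P) (1 ⊗ₜ w))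
      = modelAct W (lieB (even P) (odd v)) (1 ⊗ₜ w)) ∧
    (∀ u v, modelAct W (odd u) (modelAct W (odd v) (1 ⊗ₜ w))
      + modelAct W (odd v) (modelAct W (odd u) (1 ⊗ₜ w))
      = modelAct W (lieB (odd u) (odd v)) (1 ⊗ₜ w)) := by
  have eP : ∀ P, even P = even (constField P) + even (P - constField P) := by
    intro P
    rw [← even_add, add_sub_cancel]
  have ev : ∀ v, odd v = odd (constForm v) + odd (v - constForm v) := by
    intro v
    rw [← odd_add, add_sub_cancel]
  have z : ∀ v, modelAct W (odd (v - constForm v)) ((1 : NegUEA) ⊗ₜ[ℂ] w) = 0 := by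
    intro v
    rw [modelAct_nonneg (odd_sub_constForm_mem v), linPart_odd, zero_lie, TensorProduct.tmul_zero]
  refine ⟨fun P Q => ?_, fun P v => ?_, fun u v => ?_⟩
  · have h1 := modelAct_comm_constField P (even Q) ((1 : NegUEA) ⊗ₜ[ℂ] w)
    have h2 := modelAct_comm_constField Q (even (P - constField P)) ((1 : NegUEA) ⊗ₜ[ℂ] w)
    have h3 := modelAct_comm_nonneg (even_sub_constField_mem P) (even_sub_constField_mem Q) w
    rw [lieB_even_skew (constField Q), map_neg, LinearMap.neg_apply] at h2
    rw [eP P]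
    rw [eP Q] at h1 ⊢
    simp only [map_add, LinearMap.add_apply] at *
    linear_combination (norm := module) h1 - h2 + h3
  · have h1 := modelAct_comm_constField P (odd v) ((1 : NegUEA) ⊗ₜ[ℂ] w)
    have h2 := modelAct_comm_even_constForm (P - constField P) v ((1 : NegUEA) ⊗ₜ[ℂ] w)
    have h3 := modelAct_comm_nonneg (even_sub_constField_mem P) (odd_sub_constForm_mem v) w
    rw [eP P]
    rw [ev v] at h1 ⊢
    simp only [map_add, LinearMap.add_apply] at *
    linear_combination (norm := module) h1 + h2 + h3
  · have h1 := modelAct_anticomm_constForm v u ((1 : NegUEA) ⊗ₜ[ℂ] w)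
    have h2 := modelAct_anticomm_constForm (u - constForm u) v ((1 : NegUEA) ⊗ₜ[ℂ] w)
    have h3 : modelAct W (lieB (odd (u - constForm u)) (odd (v - constForm v)))
        ((1 : NegUEA) ⊗ₜ[ℂ] w) = 0 := by
      rw [modelAct_nonneg
          (lieB_mem_nonnegPart (odd_sub_constForm_mem u) (odd_sub_constForm_mem v)),
        linPart_lieB (odd_sub_constForm_mem u) (odd_sub_constForm_mem v), linPart_odd, zero_lie,
        zero_lie, TensorProduct.tmul_zero]
    have h4 : modelAct W (odd (u - constForm u))
          (modelAct W (odd (v - constForm v)) ((1 : NegUEA) ⊗ₜ[ℂ] w))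
        + modelAct W (odd (v - constForm v))
          (modelAct W (odd (u - constForm u)) ((1 : NegUEA) ⊗ₜ[ℂ] w)) = 0 := by
      rw [z, z, map_zero, map_zero, add_zero]
    rw [lieB_odd_comm] at h1
    rw [ev u]
    rw [ev v] at h1 ⊢
    simp only [map_add, LinearMap.add_apply] at *
    linear_combination (norm := module) h1 + h2 - h3 + h4

theorem modelAct_rel (m : Model W) :
    (∀ P Q, modelAct W (even P) (modelAct W (even Q) m)
      - modelAct W (even Q) (modelAct W (even P) m) = modelAct W (lieB (even P) (even Q)) m) ∧
    (∀ P v, modelAct W (even P) (modelAct W (odd v) m)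
      - modelAct W (odd v) (modelAct W (even P) m) = modelAct W (lieB (even P) (odd v)) m) ∧
    (∀ u v, modelAct W (odd u) (modelAct W (odd v) m)
      + modelAct W (odd v) (modelAct W (odd u) m) = modelAct W (lieB (odd u) (odd v)) m) := by
  refine Model.induction (p := fun m =>
    (∀ P Q, modelAct W (even P) (modelAct W (even Q) m)
      - modelAct W (even Q) (modelAct W (even P) m) = modelAct W (lieB (even P) (even Q)) m) ∧
    (∀ P v, modelAct W (even P) (modelAct W (odd v) m)
      - modelAct W (odd v) (modelAct W (even P) m) = modelAct W (lieB (even P) (odd v)) m) ∧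
    (∀ u v, modelAct W (odd u) (modelAct W (odd v) m)
      + modelAct W (odd v) (modelAct W (odd u) m) = modelAct W (lieB (odd u) (odd v)) m))
    modelAct_rel_one_tmul ?_ ?_ ?_ m
  · rintro a b ⟨ha1, ha2, ha3⟩ ⟨hb1, hb2, hb3⟩
    refine ⟨fun P Q => ?_, fun P v => ?_, fun u v => ?_⟩
    · simp only [map_add, ← ha1, ← hb1]; abel
    · simp only [map_add, ← ha2, ← hb2]; abel
    · simp only [map_add, ← ha3, ← hb3]; abel
  · rintro c a ⟨ha1, ha2, ha3⟩
    refine ⟨fun P Q => ?_, fun P v => ?_, fun u v => ?_⟩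
    · simp only [map_smul, ← ha1, smul_sub]
    · simp only [map_smul, ← ha2, smul_sub]
    · simp only [map_smul, ← ha3, smul_add]
  · rintro g a ⟨ha1, ha2, ha3⟩
    rcases g with p | i
    · refine ⟨fun P Q => ?_, fun P v => ?_, fun u v => ?_⟩
      · obtain ⟨p', hp⟩ : ∃ p', lieB (even P) (odd (dForm p.1 p.2)) = odd p' :=
          ⟨_, lieB_even_odd _ _⟩
        obtain ⟨q', hq⟩ : ∃ q', lieB (even Q) (odd (dForm p.1 p.2)) = odd q' :=
          ⟨_, lieB_even_odd _ _⟩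
        have hpar : parity (lieB (even P) (even Q)) = lieB (even P) (even Q) := by
          rw [parity_lieB_even, parity_even]
        have j := lieB_jacobi_even (even P) Q (odd (dForm p.1 p.2))
        rw [hp, hq, ← neg_eq_iff_eq_neg.mpr (lieB_even_skew Q (odd p'))] at j
        simp only [modelAct_smul_dForm, parity_even, map_add, hpar, j, hp, hq, ← ha1, ← ha2,
          map_neg, LinearMap.add_apply, LinearMap.neg_apply, smul_sub]
        abel
      · obtain ⟨p', hp⟩ : ∃ p', lieB (even P) (odd (dForm p.1 p.2)) = odd p' :=
          ⟨_, lieB_even_odd _ _⟩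
        obtain ⟨q', hq⟩ : ∃ q', lieB (odd v) (odd (dForm p.1 p.2)) = even q' :=
          ⟨_, lieB_odd_odd _ _⟩
        have hpar : parity (lieB (even P) (odd v)) = - lieB (even P) (odd v) := by
          rw [parity_lieB_odd, parity_even]
        have j := lieB_jacobi_odd (even P) v (dForm p.1 p.2)
        rw [hp, hq, ← eq_sub_iff_add_eq] at j
        simp only [modelAct_smul_dForm, parity_even, parity_odd, map_add, hpar, j, hp, hq, ← ha1,
          ← ha2, ← ha3, map_neg, map_sub, LinearMap.sub_apply, LinearMap.neg_apply,
          smul_sub, smul_neg]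
        abel
      · obtain ⟨p', hp⟩ : ∃ p', lieB (odd u) (odd (dForm p.1 p.2)) = even p' :=
          ⟨_, lieB_odd_odd _ _⟩
        obtain ⟨q', hq⟩ : ∃ q', lieB (odd v) (odd (dForm p.1 p.2)) = even q' :=
          ⟨_, lieB_odd_odd _ _⟩
        have hpar : parity (lieB (odd u) (odd v)) = lieB (odd u) (odd v) := by
          rw [parity_lieB_odd, parity_odd, map_neg, LinearMap.neg_apply, neg_neg]
        have j := lieB_jacobi_odd (odd u) v (dForm p.1 p.2)
        rw [hp, hq, ← eq_sub_iff_add_eq, ← neg_eq_iff_eq_neg.mpr (lieB_even_skew q' (odd u))] at j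
        simp only [modelAct_smul_dForm, parity_odd, map_add, hpar, j, hp, hq,
          ← ha2, ← ha3, map_neg, map_sub, LinearMap.sub_apply, LinearMap.neg_apply, smul_add,
          smul_neg]
        abel
    · have j : ∀ x y, lieB (lieB x y) (even (dField i))
          = lieB (lieB x (even (dField i))) y + lieB x (lieB y (even (dField i))) := by
        intro x y
        rw [lieB_jacobi_even, lieB_even_skew, map_neg]
        abel
      refine ⟨fun P Q => ?_, fun P v => ?_, fun u v => ?_⟩
      · obtain ⟨p', hp⟩ : ∃ p', lieB (even P) (even (dField i)) = even p' :=
          ⟨_, lieB_even_even _ _⟩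
        obtain ⟨q', hq⟩ : ∃ q', lieB (even Q) (even (dField i)) = even q' :=
          ⟨_, lieB_even_even _ _⟩
        simp only [modelAct_smul_dField, map_add, j, hp, hq, ← ha1, LinearMap.add_apply, smul_sub]
        abel
      · obtain ⟨p', hp⟩ : ∃ p', lieB (even P) (even (dField i)) = even p' :=
          ⟨_, lieB_even_even _ _⟩
        obtain ⟨q', hq⟩ : ∃ q', lieB (odd v) (even (dField i)) = odd q' :=
          ⟨_, (neg_eq_iff_eq_neg.mpr (lieB_even_skew _ _)).symm.trans
            ((congrArg Neg.neg (lieB_even_odd _ _)).trans (odd_neg _).symm)⟩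
        simp only [modelAct_smul_dField, map_add, j, hp, hq, ← ha2, LinearMap.add_apply, smul_sub]
        abel
      · have ho : ∀ v, ∃ q', lieB (odd v) (even (dField i)) = odd q' := fun v =>
          ⟨_, (neg_eq_iff_eq_neg.mpr (lieB_even_skew _ _)).symm.trans
            ((congrArg Neg.neg (lieB_even_odd _ _)).trans (odd_neg _).symm)⟩
        obtain ⟨p', hp⟩ := ho u
        obtain ⟨q', hq⟩ := ho v
        simp only [modelAct_smul_dField, map_add, j, hp, hq, ← ha3, LinearMap.add_apply, smul_add]
        abel

end Model


/-! ### The enveloping algebra of `E(5,10)` and its action on the model -/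

theorem UEA.mk_surjective : Function.Surjective UEA.mk :=
  RingCon.mkₐ_surjective (ringConGen UEA.Rel)

theorem UEA.mk_rel {a b : TensorAlgebra ℂ L} (h : UEA.Rel a b) : UEA.mk a = UEA.mk b :=
  (RingCon.eq _).mpr (RingCon.le_ringConGen (r := UEA.Rel) _ _ h)

theorem ιU_even_comm (P : divFree) (y : L) :
    ιU (even P) * ιU y - ιU y * ιU (even P) = ιU (lieB (even P) y) := by
  have h := UEA.mk_rel (UEA.Rel.even_left P y)
  rwa [map_sub, map_mul, map_mul] at h

theorem ιU_odd_anticomm (v w : closedForms) :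
    ιU (odd v) * ιU (odd w) + ιU (odd w) * ιU (odd v) = ιU (lieB (odd v) (odd w)) := by
  have h := UEA.mk_rel (UEA.Rel.odd_odd v w)
  rwa [map_add, map_mul, map_mul] at h

theorem UEA.induction {S : Set UEA} (h0 : ∀ c : ℂ, algebraMap ℂ UEA c ∈ S)
    (hg : ∀ x, ιU x ∈ S) (hadd : ∀ a b, a ∈ S → b ∈ S → a + b ∈ S)
    (hmul : ∀ a b, a ∈ S → b ∈ S → a * b ∈ S) (u : UEA) : u ∈ S := by
  obtain ⟨x, rfl⟩ := UEA.mk_surjective u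
  induction x using TensorAlgebra.induction with
  | algebraMap c => simpa using h0 c
  | ι g => exact hg g
  | mul a b ha hb => rw [map_mul]; exact hmul _ _ ha hb
  | add a b ha hb => rw [map_add]; exact hadd _ _ ha hb

theorem ιU_mul_negElt (x : L) (g : NegGen) :
    ιU x * ιU (negElt g) = ιU (lieB x (negElt g)) + ιU (negElt g) * ιU (genSign g x) := by
  rcases g with p | i
  · change ιU x * ιU (odd (dForm p.1 p.2)) = ιU (lieB x (odd (dForm p.1 p.2)))
      + ιU (odd (dForm p.1 p.2)) * ιU (parity x)
    have h1 := ιU_even_comm x.1 (odd (dForm p.1 p.2))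
    have h2 := ιU_odd_anticomm x.2 (dForm p.1 p.2)
    rw [← even_add_odd x]
    simp only [map_add, LinearMap.add_apply, parity_even, parity_odd, map_neg, add_mul, mul_add,
      mul_neg, ← h1, ← h2]
    abel
  · change ιU x * ιU (even (dField i)) = ιU (lieB x (even (dField i)))
      + ιU (even (dField i)) * ιU x
    have h := ιU_even_comm (dField i) x
    rw [lieB_even_skew, map_neg] at h
    rw [← sub_eq_iff_eq_add, ← neg_inj, neg_sub, h]

section

set_option linter.unusedSectionVars false

variable (W : Type) [AddCommGroup W] [Module ℂ W] [LieRingModule sl5 W] [LieModule ℂ sl5 W]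

/-- The action of `U(E(5,10))` on the model of the generalized Verma module. -/
def modelRep : UEA →ₐ[ℂ] Module.End ℂ (Model W) :=
  { RingCon.lift (ringConGen UEA.Rel)
      (TensorAlgebra.lift ℂ (modelAct W) : TensorAlgebra ℂ L →+* Module.End ℂ (Model W))
      (RingCon.ringConGen_le.mpr (by
        intro a b h
        change TensorAlgebra.lift ℂ (modelAct W) a = TensorAlgebra.lift ℂ (modelAct W) b
        cases h with
        | even_left P y =>
          rw [map_sub, map_mul, map_mul, TensorAlgebra.lift_ι_apply, TensorAlgebra.lift_ι_apply,
            TensorAlgebra.lift_ι_apply]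
          refine LinearMap.ext fun m => ?_
          change modelAct W (even P) (modelAct W y m) - modelAct W y (modelAct W (even P) m)
            = modelAct W (lieB (even P) y) m
          rw [← even_add_odd y]
          simp only [map_add, LinearMap.add_apply, ← (modelAct_rel m).1, ← (modelAct_rel m).2.1]
          abel
        | odd_odd v w =>
          rw [map_add, map_mul, map_mul, TensorAlgebra.lift_ι_apply, TensorAlgebra.lift_ι_apply,
            TensorAlgebra.lift_ι_apply]
          exact LinearMap.ext fun m => (modelAct_rel m).2.2 v w)) with
    commutes' := fun c => (TensorAlgebra.lift ℂ (modelAct W)).commutes c }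

variable {W}

theorem modelRep_ιU (x : L) : modelRep W (ιU x) = modelAct W x :=
  TensorAlgebra.lift_ι_apply (R := ℂ) (modelAct W) x

variable (W) in
/-- The map from `U ⊗ W` to the model which sends `u ⊗ w` to `u (1 ⊗ w)`. -/
def toModel : UEA ⊗[ℂ] W →ₗ[ℂ] Model W :=
  TensorProduct.lift
    (LinearMap.mk₂ ℂ (fun u w => modelRep W u (1 ⊗ₜ w))
      (fun u u' w => by rw [map_add, LinearMap.add_apply])
      (fun c u w => by rw [map_smul, LinearMap.smul_apply])
      (fun u w w' => by rw [TensorProduct.tmul_add, map_add])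
      (fun c u w => by rw [TensorProduct.tmul_smul, map_smul]))

theorem toModel_tmul (u : UEA) (w : W) : toModel W (u ⊗ₜ w) = modelRep W u (1 ⊗ₜ w) := rfl

theorem toModel_smul (u : UEA) (t : UEA ⊗[ℂ] W) :
    toModel W (u • t) = modelRep W u (toModel W t) := by
  induction t using TensorProduct.induction_on with
  | zero => simp
  | add a b ha hb => rw [smul_add, map_add, map_add, map_add, ha, hb]
  | tmul v w =>
    rw [TensorProduct.smul_tmul', toModel_tmul, toModel_tmul, smul_eq_mul, map_mul,
      Module.End.mul_apply]

/-- The relations of the generalized Verma module hold in the model. -/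
theorem toModel_vermaRel {t : UEA ⊗[ℂ] W} (ht : t ∈ vermaRel W) : toModel W t = 0 := by
  induction ht using Submodule.span_induction with
  | mem t h =>
    obtain ⟨u, x, w, hx, rfl⟩ := h
    rw [map_sub, toModel_tmul, toModel_tmul, map_mul, Module.End.mul_apply, modelRep_ιU,
      modelAct_nonneg hx, sub_self]
  | zero => exact map_zero _
  | add a b _ _ ha hb => rw [map_add, ha, hb, add_zero]
  | smul u t _ h => rw [toModel_smul, h, map_zero]

/-- The inclusion of `U(L₋)` into `U`. -/
def negToUEA : NegUEA →ₐ[ℂ] UEA :=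
  NegUEA.lift (fun g => ιU (negElt g))
    (by
      intro i j
      change ιU (odd (dForm i j)) + ιU (odd (dForm j i)) = 0
      rw [dForm_swap, odd_neg, map_neg, neg_add_cancel])
    (by
      intro p q
      refine (ιU_odd_anticomm (dForm p.1 p.2) (dForm q.1 q.2)).trans ?_
      rw [lieB_dForm_dForm, map_sum]
      exact Finset.sum_congr rfl fun i _ => map_smul _ _ _)
    (by
      intro g i
      have h := ιU_even_comm (dField i) (negElt g)
      rw [lieB_even_skew, lieB_negElt_dField, neg_zero, map_zero, sub_eq_zero] at h
      exact h.symm)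

theorem negToUEA_ng (g : NegGen) : negToUEA (ng g) = ιU (negElt g) := NegUEA.lift_ng _ _ _ _ g

theorem tmul_add_left (u v : UEA) (w : W) : tmul (u + v) w = tmul u w + tmul v w := by
  rw [tmul, TensorProduct.add_tmul]; rfl

theorem smul_tmul_eq (u v : UEA) (w : W) : u • tmul v w = tmul (u * v) w := rfl

theorem tmul_nonneg {x : L} (hx : x ∈ nonnegPart) (u : UEA) (w : W) :
    tmul (u * ιU x) w = tmul u ⁅linPart x, w⁆ :=
  (Submodule.Quotient.eq _).mpr (Submodule.subset_span ⟨u, x, w, hx, rfl⟩)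

variable (W) in
/-- The map from the model to the generalized Verma module. -/
def ofModel : Model W →ₗ[ℂ] Verma W :=
  (Submodule.restrictScalars ℂ (vermaRel W)).mkQ ∘ₗ
    TensorProduct.map negToUEA.toLinearMap LinearMap.id

theorem ofModel_tmul (u : NegUEA) (w : W) : ofModel W (u ⊗ₜ w) = tmul (negToUEA u) w := rfl

theorem ofModel_ng_smul (g : NegGen) (m : Model W) :
    ofModel W (ng g • m) = ιU (negElt g) • ofModel W m := by
  induction m using TensorProduct.induction_on with
  | zero => rw [smul_zero, map_zero, smul_zero]
  | add a b ha hb => rw [smul_add, map_add, map_add, smul_add, ha, hb]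
  | tmul v w =>
    rw [TensorProduct.smul_tmul', ofModel_tmul, ofModel_tmul, smul_eq_mul, map_mul, negToUEA_ng,
      smul_tmul_eq]

theorem negToUEA_constPart (x : L) :
    negToUEA (constPart x) = ιU (even (constField x.1)) + ιU (odd (constForm x.2)) := by
  change negToUEA (∑ i, MvPowerSeries.constantCoeff (x.1.1 i) • ng (Sum.inr i)
    + (1 / 2 : ℂ) • ∑ i, ∑ j, MvPowerSeries.constantCoeff (x.2.1 i j) • ng (Sum.inl (i, j))) = _
  simp only [even_constField, odd_constForm, map_add, map_sum, map_smul, negToUEA_ng]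
  rfl

theorem linPart_constField (P : divFree) : linPart (even (constField P)) = 0 := by
  rw [← linPartL_apply, even_constField]
  simp only [map_sum, map_smul, linPartL_apply]
  have h : ∀ i, linPart (even (dField i)) = 0 := fun i => linPart_negElt (Sum.inr i)
  simp [h]

theorem ofModel_modelAct (x : L) (m : Model W) :
    ofModel W (modelAct W x m) = ιU x • ofModel W m := by
  revert x
  refine Model.induction
    (p := fun m => ∀ x, ofModel W (modelAct W x m) = ιU x • ofModel W m) ?_ ?_ ?_ ?_ m
  · intro w x
    have h1 : x = even (constField x.1) + odd (constForm x.2)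
        + (even (x.1 - constField x.1) + odd (x.2 - constForm x.2)) := by
      rw [add_add_add_comm, ← even_add, ← odd_add, add_sub_cancel, add_sub_cancel, even_add_odd]
    have h2 := tmul_nonneg (nonnegPart.add_mem (even_sub_constField_mem x.1)
      (odd_sub_constForm_mem x.2)) 1 w
    have h3 : linPart (even (x.1 - constField x.1) + odd (x.2 - constForm x.2)) = linPart x := by
      rw [even_sub, ← linPartL_apply, map_add, map_sub, linPartL_apply, linPartL_apply,
        linPartL_apply, linPart_constField, linPart_odd, sub_zero, add_zero]
      rfl
    rw [h3, one_mul] at h2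
    rw [modelAct_one_tmul, map_add, ofModel_tmul, ofModel_tmul, ofModel_tmul, negToUEA_constPart,
      map_one, smul_tmul_eq, mul_one, ← h2, ← tmul_add_left, ← map_add, ← map_add, ← h1]
  · intro a b ha hb x
    rw [map_add, map_add, map_add, ha, hb, smul_add]
  · intro c a ha x
    rw [map_smul, map_smul, map_smul, ha, smul_comm]
  · intro g a ha x
    rw [modelAct_smul, map_add, ofModel_ng_smul, ofModel_ng_smul, ha, ha, ← mul_smul, ← mul_smul,
      ιU_mul_negElt, add_smul]

theorem ofModel_modelRep (u : UEA) (m : Model W) :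
    ofModel W (modelRep W u m) = u • ofModel W m := by
  refine UEA.induction (S := {u | ∀ m, ofModel W (modelRep W u m) = u • ofModel W m})
    ?_ ?_ ?_ ?_ u m
  · intro c m
    rw [AlgHom.commutes, Module.algebraMap_end_apply, map_smul, algebraMap_smul]
  · intro x m
    rw [modelRep_ιU, ofModel_modelAct]
  · intro a b ha hb m
    rw [map_add, LinearMap.add_apply, map_add, ha, hb, add_smul]
  · intro a b ha hb m
    rw [map_mul, Module.End.mul_apply, ha, hb, mul_smul]

theorem ofModel_toModel (t : UEA ⊗[ℂ] W) :
    ofModel W (toModel W t) = Submodule.Quotient.mk t := by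
  induction t using TensorProduct.induction_on with
  | zero => simp
  | add a b ha hb => rw [map_add, map_add, ha, hb]; rfl
  | tmul u w =>
    rw [toModel_tmul, ofModel_modelRep, ofModel_tmul, map_one, smul_tmul_eq, mul_one]
    rfl

/-- An element of the generalized Verma module vanishes if and only if it does so in the model:
this is the consequence of the Poincaré–Birkhoff–Witt theorem that is needed below. -/
theorem mk_eq_zero_iff (t : UEA ⊗[ℂ] W) :
    (Submodule.Quotient.mk t : Verma W) = 0 ↔ toModel W t = 0 := by
  refine ⟨fun h => toModel_vermaRel ((Submodule.Quotient.mk_eq_zero _).mp h), fun h => ?_⟩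
  rw [← ofModel_toModel, h, map_zero]

end

/-! ### A linear functional on `U(L₋)` -/

/-- The coefficients of the component of `dᵢⱼ` in the span of `d₀₁, …, d₀₄`. -/
def dCoord (p : Fin 5 × Fin 5) : Fin 4 → ℂ := fun k =>
  (if p.1 = 0 ∧ p.2 = k.succ then 1 else 0) - (if p.2 = 0 ∧ p.1 = k.succ then 1 else 0)

/-- The homomorphism from `U(L₋)` to the exterior algebra on `d₀₁, …, d₀₄` that kills the other
generators. -/
def toExterior : NegUEA →ₐ[ℂ] ExteriorAlgebra ℂ (Fin 4 → ℂ) :=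
  NegUEA.lift (Sum.elim (fun p => ExteriorAlgebra.ι ℂ (dCoord p)) fun _ => 0)
    (by
      intro i j
      change ExteriorAlgebra.ι ℂ (dCoord (i, j)) + ExteriorAlgebra.ι ℂ (dCoord (j, i)) = 0
      rw [← map_add]
      have h : dCoord (i, j) + dCoord (j, i) = 0 := by
        funext k
        simp [dCoord]
      rw [h, map_zero])
    (by
      intro p q
      simp [ExteriorAlgebra.ι_add_mul_swap])
    (by
      intro g i
      simp)

/-- The coefficient of `d₀₁ d₀₂ d₀₃ d₀₄`, as a functional on `U(L₋)`. -/
def topCoeff : NegUEA →ₗ[ℂ] ℂ :=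
  ExteriorAlgebra.liftAlternating
    (fun i => if h : i = 4 then
      h ▸ (Matrix.detRowAlternating : (Fin 4 → ℂ) [⋀^Fin 4]→ₗ[ℂ] ℂ) else 0)
    ∘ₗ toExterior.toLinearMap

theorem topCoeff_top : topCoeff (ng (Sum.inl (0, 1)) * ng (Sum.inl (0, 2)) * ng (Sum.inl (0, 3))
    * ng (Sum.inl (0, 4))) = 1 := by
  have h : toExterior (ng (Sum.inl (0, 1)) * ng (Sum.inl (0, 2)) * ng (Sum.inl (0, 3))
      * ng (Sum.inl (0, 4)))
      = ExteriorAlgebra.ιMulti ℂ 4 (fun k : Fin 4 => (Pi.single k 1 : Fin 4 → ℂ)) := by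
    have e : ∀ k : Fin 4, dCoord (0, k.succ) = Pi.single k 1 := by
      intro k
      funext l
      simp [dCoord, Pi.single_apply, Fin.succ_ne_zero, eq_comm]
    have e2 : ∀ k : Fin 4, toExterior (ng (Sum.inl (0, k.succ)))
        = ExteriorAlgebra.ι ℂ (Pi.single k 1) := by
      intro k
      rw [toExterior, NegUEA.lift_ng, Sum.elim_inl, e]
    rw [map_mul, map_mul, map_mul, ExteriorAlgebra.ιMulti_apply]
    have := e2 0
    have := e2 1
    have := e2 2
    have := e2 3
    simp_all [List.ofFn_succ, mul_assoc]
  rw [topCoeff, LinearMap.comp_apply, AlgHom.toLinearMap_apply, h,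
    ExteriorAlgebra.liftAlternating_apply_ιMulti]
  have h2 : (fun k : Fin 4 => (Pi.single k 1 : Fin 4 → ℂ)) = (1 : Matrix (Fin 4) (Fin 4) ℂ) := by
    funext k l
    simp [Matrix.one_apply, Pi.single_apply, eq_comm]
  rw [h2]
  exact Matrix.det_one

/-! ### The forms `dx_q ∧ df` -/

/-- The closed form `dx_q ∧ df`. -/
def dxd (q : Fin 5) (f : PS) : closedForms :=
  ⟨fun a b => (if a = q then pd b f else 0) - (if b = q then pd a f else 0), by
    refine ⟨fun a b => (neg_sub _ _).symm, fun a b c => ?_⟩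
    have h : ∀ (p : Prop) [Decidable p] (n : Fin 5) (g : PS),
        pd n (if p then g else 0) = if p then pd n g else 0 := by
      intro p _ n g
      split_ifs <;> simp
    simp only [map_sub, h, pd_comm b a, pd_comm c a, pd_comm c b]
    ring⟩

theorem dxd_apply (q : Fin 5) (f : PS) (a b : Fin 5) :
    (dxd q f).1 a b = (if a = q then pd b f else 0) - (if b = q then pd a f else 0) := rfl

/-- `L_P (dx_q ∧ dx_l) = dx_q ∧ dP_l - dx_l ∧ dP_q`. -/
theorem lieDeriv_dForm (P : VField) (q l : Fin 5) :
    lieDeriv P (dForm q l).1 = (dxd q (P l)).1 - (dxd l (P q)).1 := by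
  funext a b
  rw [lieDeriv_apply, Pi.sub_apply, Pi.sub_apply, dxd_apply, dxd_apply]
  have h0 : fieldDer P ((dForm q l).1 a b) = 0 := by
    simp only [fieldDer_apply, pd_dForm, mul_zero, Finset.sum_const_zero]
  have h1 : ∀ i b, (dForm q l).1 i b
      = (if i = q then (if b = l then 1 else 0) else 0)
        - (if i = l then (if b = q then 1 else 0) else 0) := by
    intro i b
    change (if i = q ∧ b = l then (1 : PS) else 0) - (if i = l ∧ b = q then 1 else 0) = _
    simp only [ite_and]
  have h2 : ∀ i, (dForm q l).1 a i = - (dForm q l).1 i a := fun i => (dForm q l).2.1 a i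
  rw [h0, zero_add]
  simp only [h2, h1, mul_neg, mul_sub, mul_ite, mul_zero, mul_one, Finset.sum_add_distrib,
    Finset.sum_sub_distrib, Finset.sum_neg_distrib, Finset.sum_ite_eq', Finset.mem_univ, if_true]
  ring

theorem odd_lieDeriv_dForm (P : divFree) (q l : Fin 5) :
    lieB (even P) (odd (dForm q l)) = odd (dxd q (P.1 l)) - odd (dxd l (P.1 q)) := by
  rw [lieB_even_odd, ← odd_sub]
  exact congrArg odd (Subtype.ext (lieDeriv_dForm P.1 q l))

theorem formBracket_dForm_swap (v : FormArray) (p k q : Fin 5) :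
    formBracket v (dForm p k).1 q = - formBracket v (dForm q k).1 p := by
  have h : ∀ a b, levi q a b p k = - levi p a b q k := by
    intro a b
    rw [levi, levi, cmpSign_swap p a, cmpSign_swap p b, cmpSign_swap q p, cmpSign_swap a q,
      cmpSign_swap b q]
    ring
  rw [formBracket_dForm, formBracket_dForm, ← smul_neg, ← Finset.sum_neg_distrib]
  simp only [← Finset.sum_neg_distrib, h, Int.cast_neg, neg_smul]

theorem formBracket_dxd (q : Fin 5) (f : PS) (r m i : Fin 5) :
    formBracket (dxd q f).1 (dForm r m).1 i = ∑ a, (levi i q a r m : ℂ) • pd a f := by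
  have h : ∀ a, levi i a q r m = - levi i q a r m := by
    intro a
    rw [levi, levi, cmpSign_swap a q]
    ring
  rw [formBracket_dForm]
  simp only [dxd_apply, smul_sub, smul_ite, smul_zero, Finset.sum_sub_distrib,
    Finset.sum_ite_irrel, Finset.sum_const_zero, Finset.sum_ite_eq', Finset.mem_univ, if_true, h,
    Int.cast_neg, neg_smul, Finset.sum_neg_distrib]
  module

theorem formBracket_dxd_swap (q : Fin 5) (f : PS) (r m i : Fin 5) :
    formBracket (dxd q f).1 (dForm r m).1 i = - formBracket (dxd r f).1 (dForm q m).1 i := by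
  have h : ∀ a, levi i q a r m = - levi i r a q m := by
    intro a
    rw [levi, levi, cmpSign_swap r a, cmpSign_swap q r, cmpSign_swap a q]
    ring
  rw [formBracket_dxd, formBracket_dxd, ← Finset.sum_neg_distrib]
  simp only [h, Int.cast_neg, neg_smul]

theorem dxd_add (q : Fin 5) (f g : PS) : dxd q (f + g) = dxd q f + dxd q g := by
  refine Subtype.ext (funext fun a => funext fun b => ?_)
  change (dxd q (f + g)).1 a b = (dxd q f).1 a b + (dxd q g).1 a b
  simp only [dxd_apply, map_add]
  split_ifs <;> ring

theorem dxd_smul (q : Fin 5) (c : ℂ) (f : PS) : dxd q (c • f) = c • dxd q f := by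
  refine Subtype.ext (funext fun a => funext fun b => ?_)
  change (dxd q (c • f)).1 a b = c • (dxd q f).1 a b
  simp only [dxd_apply, Derivation.map_smul, smul_sub, smul_ite, smul_zero]

theorem dxd_neg (q : Fin 5) (f : PS) : dxd q (-f) = - dxd q f := by
  refine Subtype.ext (funext fun a => funext fun b => ?_)
  change (dxd q (-f)).1 a b = - (dxd q f).1 a b
  simp only [dxd_apply, map_neg]
  split_ifs <;> ring

/-- The coefficient of `x_t` in `f`. -/
def lc (t : Fin 5) : PS →ₗ[ℂ] ℂ :=
  (MvPowerSeries.coeff (R := ℂ) (Finsupp.single t 1))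

theorem lc_apply (t : Fin 5) (f : PS) : lc t f = MvPowerSeries.constantCoeff (pd t f) :=
  (constantCoeff_pd t f).symm

theorem constForm_dxd_mem (q : Fin 5) (f : PS) :
    odd (dxd q f - ∑ t, lc t f • dForm q t) ∈ nonnegPart := by
  refine ⟨fun i => map_zero _, fun a b => ?_⟩
  have h : ∀ t, lc t f • (dForm q t).1 a b
      = (if t = b then (if a = q then lc t f • (1 : PS) else 0) else 0)
        - (if t = a then (if b = q then lc t f • (1 : PS) else 0) else 0) := by
    intro t
    change lc t f • ((if a = q ∧ b = t then (1 : PS) else 0) - (if a = t ∧ b = q then 1 else 0)) = _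
    rw [smul_sub]
    congr 1
    · by_cases h1 : a = q <;> by_cases h2 : t = b <;> simp [h1, h2, eq_comm]
      exact fun h3 => absurd h3.symm h2
    · by_cases h1 : b = q <;> by_cases h2 : t = a <;> simp [h1, h2, eq_comm]
      exact fun h3 => absurd h3.symm h2
  change MvPowerSeries.constantCoeff
    ((dxd q f).1 a b - (∑ t, lc t f • dForm q t : closedForms).1 a b)
    = 0
  rw [AddSubmonoidClass.coe_finsetSum, Finset.sum_apply, Finset.sum_apply]
  change MvPowerSeries.constantCoeff ((dxd q f).1 a b - ∑ t, lc t f • (dForm q t).1 a b) = 0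
  simp only [h, Finset.sum_sub_distrib, Finset.sum_ite_eq', Finset.mem_univ, if_true]
  simp only [dxd_apply, lc_apply]
  split_ifs <;> simp

/-! ### Products of four odd elements with a common factor -/

section Common

set_option linter.unusedSectionVars false

variable {C R : Type} [CommRing C] [Ring R] [Algebra ℂ C] [Algebra ℂ R] [Algebra C R]
  [IsScalarTower ℂ C R] (ε : UEA →ₐ[ℂ] R) (z : Fin 5 → C)

/-- The map `L → R` which underlies an algebra homomorphism `U → R`. -/
def emb : L →ₗ[ℂ] R := ε.toLinearMap ∘ₗ ιU

theorem emb_even_comm (P : divFree) (y : L) :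
    emb ε (even P) * emb ε y - emb ε y * emb ε (even P) = emb ε (lieB (even P) y) := by
  have h := congrArg ε (ιU_even_comm P y)
  rwa [map_sub, map_mul, map_mul] at h

theorem emb_odd_anticomm (v w : closedForms) :
    emb ε (odd v) * emb ε (odd w) + emb ε (odd w) * emb ε (odd v)
      = emb ε (lieB (odd v) (odd w)) := by
  have h := congrArg ε (ιU_odd_anticomm v w)
  rwa [map_add, map_mul, map_mul] at h

/-- The element `y ∧ dx_k` for the covector `y = ∑ z_p dx_p` with coefficients in `C`. -/
def gD (k : Fin 5) : R := ∑ p, z p • emb ε (odd (dForm p k))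

/-- The element `y ∧ df` for `y = ∑ z_p dx_p`. -/
def gE (f : PS) : R := ∑ q, z q • emb ε (odd (dxd q f))

/-- A sum of an alternating function against the symmetric products `z_p z_q` vanishes. -/
theorem sum_alternating {G : Fin 5 → Fin 5 → R} (h : ∀ p q, G p q = - G q p) :
    ∑ p, ∑ q, z p • z q • G p q = 0 := by
  have h1 : ∑ p, ∑ q, z p • z q • G p q = - ∑ p, ∑ q, z p • z q • G p q := by
    conv_lhs => rw [Finset.sum_comm]
    simp only [← Finset.sum_neg_distrib]
    refine Finset.sum_congr rfl fun p _ => Finset.sum_congr rfl fun q _ => ?_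
    rw [h q p, smul_neg, smul_neg, smul_comm]
  have h2 : (2 : ℂ) • ∑ p, ∑ q, z p • z q • G p q = 0 := by
    rw [two_smul]
    nth_rewrite 1 [h1]
    exact neg_add_cancel _
  exact (smul_eq_zero.mp h2).resolve_left two_ne_zero

theorem sum_smul_gD : ∑ k, z k • gD ε z k = 0 := by
  simp only [gD, Finset.smul_sum]
  refine sum_alternating z fun p q => ?_
  rw [dForm_swap, odd_neg, map_neg]

theorem gD_mul (k : Fin 5) (x : R) : gD ε z k * x = ∑ p, z p • (emb ε (odd (dForm p k)) * x) := by
  simp only [gD, Finset.sum_mul, smul_mul_assoc]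

theorem mul_gD (k : Fin 5) (x : R) : x * gD ε z k = ∑ p, z p • (x * emb ε (odd (dForm p k))) := by
  simp only [gD, Finset.mul_sum, mul_smul_comm]

/-- `y ∧ df` and `y ∧ dx_m` anticommute, since `y ∧ y = 0`. -/
theorem gE_gD (f : PS) (m : Fin 5) : gE ε z f * gD ε z m = - (gD ε z m * gE ε z f) := by
  rw [eq_neg_iff_add_eq_zero]
  have h : gE ε z f * gD ε z m + gD ε z m * gE ε z f
      = ∑ q, ∑ r, z q • z r • emb ε (lieB (odd (dxd q f)) (odd (dForm r m))) := by
    rw [mul_gD, gD_mul, ← Finset.sum_add_distrib, Finset.sum_comm]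
    refine Finset.sum_congr rfl fun r _ => ?_
    rw [← smul_add, gE, Finset.sum_mul, Finset.mul_sum, ← Finset.sum_add_distrib, Finset.smul_sum]
    refine Finset.sum_congr rfl fun q _ => ?_
    rw [smul_mul_assoc, mul_smul_comm, ← smul_add, emb_odd_anticomm, smul_comm]
  rw [h]
  refine sum_alternating z fun q r => ?_
  rw [lieB_odd_odd, lieB_odd_odd, ← map_neg]
  refine congrArg (emb ε) (Prod.ext (Subtype.ext (funext fun i => ?_)) neg_zero.symm)
  exact formBracket_dxd_swap q f r m i

theorem gE_X (k : Fin 5) : gE ε z (MvPowerSeries.X k) = gD ε z k := by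
  rw [gE, gD]
  refine Finset.sum_congr rfl fun q _ => ?_
  congr 2
  refine congrArg odd (Subtype.ext (funext fun a => funext fun b => ?_))
  rw [dxd_apply]
  change _ = (if a = q ∧ b = k then (1 : PS) else 0) - (if a = k ∧ b = q then 1 else 0)
  have h : ∀ c, pd c (MvPowerSeries.X k : PS) = if c = k then 1 else 0 := by
    intro c
    split_ifs with hc
    · rw [hc]; exact MvPowerSeries.pderiv_X_self
    · exact MvPowerSeries.pderiv_X_of_ne (Ne.symm hc)
  rw [h, h, ite_and, ite_and]
  congr 1
  split_ifs <;> rfl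

theorem gD_gD (k m : Fin 5) : gD ε z k * gD ε z m = - (gD ε z m * gD ε z k) := by
  rw [← gE_X, gE_gD]

theorem gD_sq (k : Fin 5) : gD ε z k * gD ε z k = 0 := by
  have h2 : (2 : ℂ) • (gD ε z k * gD ε z k) = 0 := by
    rw [two_smul]
    nth_rewrite 1 [gD_gD]
    exact neg_add_cancel _
  exact (smul_eq_zero.mp h2).resolve_left two_ne_zero

/-- The commutator of a family of fields that is alternating against `y` with `y ∧ dx_l`. -/
theorem sum_even_comm_gD (Q : Fin 5 → divFree) (h : ∀ p q, (Q p).1 q = - (Q q).1 p) (l : Fin 5) :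
    (∑ p, z p • emb ε (even (Q p))) * gD ε z l
      = gD ε z l * (∑ p, z p • emb ε (even (Q p))) + ∑ p, z p • gE ε z ((Q p).1 l) := by
  rw [← sub_eq_iff_eq_add']
  have h1 : (∑ p, z p • emb ε (even (Q p))) * gD ε z l
      - gD ε z l * (∑ p, z p • emb ε (even (Q p)))
      = ∑ p, ∑ q, z p • z q • (emb ε (odd (dxd q ((Q p).1 l)))
          - emb ε (odd (dxd l ((Q p).1 q)))) := by
    rw [Finset.sum_mul, Finset.mul_sum, ← Finset.sum_sub_distrib]
    refine Finset.sum_congr rfl fun p _ => ?_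
    rw [smul_mul_assoc, mul_smul_comm, ← smul_sub, mul_gD, gD_mul, ← Finset.sum_sub_distrib,
      Finset.smul_sum]
    refine Finset.sum_congr rfl fun q _ => ?_
    rw [← smul_sub, emb_even_comm, odd_lieDeriv_dForm, map_sub]
  have h2 : ∑ p, ∑ q, z p • z q • emb ε (odd (dxd l ((Q p).1 q))) = 0 :=
    sum_alternating z fun p q => by rw [h, dxd_neg, odd_neg, map_neg]
  rw [h1]
  simp only [smul_sub, Finset.sum_sub_distrib]
  rw [h2, sub_zero]
  simp only [gE, Finset.smul_sum]

/-- The anticommutator of an odd element with `y ∧ dx_k`. -/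
def gA (w : closedForms) (k : Fin 5) : R :=
  ∑ p, z p • emb ε (even ⟨formBracket w.1 (dForm p k).1, formBracket_mem w.2 (dForm p k).2⟩)

/-- The anticommutator of `L_P (y ∧ dx_k)` with `y ∧ dx_l`. -/
def gH (P : VField) (k l : Fin 5) : R :=
  - ∑ p, z p • ∑ q, z q • emb ε (even ⟨formBracket (dxd k (P p)).1 (dForm q l).1,
    formBracket_mem (dxd k (P p)).2 (dForm q l).2⟩)

theorem odd_gD (w : closedForms) (k : Fin 5) :
    emb ε (odd w) * gD ε z k = gA ε z w k - gD ε z k * emb ε (odd w) := by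
  rw [eq_sub_iff_add_eq, mul_gD, gD_mul, ← Finset.sum_add_distrib, gA]
  refine Finset.sum_congr rfl fun p _ => ?_
  rw [← smul_add, emb_odd_anticomm, lieB_odd_odd]

theorem gA_gD (w : closedForms) (k l : Fin 5) :
    gA ε z w k * gD ε z l = gD ε z l * gA ε z w k
      + ∑ p, z p • gE ε z (formBracket w.1 (dForm p k).1 l) :=
  sum_even_comm_gD ε z
    (fun p => ⟨formBracket w.1 (dForm p k).1, formBracket_mem w.2 (dForm p k).2⟩)
    (fun p q => formBracket_dForm_swap w.1 p k q) l

/-- The commutator of a field with `y ∧ dx_k`. -/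
def gG (P : divFree) (k : Fin 5) : R :=
  ∑ p, z p • emb ε (odd (dxd p (P.1 k)) - odd (dxd k (P.1 p)))

theorem even_gD (P : divFree) (k : Fin 5) :
    emb ε (even P) * gD ε z k = gD ε z k * emb ε (even P) + gG ε z P k := by
  rw [← sub_eq_iff_eq_add', mul_gD, gD_mul, ← Finset.sum_sub_distrib, gG]
  refine Finset.sum_congr rfl fun p _ => ?_
  rw [← smul_sub, emb_even_comm, odd_lieDeriv_dForm]

theorem gG_eq (P : divFree) (k : Fin 5) :
    gG ε z P k = gE ε z (P.1 k) - ∑ p, z p • emb ε (odd (dxd k (P.1 p))) := by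
  simp only [gG, gE, map_sub, smul_sub, Finset.sum_sub_distrib]

theorem gG_gD (P : divFree) (k l : Fin 5) :
    gG ε z P k * gD ε z l = gH ε z P.1 k l - gD ε z l * gG ε z P k := by
  have h : (∑ p, z p • emb ε (odd (dxd k (P.1 p)))) * gD ε z l
      + gD ε z l * (∑ p, z p • emb ε (odd (dxd k (P.1 p)))) = - gH ε z P.1 k l := by
    rw [gH, neg_neg, Finset.sum_mul, Finset.mul_sum, ← Finset.sum_add_distrib]
    refine Finset.sum_congr rfl fun p _ => ?_
    rw [smul_mul_assoc, mul_smul_comm, ← smul_add, mul_gD, gD_mul, ← Finset.sum_add_distrib]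
    congr 1
    refine Finset.sum_congr rfl fun q _ => ?_
    rw [← smul_add, emb_odd_anticomm, lieB_odd_odd]
  rw [gG_eq, sub_mul, mul_sub, gE_gD, eq_sub_iff_add_eq, ← neg_inj, ← h]
  abel

theorem gH_gD (P : VField) (k l m : Fin 5) :
    gH ε z P k l * gD ε z m = gD ε z m * gH ε z P k l
      - ∑ p, z p • ∑ q, z q • gE ε z (formBracket (dxd k (P p)).1 (dForm q l).1 m) := by
  have h := fun p => sum_even_comm_gD ε z
    (fun q => ⟨formBracket (dxd k (P p)).1 (dForm q l).1,
      formBracket_mem (dxd k (P p)).2 (dForm q l).2⟩)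
    (fun q r => formBracket_dForm_swap (dxd k (P p)).1 q l r) m
  simp only [gH, neg_mul, mul_neg, Finset.sum_mul, Finset.mul_sum, smul_mul_assoc,
    mul_smul_comm] at h ⊢
  simp only [h, smul_add, Finset.sum_add_distrib]
  abel

end Common

/-! ### The action of odd elements of `L₊` on `D₁ D₂ D₃ D₄` -/

section Common

set_option linter.unusedSectionVars false

variable {C R : Type} [CommRing C] [Ring R] [Algebra ℂ C] [Algebra ℂ R] [Algebra C R]
  [IsScalarTower ℂ C R] (ε : UEA →ₐ[ℂ] R) (z : Fin 5 → C)

/-- The element `y ∧ df₁` for the linear part `f₁` of `f`. -/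
def gL : PS →ₗ[ℂ] R where
  toFun f := ∑ t, lc t f • gD ε z t
  map_add' f g := by simp only [map_add, add_smul, Finset.sum_add_distrib]
  map_smul' c f := by
    simp only [map_smul, smul_eq_mul, mul_smul, ← Finset.smul_sum, RingHom.id_apply]

theorem gL_apply (f : PS) : gL ε z f = ∑ t, lc t f • gD ε z t := rfl

theorem smul_mem_of_left_ideal {I : Submodule R R} (c : C) {x : R} (hx : x ∈ I) : c • x ∈ I := by
  rw [Algebra.smul_def]
  exact I.smul_mem _ hx

/-- Modulo the forms that vanish at the origin, only the linear part of `f` matters in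
`y ∧ df`. -/
theorem gE_sub_gL_mem {I : Submodule R R}
    (hI : ∀ v, odd v ∈ nonnegPart → emb ε (odd v) ∈ I) (f : PS) :
    gE ε z f - gL ε z f ∈ I := by
  have h : gE ε z f - gL ε z f = ∑ q, z q • emb ε (odd (dxd q f - ∑ t, lc t f • dForm q t)) := by
    have e : ∀ w, odd w = LinearMap.inr ℂ divFree closedForms w := fun _ => rfl
    simp only [gE, gL_apply, gD, e, map_sub, map_sum, map_smul, smul_sub, Finset.sum_sub_distrib]
    congr 1
    simp only [Finset.smul_sum]
    rw [Finset.sum_comm]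
    exact Finset.sum_congr rfl fun q _ => Finset.sum_congr rfl fun t _ => smul_comm _ _ _
  rw [h]
  exact I.sum_mem fun q _ => smul_mem_of_left_ideal _ (hI _ (constForm_dxd_mem q f))

theorem sum_gE_sub_gL_mem {I : Submodule R R}
    (hI : ∀ v, odd v ∈ nonnegPart → emb ε (odd v) ∈ I) (f : Fin 5 → PS) :
    ∑ p, z p • gE ε z (f p) - ∑ p, z p • gL ε z (f p) ∈ I := by
  rw [← Finset.sum_sub_distrib]
  refine I.sum_mem fun p _ => ?_
  rw [← smul_sub]
  exact smul_mem_of_left_ideal _ (gE_sub_gL_mem ε z hI (f p))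

/-- Closedness of `w`, contracted with `D_l D_m D_t`. -/
theorem sum_gD_gD_gL {w : FormArray} (hw : w ∈ closedForms) :
    ∑ l, ∑ m, gD ε z l * gD ε z m * gL ε z (w l m) = 0 := by
  have cyc : ∀ F : Fin 5 → Fin 5 → Fin 5 → R,
      ∑ i, ∑ j, ∑ k, F i j k = ∑ i, ∑ j, ∑ k, F j k i := by
    intro F
    rw [Finset.sum_comm (f := fun i j => ∑ k, F j k i)]
    exact Finset.sum_congr rfl fun j _ => Finset.sum_comm
  have hX : ∀ l m t, gD ε z m * gD ε z t * gD ε z l = gD ε z l * gD ε z m * gD ε z t := by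
    intro l m t
    rw [mul_assoc, gD_gD ε z t l, mul_neg, ← mul_assoc, gD_gD ε z m l, neg_mul, neg_neg]
  have h0 : ∑ l, ∑ m, gD ε z l * gD ε z m * gL ε z (w l m)
      = ∑ l, ∑ m, ∑ t, lc t (w l m) • (gD ε z l * gD ε z m * gD ε z t) := by
    simp only [gL_apply, Finset.mul_sum, mul_smul_comm]
  have h1 : ∑ l, ∑ m, ∑ t, lc t (w l m) • (gD ε z l * gD ε z m * gD ε z t)
      = ∑ l, ∑ m, ∑ t, lc l (w m t) • (gD ε z l * gD ε z m * gD ε z t) := by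
    rw [cyc]
    simp only [hX]
  have h2 : ∑ l, ∑ m, ∑ t, lc t (w l m) • (gD ε z l * gD ε z m * gD ε z t)
      = ∑ l, ∑ m, ∑ t, lc m (w t l) • (gD ε z l * gD ε z m * gD ε z t) := by
    rw [h1, cyc]
    simp only [hX]
  have h3 : ∑ l, ∑ m, ∑ t, (lc t (w l m) • (gD ε z l * gD ε z m * gD ε z t)
      + lc l (w m t) • (gD ε z l * gD ε z m * gD ε z t)
      + lc m (w t l) • (gD ε z l * gD ε z m * gD ε z t)) = 0 := by
    refine Finset.sum_eq_zero fun l _ => Finset.sum_eq_zero fun m _ =>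
      Finset.sum_eq_zero fun t _ => ?_
    have h := congrArg MvPowerSeries.constantCoeff (hw.2 t l m)
    rw [map_add, map_add, ← lc_apply, ← lc_apply, ← lc_apply, map_zero] at h
    rw [← add_smul, ← add_smul, h, zero_smul]
  simp only [Finset.sum_add_distrib] at h3
  rw [← h1, ← h2, ← h0] at h3
  have h4 : (3 : ℂ) • ∑ l, ∑ m, gD ε z l * gD ε z m * gL ε z (w l m) = 0 := by
    rw [← h3]
    module
  exact (smul_eq_zero.mp h4).resolve_left (by norm_num)

/-- Terms with `y` in place of one of the factors vanish, as `∑ z_l D_l = 0`. -/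
theorem sum_smul_gD_mul (x : R) : ∑ l, z l • (gD ε z l * x) = 0 := by
  simp only [← smul_mul_assoc, ← Finset.sum_mul, sum_smul_gD, zero_mul]

theorem half_sum_skew {c : Fin 5 → Fin 5 → ℂ} {E : Fin 5 → Fin 5 → R}
    (hc : ∀ a b, c a b = - c b a) (hE : ∀ a b, E a b = - E b a) :
    (1 / 2 : ℂ) • ∑ a, ∑ b, c a b • E a b
      = ∑ a, ∑ b, (if a < b then c a b else 0) • E a b := by
  have h0 : ∀ a, c a a = 0 := fun a => self_eq_neg.mp (hc a a)
  simp only [Fin.sum_univ_five, h0, hc 1 0, hc 2 0, hc 3 0, hc 4 0, hc 2 1, hc 3 1, hc 4 1,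
    hc 3 2, hc 4 2, hc 4 3, hE 1 0, hE 2 0, hE 3 0, hE 4 0, hE 2 1, hE 3 1, hE 4 1, hE 3 2, hE 4 2,
    hE 4 3]
  simp [Fin.lt_def]
  module

/-- Odd elements of `L₊` annihilate `D₁ D₂ D₃ D₄` modulo a left ideal which contains the odd part
of `L₀` and the fields `[w, y ∧ dx_k]`. -/
theorem odd_mul_gD_mem {I : Submodule R R}
    (hI : ∀ v, odd v ∈ nonnegPart → emb ε (odd v) ∈ I) {w : closedForms}
    (hw : odd w ∈ nonnegPart) (hA : ∀ k, gA ε z w k ∈ I) :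
    emb ε (odd w) * (gD ε z 1 * gD ε z 2 * gD ε z 3 * gD ε z 4) ∈ I := by
  set F : Fin 5 → Fin 5 → R := fun k l => ∑ p, z p • gE ε z (formBracket w.1 (dForm p k).1 l)
    with hFdef
  set Φ : Fin 5 → Fin 5 → R := fun k l => ∑ p, z p • gL ε z (formBracket w.1 (dForm p k).1 l)
    with hΦdef
  have hFΦ : ∀ k l, F k l - Φ k l ∈ I := fun k l => sum_gE_sub_gL_mem ε z hI _
  have hF : ∀ k l m, F k l * gD ε z m = - (gD ε z m * F k l) := by
    intro k l m
    simp only [hFdef, Finset.sum_mul, Finset.mul_sum, smul_mul_assoc, mul_smul_comm, gE_gD,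
      smul_neg, Finset.sum_neg_distrib]
  have hX : ∀ k y, emb ε (odd w) * (gD ε z k * y)
      = gA ε z w k * y - gD ε z k * (emb ε (odd w) * y) := by
    intro k y
    rw [← mul_assoc, odd_gD, sub_mul, mul_assoc (gD ε z k)]
  have hAD : ∀ k l, gA ε z w k * gD ε z l = gD ε z l * gA ε z w k + F k l := gA_gD ε z w
  have hAD2 : ∀ k l y, gA ε z w k * (gD ε z l * y)
      = gD ε z l * (gA ε z w k * y) + F k l * y := by
    intro k l y
    rw [← mul_assoc, hAD, add_mul, mul_assoc (gD ε z l)]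
  have hF2 : ∀ k l m y, F k l * (gD ε z m * y) = - (gD ε z m * (F k l * y)) := by
    intro k l m y
    rw [← mul_assoc, hF, neg_mul, mul_assoc]
  generalize hx : emb ε (odd w) = x at *
  have hxI : x ∈ I := hx ▸ hI w hw
  have key : x * (gD ε z 1 * gD ε z 2 * gD ε z 3 * gD ε z 4)
      = (gD ε z 3 * gD ε z 4) * F 1 2 - (gD ε z 2 * gD ε z 4) * F 1 3
        + (gD ε z 2 * gD ε z 3) * F 1 4 + (gD ε z 1 * gD ε z 4) * F 2 3
        - (gD ε z 1 * gD ε z 3) * F 2 4 + (gD ε z 1 * gD ε z 2) * F 3 4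
        + ((gD ε z 2 * gD ε z 3 * gD ε z 4) * gA ε z w 1
          - (gD ε z 1 * gD ε z 3 * gD ε z 4) * gA ε z w 2
          + (gD ε z 1 * gD ε z 2 * gD ε z 4) * gA ε z w 3
          - (gD ε z 1 * gD ε z 2 * gD ε z 3) * gA ε z w 4
          + (gD ε z 1 * gD ε z 2 * gD ε z 3 * gD ε z 4) * x) := by
    have hX' : ∀ k, x * gD ε z k = gA ε z w k - gD ε z k * x := fun k => by
      simpa using hX k 1
    simp only [mul_assoc, hX, hX', hAD, hAD2, hF, hF2, mul_add, mul_sub, mul_neg]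
    abel
  have hΦ : (gD ε z 3 * gD ε z 4) * Φ 1 2 - (gD ε z 2 * gD ε z 4) * Φ 1 3
        + (gD ε z 2 * gD ε z 3) * Φ 1 4 + (gD ε z 1 * gD ε z 4) * Φ 2 3
        - (gD ε z 1 * gD ε z 3) * Φ 2 4 + (gD ε z 1 * gD ε z 2) * Φ 3 4 = 0 := by
    set E : Fin 5 → Fin 5 → R := fun a b => gL ε z (w.1 a b) with hE
    have hskew : ∀ a b, E a b = - E b a := by
      intro a b
      simp only [hE]
      rw [w.2.1 a b, map_neg]
    have hΩ : ∑ l, ∑ m, gD ε z l * gD ε z m * E l m = 0 := sum_gD_gD_gL ε z w.2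
    have hS : ∀ m, ∑ l, z l • (gD ε z l * (gD ε z m * E 0 m)) = 0 :=
      fun m => sum_smul_gD_mul ε z _
    have hf : ∀ p k l, gL ε z (formBracket w.1 (dForm p k).1 l)
        = ∑ a, ∑ b, (if a < b then (levi l a b p k : ℂ) else 0) • E a b := by
      intro p k l
      rw [formBracket_dForm, ← half_sum_skew _ hskew]
      · simp only [map_smul, map_sum, hE]
      · intro a b
        rw [← Int.cast_neg]
        congr 1
        rw [levi, levi, cmpSign_swap b a]
        ring
    have h12 : Φ 1 2 = z 0 • E 3 4 - z 3 • E 0 4 + z 4 • E 0 3 := by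
      simp only [hΦdef, hf, Fin.sum_univ_five]
      simp [levi, cmpSign, Fin.lt_def]
      module
    have h13 : Φ 1 3 = - (z 0 • E 2 4 - z 2 • E 0 4 + z 4 • E 0 2) := by
      simp only [hΦdef, hf, Fin.sum_univ_five]
      simp [levi, cmpSign, Fin.lt_def]
      module
    have h14 : Φ 1 4 = z 0 • E 2 3 - z 2 • E 0 3 + z 3 • E 0 2 := by
      simp only [hΦdef, hf, Fin.sum_univ_five]
      simp [levi, cmpSign, Fin.lt_def]
      module
    have h23 : Φ 2 3 = z 0 • E 1 4 - z 1 • E 0 4 + z 4 • E 0 1 := by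
      simp only [hΦdef, hf, Fin.sum_univ_five]
      simp [levi, cmpSign, Fin.lt_def]
      module
    have h24 : Φ 2 4 = - (z 0 • E 1 3 - z 1 • E 0 3 + z 3 • E 0 1) := by
      simp only [hΦdef, hf, Fin.sum_univ_five]
      simp [levi, cmpSign, Fin.lt_def]
      module
    have h34 : Φ 3 4 = z 0 • E 1 2 - z 1 • E 0 2 + z 2 • E 0 1 := by
      simp only [hΦdef, hf, Fin.sum_univ_five]
      simp [levi, cmpSign, Fin.lt_def]
      module
    rw [h12, h13, h14, h23, h24, h34]
    have hS1 := hS 1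
    have hS2 := hS 2
    have hS3 := hS 3
    have hS4 := hS 4
    have hE0 : ∀ a, E a a = 0 := by
      intro a
      simp only [hE, skew_self w.2.1, map_zero]
    have sq : ∀ k y, gD ε z k * (gD ε z k * y) = 0 := by
      intro k y
      rw [← mul_assoc, gD_sq, zero_mul]
    have anti : ∀ k l y, gD ε z k * (gD ε z l * y) = - (gD ε z l * (gD ε z k * y)) := by
      intro k l y
      rw [← mul_assoc, gD_gD, neg_mul, mul_assoc]
    simp only [Fin.sum_univ_five, mul_assoc, sq, hE0, mul_zero, anti 1 0, anti 2 0, anti 3 0,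
      anti 4 0, anti 2 1, anti 3 1, anti 4 1, anti 3 2, anti 4 2, anti 4 3, hskew 1 0, hskew 2 0,
      hskew 3 0, hskew 4 0, hskew 2 1, hskew 3 1, hskew 4 1, hskew 3 2, hskew 4 2, hskew 4 3,
      mul_add, mul_sub, mul_neg, mul_smul_comm] at hΩ hS1 hS2 hS3 hS4 ⊢
    have hΩ2 : gD ε z 0 * (gD ε z 1 * E 0 1) + gD ε z 0 * (gD ε z 2 * E 0 2)
        + gD ε z 0 * (gD ε z 3 * E 0 3) + gD ε z 0 * (gD ε z 4 * E 0 4)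
        + gD ε z 1 * (gD ε z 2 * E 1 2) + gD ε z 1 * (gD ε z 3 * E 1 3)
        + gD ε z 1 * (gD ε z 4 * E 1 4) + gD ε z 2 * (gD ε z 3 * E 2 3)
        + gD ε z 2 * (gD ε z 4 * E 2 4) + gD ε z 3 * (gD ε z 4 * E 3 4) = 0 := by
      linear_combination (norm := module) (1 / 2 : ℂ) • hΩ
    linear_combination (norm := module) z 0 • hΩ2 - hS1 - hS2 - hS3 - hS4
  have hsum : ∀ a k l, a * F k l - a * Φ k l ∈ I := by
    intro a k l
    rw [← mul_sub]
    exact I.smul_mem a (hFΦ k l)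
  have hAmem : ∀ a k, a * gA ε z w k ∈ I := fun a k => I.smul_mem a (hA k)
  have hxmem : ∀ a, a * x ∈ I := fun a => I.smul_mem a hxI
  rw [key]
  refine I.add_mem ?_ (I.add_mem (I.sub_mem (I.add_mem (I.sub_mem (hAmem _ _) (hAmem _ _))
    (hAmem _ _)) (hAmem _ _)) (hxmem _))
  rw [← sub_zero (_ + _), ← hΦ]
  have := I.add_mem (I.sub_mem (I.add_mem (I.add_mem (I.sub_mem
    (hsum (gD ε z 3 * gD ε z 4) 1 2) (hsum (gD ε z 2 * gD ε z 4) 1 3))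
    (hsum (gD ε z 2 * gD ε z 3) 1 4)) (hsum (gD ε z 1 * gD ε z 4) 2 3))
    (hsum (gD ε z 1 * gD ε z 3) 2 4)) (hsum (gD ε z 1 * gD ε z 2) 3 4)
  convert this using 1
  abel

end Common

/-! ### The action of even elements of `L₊` on `D₁ D₂ D₃ D₄` -/

section Common

set_option linter.unusedSectionVars false

variable {C R : Type} [CommRing C] [Ring R] [Algebra ℂ C] [Algebra ℂ R] [Algebra C R]
  [IsScalarTower ℂ C R] (ε : UEA →ₐ[ℂ] R) (z : Fin 5 → C)

/-- Symmetry of second derivatives, contracted with `D_n D_t`. -/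
theorem sum_gD_gL_pd (f : PS) : ∑ n, gD ε z n * gL ε z (pd n f) = 0 := by
  have h : ∑ n, gD ε z n * gL ε z (pd n f)
      = ∑ n, ∑ t, lc t (pd n f) • (gD ε z n * gD ε z t) := by
    simp only [gL_apply, Finset.mul_sum, mul_smul_comm]
  have h1 : ∑ n, gD ε z n * gL ε z (pd n f) = - ∑ n, gD ε z n * gL ε z (pd n f) := by
    conv_lhs => rw [h, Finset.sum_comm]
    rw [h]
    simp only [← Finset.sum_neg_distrib]
    refine Finset.sum_congr rfl fun n _ => Finset.sum_congr rfl fun t _ => ?_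
    rw [gD_gD, smul_neg, lc_apply, lc_apply, pd_comm]
  have h2 : (2 : ℂ) • ∑ n, gD ε z n * gL ε z (pd n f) = 0 := by
    rw [two_smul]
    nth_rewrite 1 [h1]
    exact neg_add_cancel _
  exact (smul_eq_zero.mp h2).resolve_left two_ne_zero

theorem odd_dxd_mem {f : PS} (hf : ∀ t, lc t f = 0) (q : Fin 5) :
    odd (dxd q f) ∈ nonnegPart := by
  have h := constForm_dxd_mem q f
  simpa [hf] using h

/-- Even elements of `L₊` annihilate `D₁ D₂ D₃ D₄` modulo a left ideal which contains them, the
odd part of `L₀` and the fields `[[P, y ∧ dx_k], y ∧ dx_l]`. -/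
theorem even_mul_gD_mem {I : Submodule R R}
    (hI : ∀ v, odd v ∈ nonnegPart → emb ε (odd v) ∈ I) {P : divFree}
    (hP : ∀ t p, lc t (P.1 p) = 0) (hPI : emb ε (even P) ∈ I)
    (hH : ∀ k l, gH ε z P.1 k l ∈ I) :
    emb ε (even P) * (gD ε z 1 * gD ε z 2 * gD ε z 3 * gD ε z 4) ∈ I := by
  set J : Fin 5 → Fin 5 → Fin 5 → R := fun k l m =>
    ∑ p, z p • ∑ q, z q • gE ε z (formBracket (dxd k (P.1 p)).1 (dForm q l).1 m) with hJdef
  set S : Fin 5 → R := fun a => ∑ p, z p • gL ε z (pd a (P.1 p)) with hSdef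
  set Φ : Fin 5 → Fin 5 → Fin 5 → R := fun k l m =>
    ∑ q, z q • ∑ a, (levi m k a q l : ℂ) • S a with hΦdef
  have hG : ∀ k, gG ε z P k ∈ I := by
    intro k
    refine I.sum_mem fun p _ => smul_mem_of_left_ideal _ ?_
    rw [map_sub]
    exact I.sub_mem (hI _ (odd_dxd_mem (fun t => hP t k) p))
      (hI _ (odd_dxd_mem (fun t => hP t p) k))
  have hJΦ : ∀ k l m, J k l m - Φ k l m ∈ I := by
    intro k l m
    have e : Φ k l m = ∑ p, z p • ∑ q, z q •
        gL ε z (formBracket (dxd k (P.1 p)).1 (dForm q l).1 m) := by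
      simp only [hΦdef, hSdef, formBracket_dxd, map_sum, map_smul, Finset.smul_sum]
      have : ∀ T : Fin 5 → Fin 5 → Fin 5 → R,
          ∑ q, ∑ a, ∑ p, T p q a = ∑ p, ∑ q, ∑ a, T p q a := by
        intro T
        rw [Finset.sum_comm (f := fun p q => ∑ a, T p q a)]
        exact Finset.sum_congr rfl fun q _ => Finset.sum_comm
      rw [this]
      refine Finset.sum_congr rfl fun p _ => Finset.sum_congr rfl fun q _ =>
        Finset.sum_congr rfl fun a _ => ?_
      rw [smul_comm (z p) (z q), smul_comm (levi m k a q l : ℂ) (z p)]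
    rw [e]
    simp only [hJdef]
    rw [← Finset.sum_sub_distrib]
    refine I.sum_mem fun p _ => ?_
    rw [← smul_sub]
    exact smul_mem_of_left_ideal _ (sum_gE_sub_gL_mem ε z hI _)
  have hJ : ∀ k l m n, J k l m * gD ε z n = - (gD ε z n * J k l m) := by
    intro k l m n
    simp only [hJdef, Finset.sum_mul, Finset.mul_sum, smul_mul_assoc, mul_smul_comm, gE_gD,
      smul_neg, Finset.sum_neg_distrib]
  have hXD : ∀ k, emb ε (even P) * gD ε z k = gD ε z k * emb ε (even P) + gG ε z P k :=
    even_gD ε z P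
  have hGD : ∀ k l, gG ε z P k * gD ε z l = gH ε z P.1 k l - gD ε z l * gG ε z P k :=
    gG_gD ε z P
  have hHD : ∀ k l m, gH ε z P.1 k l * gD ε z m = gD ε z m * gH ε z P.1 k l - J k l m :=
    gH_gD ε z P.1
  have hXD2 : ∀ k y, emb ε (even P) * (gD ε z k * y)
      = gD ε z k * (emb ε (even P) * y) + gG ε z P k * y := by
    intro k y
    rw [← mul_assoc, hXD, add_mul, mul_assoc (gD ε z k)]
  have hGD2 : ∀ k l y, gG ε z P k * (gD ε z l * y)
      = gH ε z P.1 k l * y - gD ε z l * (gG ε z P k * y) := by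
    intro k l y
    rw [← mul_assoc, hGD, sub_mul, mul_assoc (gD ε z l)]
  have hHD2 : ∀ k l m y, gH ε z P.1 k l * (gD ε z m * y)
      = gD ε z m * (gH ε z P.1 k l * y) - J k l m * y := by
    intro k l m y
    rw [← mul_assoc, hHD, sub_mul, mul_assoc (gD ε z m)]
  have key : emb ε (even P) * (gD ε z 1 * gD ε z 2 * gD ε z 3 * gD ε z 4)
      = - (- gD ε z 4 * J 1 2 3 + gD ε z 3 * J 1 2 4 - gD ε z 2 * J 1 3 4 + gD ε z 1 * J 2 3 4)
        + ((gD ε z 3 * gD ε z 4) * gH ε z P.1 1 2 - (gD ε z 2 * gD ε z 4) * gH ε z P.1 1 3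
          + (gD ε z 2 * gD ε z 3) * gH ε z P.1 1 4 + (gD ε z 1 * gD ε z 4) * gH ε z P.1 2 3
          - (gD ε z 1 * gD ε z 3) * gH ε z P.1 2 4 + (gD ε z 1 * gD ε z 2) * gH ε z P.1 3 4)
        + (- ((gD ε z 2 * gD ε z 3 * gD ε z 4) * gG ε z P 1)
          + (gD ε z 1 * gD ε z 3 * gD ε z 4) * gG ε z P 2
          - (gD ε z 1 * gD ε z 2 * gD ε z 4) * gG ε z P 3
          + (gD ε z 1 * gD ε z 2 * gD ε z 3) * gG ε z P 4
          + (gD ε z 1 * gD ε z 2 * gD ε z 3 * gD ε z 4) * emb ε (even P)) := by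
    simp only [mul_assoc, hXD, hXD2, hGD, hGD2, hHD, hHD2, hJ, mul_add, mul_sub, neg_mul]
    abel
  have hΦ : - gD ε z 4 * Φ 1 2 3 + gD ε z 3 * Φ 1 2 4 - gD ε z 2 * Φ 1 3 4
      + gD ε z 1 * Φ 2 3 4 = 0 := by
    have h123 : Φ 1 2 3 = z 0 • S 4 - z 4 • S 0 := by
      simp only [hΦdef, Fin.sum_univ_five]
      simp [levi, cmpSign, Fin.lt_def]
      module
    have h124 : Φ 1 2 4 = - (z 0 • S 3 - z 3 • S 0) := by
      simp only [hΦdef, Fin.sum_univ_five]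
      simp [levi, cmpSign, Fin.lt_def]
      module
    have h134 : Φ 1 3 4 = z 0 • S 2 - z 2 • S 0 := by
      simp only [hΦdef, Fin.sum_univ_five]
      simp [levi, cmpSign, Fin.lt_def]
      module
    have h234 : Φ 2 3 4 = - (z 0 • S 1 - z 1 • S 0) := by
      simp only [hΦdef, Fin.sum_univ_five]
      simp [levi, cmpSign, Fin.lt_def]
      module
    have hDS : ∑ n, gD ε z n * S n = 0 := by
      simp only [hSdef, Finset.mul_sum, mul_smul_comm]
      rw [Finset.sum_comm]
      refine Finset.sum_eq_zero fun p _ => ?_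
      rw [← Finset.smul_sum, sum_gD_gL_pd, smul_zero]
    have hS0 := sum_smul_gD_mul ε z (S 0)
    rw [h123, h124, h134, h234]
    simp only [Fin.sum_univ_five, mul_sub, mul_neg, neg_mul, mul_smul_comm] at hDS hS0 ⊢
    linear_combination (norm := module) hS0 - z 0 • hDS
  have hsum : ∀ a k l m, a * J k l m - a * Φ k l m ∈ I := by
    intro a k l m
    rw [← mul_sub]
    exact I.smul_mem a (hJΦ k l m)
  have hHmem : ∀ a k l, a * gH ε z P.1 k l ∈ I := fun a k l => I.smul_mem a (hH k l)
  have hGmem : ∀ a k, a * gG ε z P k ∈ I := fun a k => I.smul_mem a (hG k)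
  rw [key]
  refine I.add_mem (I.add_mem (I.neg_mem ?_) ?_) ?_
  · rw [← sub_zero (_ + _), ← hΦ]
    have := I.add_mem (I.sub_mem (I.add_mem (hsum (-gD ε z 4) 1 2 3) (hsum (gD ε z 3) 1 2 4))
      (hsum (gD ε z 2) 1 3 4)) (hsum (gD ε z 1) 2 3 4)
    convert this using 1
    abel
  · exact I.add_mem (I.sub_mem (I.add_mem (I.add_mem (I.sub_mem (hHmem _ _ _) (hHmem _ _ _))
      (hHmem _ _ _)) (hHmem _ _ _)) (hHmem _ _ _)) (hHmem _ _ _)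
  · exact I.add_mem (I.add_mem (I.sub_mem (I.add_mem (I.neg_mem (hGmem _ _)) (hGmem _ _))
      (hGmem _ _)) (hGmem _ _)) (I.smul_mem _ hPI)

end Common

/-! ### Irreducibility of the symmetric powers -/

theorem matDer_single (i j : Fin 5) (c : ℂ) (f : Poly) :
    matDer (Matrix.single i j c) f = c • (MvPolynomial.X i * MvPolynomial.pderiv j f) := by
  rw [matDer_apply, Finset.sum_eq_single i, Finset.sum_eq_single j]
  · rw [Matrix.single_apply_same]
  · intro k _ hk
    rw [Matrix.single_apply_of_ne _ _ _ _ _ (fun h => hk h.2.symm), zero_smul]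
  · simp
  · intro k _ hk
    refine Finset.sum_eq_zero fun l _ => ?_
    rw [Matrix.single_apply_of_ne _ _ _ _ _ (fun h => hk h.1.symm), zero_smul]
  · simp

theorem eq_C_mul_X_pow {n : ℕ} {f : Poly} (hf : f.IsHomogeneous n)
    (h : ∀ j, j ≠ 0 → MvPolynomial.pderiv j f = 0) :
    f = f.coeff (Finsupp.single 0 n) • (MvPolynomial.X 0 : Poly) ^ n := by
  classical
  ext s
  rw [MvPolynomial.coeff_smul, MvPolynomial.coeff_X_pow, smul_eq_mul]
  split_ifs with hs
  · rw [hs, mul_one]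
  rw [mul_zero]
  by_contra hc
  have hd : s.degree = n := by
    by_contra hd
    exact hc (hf.coeff_eq_zero hd)
  have hs0 : ∀ j, j ≠ 0 → s j = 0 := by
    intro j hj
    by_contra hsj
    have h1 := congrArg (MvPolynomial.coeff (s - Finsupp.single j 1)) (h j hj)
    have h2 : s - Finsupp.single j 1 + Finsupp.single j 1 = s :=
      tsub_add_cancel_of_le (Finsupp.single_le_iff.mpr (Nat.one_le_iff_ne_zero.mpr hsj))
    rw [MvPolynomial.coeff_pderiv, h2, MvPolynomial.coeff_zero] at h1
    have h3 : (((s - Finsupp.single j 1 : Fin 5 →₀ ℕ) j : ℂ) + 1) ≠ 0 := by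
      exact Nat.cast_add_one_ne_zero _
    exact hc ((mul_eq_zero.mp h1).resolve_right h3)
  refine hs ?_
  have h4 : s = Finsupp.single 0 (s 0) := by
    ext j
    by_cases hj : j = 0
    · simp [hj]
    · rw [hs0 j hj, Finsupp.single_eq_of_ne hj]
  rw [h4, Finsupp.degree_single] at hd
  rw [h4, hd]

/-- A nonzero space of forms of degree `n` stable under the operators `z_i ∂_j`, `i ≠ j`, contains
`z_0ⁿ`: apply operators `z_0 ∂_j`, which raise the divisibility by `z_0`. -/
theorem X_pow_mem {n : ℕ} {N : Submodule ℂ Poly}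
    (hN : N ≤ MvPolynomial.homogeneousSubmodule (Fin 5) ℂ n)
    (hst : ∀ i j, i ≠ j → ∀ f ∈ N, MvPolynomial.X i * MvPolynomial.pderiv j f ∈ N)
    {f : Poly} (hf : f ∈ N) (hf0 : f ≠ 0) : (MvPolynomial.X 0 : Poly) ^ n ∈ N := by
  suffices H : ∀ m : ℕ, ∀ f ∈ N, f ≠ 0 → (MvPolynomial.X 0 : Poly) ^ (n + 1 - m) ∣ f →
      (MvPolynomial.X 0 : Poly) ^ n ∈ N from
    H (n + 1) f hf hf0 (by simp)
  intro m
  induction m with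
  | zero =>
    rintro f hf hf0 ⟨g, rfl⟩
    have hg0 : g ≠ 0 := right_ne_zero_of_mul hf0
    have h1 := (hN hf : MvPolynomial.IsHomogeneous _ n).totalDegree hf0
    rw [MvPolynomial.totalDegree_mul_of_isDomain (pow_ne_zero _ (MvPolynomial.X_ne_zero _)) hg0,
      MvPolynomial.totalDegree_X_pow] at h1
    omega
  | succ m ih =>
    intro f hf hf0 hdvd
    by_cases h : ∀ j, j ≠ 0 → MvPolynomial.pderiv j f = 0
    · have h1 := eq_C_mul_X_pow (hN hf) h
      have h2 : f.coeff (Finsupp.single 0 n) ≠ 0 := by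
        intro h2
        rw [h2, zero_smul] at h1
        exact hf0 h1
      rw [h1] at hf
      exact (N.smul_mem_iff h2).mp hf
    · push Not at h
      obtain ⟨j, hj, hjf⟩ := h
      refine ih _ (hst 0 j hj.symm f hf) (mul_ne_zero (MvPolynomial.X_ne_zero _) hjf) ?_
      obtain ⟨g, rfl⟩ := hdvd
      have h1 : MvPolynomial.pderiv j ((MvPolynomial.X 0 : Poly) ^ (n + 1 - (m + 1)) * g)
          = (MvPolynomial.X 0 : Poly) ^ (n + 1 - (m + 1)) * MvPolynomial.pderiv j g := by
        rw [MvPolynomial.pderiv_mul, MvPolynomial.pderiv_pow,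
          MvPolynomial.pderiv_X_of_ne hj.symm]
        ring
      rw [h1, ← mul_assoc, ← pow_succ']
      exact Dvd.dvd.mul_right (pow_dvd_pow _ (by omega)) _

/-- A space of forms of degree `n` stable under the operators `z_i ∂_j`, `i ≠ j`, which contains
`z_0ⁿ` is everything: the operators `z_j ∂_0` produce all monomials. -/
theorem homogeneousSubmodule_le_of_X_pow_mem {n : ℕ} {N : Submodule ℂ Poly}
    (hst : ∀ i j, i ≠ j → ∀ f ∈ N, MvPolynomial.X i * MvPolynomial.pderiv j f ∈ N)
    (h0 : (MvPolynomial.X 0 : Poly) ^ n ∈ N) :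
    MvPolynomial.homogeneousSubmodule (Fin 5) ℂ n ≤ N := by
  have H : ∀ m : ℕ, ∀ s : Fin 5 →₀ ℕ, s.degree = n → s 0 + m = n →
      MvPolynomial.monomial s (1 : ℂ) ∈ N := by
    intro m
    induction m with
    | zero =>
      intro s hs hm
      have h1 : s = Finsupp.single 0 n := by
        have h2 : s.degree = s 0 + s 1 + s 2 + s 3 + s 4 := by
          rw [Finsupp.degree_eq_sum, Fin.sum_univ_five]
        ext j
        fin_cases j <;> simp <;> omega
      rw [h1, ← MvPolynomial.X_pow_eq_monomial]
      exact h0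
    | succ m ih =>
      intro s hs hm
      obtain ⟨j, hj, hsj⟩ : ∃ j, j ≠ 0 ∧ s j ≠ 0 := by
        by_contra h
        push Not at h
        have h2 : s.degree = s 0 + s 1 + s 2 + s 3 + s 4 := by
          rw [Finsupp.degree_eq_sum, Fin.sum_univ_five]
        have h3 := h 1 (by decide)
        have h4 := h 2 (by decide)
        have h5 := h 3 (by decide)
        have h6 := h 4 (by decide)
        omega
      have hle : Finsupp.single j 1 ≤ s :=
        Finsupp.single_le_iff.mpr (Nat.one_le_iff_ne_zero.mpr hsj)
      have hs2 : s - Finsupp.single j 1 + Finsupp.single j 1 = s := tsub_add_cancel_of_le hle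
      have hdeg : (s - Finsupp.single j 1).degree + 1 = n := by
        have h1 := congrArg Finsupp.degree hs2
        rwa [map_add, Finsupp.degree_single, hs] at h1
      have hj0 : (s - Finsupp.single j 1 : Fin 5 →₀ ℕ) 0 = s 0 := by
        rw [Finsupp.tsub_apply, Finsupp.single_eq_of_ne hj.symm, Nat.sub_zero]
      have h3 := ih (s - Finsupp.single j 1 + Finsupp.single 0 1)
        (by rw [map_add, Finsupp.degree_single, hdeg])
        (by rw [Finsupp.add_apply, hj0, Finsupp.single_eq_same]; omega)
      have h4 := hst j 0 hj _ h3
      rw [MvPolynomial.pderiv_monomial, add_tsub_cancel_right, MvPolynomial.X,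
        MvPolynomial.monomial_mul, add_comm (Finsupp.single j 1), hs2, Finsupp.add_apply, hj0,
        Finsupp.single_eq_same, one_mul, one_mul] at h4
      have h5 : MvPolynomial.monomial s ((s 0 + 1 : ℕ) : ℂ)
          = ((s 0 + 1 : ℕ) : ℂ) • MvPolynomial.monomial s (1 : ℂ) := by
        rw [MvPolynomial.smul_monomial, smul_eq_mul, mul_one]
      rw [h5] at h4
      exact (N.smul_mem_iff (Nat.cast_ne_zero.mpr (Nat.succ_ne_zero _))).mp h4
  intro f hf
  rw [MvPolynomial.as_sum f]
  refine N.sum_mem fun s hs => ?_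
  have hd : s.degree = n := by
    by_contra hd
    exact MvPolynomial.mem_support_iff.mp hs ((hf : f.IsHomogeneous n).coeff_eq_zero hd)
  have h1 : MvPolynomial.monomial s (f.coeff s) = f.coeff s • MvPolynomial.monomial s (1 : ℂ) := by
    rw [MvPolynomial.smul_monomial, smul_eq_mul, mul_one]
  rw [h1]
  refine N.smul_mem _ (H (n - s 0) s hd ?_)
  have h2 : s.degree = s 0 + s 1 + s 2 + s 3 + s 4 := by
    rw [Finsupp.degree_eq_sum, Fin.sum_univ_five]
  omega

/-- The power `z_iⁿ` in `Symⁿ(ℂ⁵)`. -/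
def SymPow.pow (i : Fin 5) (n : ℕ) : SymPow n :=
  ⟨MvPolynomial.X i ^ n, by simpa using (MvPolynomial.isHomogeneous_X ℂ i).pow n⟩

/-- The power `(z_i*)ⁿ` in `Symⁿ(ℂ⁵*)`. -/
def SymDual.pow (i : Fin 5) (n : ℕ) : SymDual n :=
  ⟨MvPolynomial.X i ^ n, by simpa using (MvPolynomial.isHomogeneous_X ℂ i).pow n⟩

theorem SymPow.pow_ne_zero (i : Fin 5) (n : ℕ) : SymPow.pow i n ≠ 0 := fun h =>
  _root_.pow_ne_zero n (MvPolynomial.X_ne_zero i) (congrArg Subtype.val h :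
    (MvPolynomial.X i : Poly) ^ n = 0)

theorem SymDual.pow_ne_zero (i : Fin 5) (n : ℕ) : SymDual.pow i n ≠ 0 := fun h =>
  _root_.pow_ne_zero n (MvPolynomial.X_ne_zero i) (congrArg Subtype.val h :
    (MvPolynomial.X i : Poly) ^ n = 0)

instance (n : ℕ) : Nontrivial (SymPow n) := ⟨⟨_, _, SymPow.pow_ne_zero 0 n⟩⟩

instance (n : ℕ) : Nontrivial (SymDual n) := ⟨⟨_, _, SymDual.pow_ne_zero 0 n⟩⟩

theorem SymPow.coe_lie {n : ℕ} (A : sl5) (f : SymPow n) : (⁅A, f⁆ : SymPow n).1 = matDer A.1 f.1 :=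
  rfl

theorem SymDual.coe_lie {n : ℕ} (A : sl5) (f : SymDual n) :
    (⁅A, f⁆ : SymDual n).1 = matDer (-A.1.transpose) f.1 := rfl

theorem SymPow.coe_matE_lie {n : ℕ} (i j : Fin 5) (h : i ≠ j) (f : SymPow n) :
    (⁅matE i j h, f⁆ : SymPow n).1 = MvPolynomial.X i * MvPolynomial.pderiv j f.1 := by
  rw [SymPow.coe_lie, matE, LieAlgebra.SpecialLinear.val_single, matDer_single, one_smul]

theorem SymDual.coe_matE_lie {n : ℕ} (i j : Fin 5) (h : i ≠ j) (f : SymDual n) :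
    (⁅matE i j h, f⁆ : SymDual n).1 = - (MvPolynomial.X j * MvPolynomial.pderiv i f.1) := by
  have e : -(Matrix.single i j (1 : ℂ)).transpose = (-1 : ℂ) • Matrix.single j i (1 : ℂ) := by
    rw [Matrix.transpose_single, neg_smul, one_smul]
  rw [SymDual.coe_lie, matE, LieAlgebra.SpecialLinear.val_single, e, matDer_smul,
    Derivation.smul_apply, matDer_single, one_smul, neg_smul, one_smul]

theorem SymPow.coe_matH_lie {n : ℕ} (i j : Fin 5) (f : SymPow n) :
    (⁅matH i j, f⁆ : SymPow n).1 = MvPolynomial.X i * MvPolynomial.pderiv i f.1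
      - MvPolynomial.X j * MvPolynomial.pderiv j f.1 := by
  have e : Matrix.single i i (1 : ℂ) - Matrix.single j j 1
      = Matrix.single i i (1 : ℂ) + (-1 : ℂ) • Matrix.single j j 1 := by
    rw [neg_smul, one_smul, sub_eq_add_neg]
  rw [SymPow.coe_lie, matH, LieAlgebra.SpecialLinear.val_singleSubSingle, e, matDer_add,
    matDer_smul, Derivation.add_apply, Derivation.smul_apply, matDer_single, matDer_single,
    one_smul,
    neg_smul, one_smul, one_smul, sub_eq_add_neg]

theorem SymDual.coe_matH_lie {n : ℕ} (i j : Fin 5) (f : SymDual n) :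
    (⁅matH i j, f⁆ : SymDual n).1 = MvPolynomial.X j * MvPolynomial.pderiv j f.1
      - MvPolynomial.X i * MvPolynomial.pderiv i f.1 := by
  have e : -(Matrix.single i i (1 : ℂ) - Matrix.single j j 1).transpose
      = Matrix.single j j (1 : ℂ) + (-1 : ℂ) • Matrix.single i i 1 := by
    rw [neg_smul, one_smul, Matrix.transpose_sub, Matrix.transpose_single, Matrix.transpose_single]
    abel
  rw [SymDual.coe_lie, matH, LieAlgebra.SpecialLinear.val_singleSubSingle, e, matDer_add,
    matDer_smul, Derivation.add_apply, Derivation.smul_apply, matDer_single, matDer_single,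
    one_smul,
    neg_smul, one_smul, one_smul, sub_eq_add_neg]

theorem SymPow.eq_top {n : ℕ} {N : Submodule ℂ (SymPow n)}
    (hN : ∀ (i j : Fin 5) (h : i ≠ j), ∀ f ∈ N, ⁅matE i j h, f⁆ ∈ N) (h0 : SymPow.pow 0 n ∈ N) :
    N = ⊤ := by
  set ι : SymPow n →ₗ[ℂ] Poly := (MvPolynomial.homogeneousSubmodule (Fin 5) ℂ n).subtype
  have h := homogeneousSubmodule_le_of_X_pow_mem (n := n) (N := N.map ι) (by
    rintro i j hij _ ⟨f, hf, rfl⟩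
    exact ⟨_, hN i j hij f hf, SymPow.coe_matE_lie i j hij f⟩) ⟨_, h0, rfl⟩
  refine eq_top_iff.mpr fun f _ => ?_
  obtain ⟨g, hg, hgf⟩ := h f.2
  have e : g = f := Subtype.ext hgf
  exact e ▸ hg

instance SymPow.isIrreducible (n : ℕ) : LieModule.IsIrreducible ℂ sl5 (SymPow n) := by
  refine LieModule.IsIrreducible.mk fun N hN => ?_
  have hst : ∀ (i j : Fin 5) (h : i ≠ j), ∀ f ∈ N.toSubmodule, ⁅matE i j h, f⁆ ∈ N.toSubmodule :=
    fun i j h f hf => N.lie_mem hf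
  rw [← LieSubmodule.toSubmodule_inj]
  refine SymPow.eq_top hst ?_
  obtain ⟨f, hf, hf0⟩ := Submodule.exists_mem_ne_zero_of_ne_bot (mt N.toSubmodule_eq_bot.mp hN)
  set ι : SymPow n →ₗ[ℂ] Poly := (MvPolynomial.homogeneousSubmodule (Fin 5) ℂ n).subtype
  have h := X_pow_mem (n := n) (N := N.toSubmodule.map ι) (by
    rintro _ ⟨f, hf, rfl⟩
    exact f.2) (by
    rintro i j hij _ ⟨f, hf, rfl⟩
    exact ⟨_, hst i j hij f hf, SymPow.coe_matE_lie i j hij f⟩) ⟨f, hf, rfl⟩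
    (fun h => hf0 (Subtype.ext h))
  obtain ⟨g, hg, hgf⟩ := h
  have e : g = SymPow.pow 0 n := Subtype.ext hgf
  exact e ▸ hg

instance SymDual.isIrreducible (n : ℕ) : LieModule.IsIrreducible ℂ sl5 (SymDual n) := by
  refine LieModule.IsIrreducible.mk fun N hN => ?_
  set ι : SymDual n →ₗ[ℂ] Poly := (MvPolynomial.homogeneousSubmodule (Fin 5) ℂ n).subtype
  have hst : ∀ i j, i ≠ j → ∀ f ∈ N.toSubmodule.map ι,
      MvPolynomial.X i * MvPolynomial.pderiv j f ∈ N.toSubmodule.map ι := by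
    rintro i j hij _ ⟨f, hf, rfl⟩
    refine ⟨_, N.neg_mem (N.lie_mem (x := matE j i hij.symm) hf), ?_⟩
    have h := SymDual.coe_matE_lie j i hij.symm f
    exact (congrArg Neg.neg h).trans (neg_neg _)
  obtain ⟨f, hf, hf0⟩ := Submodule.exists_mem_ne_zero_of_ne_bot (mt N.toSubmodule_eq_bot.mp hN)
  have h0 := X_pow_mem (n := n) (N := N.toSubmodule.map ι) (by
    rintro _ ⟨f, hf, rfl⟩
    exact f.2) hst ⟨f, hf, rfl⟩ (fun h => hf0 (Subtype.ext h))
  have h := homogeneousSubmodule_le_of_X_pow_mem hst h0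
  rw [← LieSubmodule.toSubmodule_inj]
  refine eq_top_iff.mpr fun f _ => ?_
  obtain ⟨g, hg, hgf⟩ := h f.2
  have e : g = f := Subtype.ext hgf
  exact e ▸ hg

instance SymPow.finiteDimensional (n : ℕ) : FiniteDimensional ℂ (SymPow n) :=
  Module.Finite.iff_fg.mpr (MvPolynomial.homogeneousSubmodule_fg (Fin 5) ℂ n)

instance SymDual.finiteDimensional (n : ℕ) : FiniteDimensional ℂ (SymDual n) :=
  Module.Finite.iff_fg.mpr (MvPolynomial.homogeneousSubmodule_fg (Fin 5) ℂ n)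

theorem X_mul_pderiv_X_pow (i : Fin 5) (n : ℕ) :
    (MvPolynomial.X i : Poly) * MvPolynomial.pderiv i (MvPolynomial.X i ^ n)
      = (n : ℂ) • MvPolynomial.X i ^ n := by
  rcases n with _ | n
  · simp
  · rw [MvPolynomial.pderiv_pow, MvPolynomial.pderiv_X_self, Nat.add_sub_cancel,
      MvPolynomial.smul_eq_C_mul, map_natCast]
    ring

theorem pderiv_X_pow_of_ne {i j : Fin 5} (h : i ≠ j) (n : ℕ) :
    MvPolynomial.pderiv j ((MvPolynomial.X i : Poly) ^ n) = 0 := by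
  rw [MvPolynomial.pderiv_pow, MvPolynomial.pderiv_X_of_ne h, mul_zero]

theorem SymPow.isIrreducibleOfHighestWeight (n : ℕ) :
    IsIrreducibleOfHighestWeight ![n, 0, 0, 0] (SymPow n) := by
  refine ⟨inferInstance, inferInstance, SymPow.pow 0 n, SymPow.pow_ne_zero 0 n, ?_, ?_⟩
  · intro i j h
    refine Subtype.ext ?_
    rw [SymPow.coe_matE_lie]
    change _ * MvPolynomial.pderiv j ((MvPolynomial.X 0 : Poly) ^ n) = 0
    rw [pderiv_X_pow_of_ne (Fin.ne_zero_of_lt h).symm, mul_zero]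
  · intro i
    refine Subtype.ext ?_
    rw [SymPow.coe_matH_lie]
    change _ * MvPolynomial.pderiv _ ((MvPolynomial.X 0 : Poly) ^ n)
      - _ * MvPolynomial.pderiv _ ((MvPolynomial.X 0 : Poly) ^ n)
      = (![n, 0, 0, 0] i : ℂ) • (MvPolynomial.X 0 : Poly) ^ n
    rw [pderiv_X_pow_of_ne (Fin.succ_ne_zero i).symm, mul_zero, sub_zero]
    by_cases hi : i = 0
    · subst hi
      exact X_mul_pderiv_X_pow 0 n
    · rw [pderiv_X_pow_of_ne (fun h => hi (Fin.castSucc_eq_zero_iff.mp h.symm)), mul_zero]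
      fin_cases i <;> simp_all

theorem SymDual.isIrreducibleOfHighestWeight (n : ℕ) :
    IsIrreducibleOfHighestWeight ![0, 0, 0, n] (SymDual n) := by
  refine ⟨inferInstance, inferInstance, SymDual.pow 4 n, SymDual.pow_ne_zero 4 n, ?_, ?_⟩
  · intro i j h
    refine Subtype.ext ?_
    rw [SymDual.coe_matE_lie]
    change -(_ * MvPolynomial.pderiv i ((MvPolynomial.X 4 : Poly) ^ n)) = 0
    rw [pderiv_X_pow_of_ne (by omega), mul_zero, neg_zero]
  · intro i
    refine Subtype.ext ?_
    rw [SymDual.coe_matH_lie]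
    change _ * MvPolynomial.pderiv _ ((MvPolynomial.X 4 : Poly) ^ n)
      - _ * MvPolynomial.pderiv _ ((MvPolynomial.X 4 : Poly) ^ n)
      = (![0, 0, 0, n] i : ℂ) • (MvPolynomial.X 4 : Poly) ^ n
    rw [pderiv_X_pow_of_ne (i := 4) (j := i.castSucc) (Fin.castSucc_lt_last i).ne', mul_zero,
      sub_zero]
    by_cases hi : i = 3
    · subst hi
      exact X_mul_pderiv_X_pow 4 n
    · rw [pderiv_X_pow_of_ne (i := 4) (j := i.succ)
        (fun h => hi (Fin.succ_injective 4 (h.symm : i.succ = Fin.succ 3))), mul_zero]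
      fin_cases i <;> simp_all

/-! ### The quotient of `D₁ D₂ D₃ D₄` by `z_0` -/

section Common

set_option linter.unusedSectionVars false

variable {C R : Type} [CommRing C] [Ring R] [Algebra ℂ C] [Algebra ℂ R] [Algebra C R]
  [IsScalarTower ℂ C R] (ε : UEA →ₐ[ℂ] R) (z : Fin 5 → C)

/-- The element `(1/4) ∑ ± d_{ij} D_k D_l D_m`, the sum over the ten decompositions
`{0, …, 4} = {i, j} ∪ {k, l, m}`; the sign is that of the permutation `(i j k l m)`. It is the
quotient of `D₁ D₂ D₃ D₄` by `z_0`. -/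
def gPsi : R :=
  (1 / 4 : ℂ) • (emb ε (odd (dForm 0 1)) * (gD ε z 2 * (gD ε z 3 * gD ε z 4))
    - emb ε (odd (dForm 0 2)) * (gD ε z 1 * (gD ε z 3 * gD ε z 4))
    + emb ε (odd (dForm 0 3)) * (gD ε z 1 * (gD ε z 2 * gD ε z 4))
    - emb ε (odd (dForm 0 4)) * (gD ε z 1 * (gD ε z 2 * gD ε z 3))
    + emb ε (odd (dForm 1 2)) * (gD ε z 0 * (gD ε z 3 * gD ε z 4))
    - emb ε (odd (dForm 1 3)) * (gD ε z 0 * (gD ε z 2 * gD ε z 4))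
    + emb ε (odd (dForm 1 4)) * (gD ε z 0 * (gD ε z 2 * gD ε z 3))
    + emb ε (odd (dForm 2 3)) * (gD ε z 0 * (gD ε z 1 * gD ε z 4))
    - emb ε (odd (dForm 2 4)) * (gD ε z 0 * (gD ε z 1 * gD ε z 3))
    + emb ε (odd (dForm 3 4)) * (gD ε z 0 * (gD ε z 1 * gD ε z 2)))

theorem emb_dForm_swap (i j : Fin 5) :
    emb ε (odd (dForm j i)) = - emb ε (odd (dForm i j)) := by
  rw [dForm_swap, odd_neg, map_neg]

theorem emb_dForm_self (i : Fin 5) : emb ε (odd (dForm i i)) = 0 := by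
  have h2 : (2 : ℂ) • emb ε (odd (dForm i i)) = 0 := by
    rw [two_smul]
    nth_rewrite 1 [emb_dForm_swap]
    exact neg_add_cancel _
  exact (smul_eq_zero.mp h2).resolve_left two_ne_zero

/-- `z_0 Ψ = D₁ D₂ D₃ D₄`. -/
theorem smul_gPsi : z 0 • gPsi ε z = gD ε z 1 * gD ε z 2 * gD ε z 3 * gD ε z 4 := by
  -- `D_j = ∑ z_p d_{pj}`, times three further factors
  have hD : ∀ j x, gD ε z j * x = ∑ p, z p • (emb ε (odd (dForm p j)) * x) := gD_mul ε z
  have h1 := hD 1 (gD ε z 2 * (gD ε z 3 * gD ε z 4))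
  have h2 := hD 2 (gD ε z 1 * (gD ε z 3 * gD ε z 4))
  have h3 := hD 3 (gD ε z 1 * (gD ε z 2 * gD ε z 4))
  have h4 := hD 4 (gD ε z 1 * (gD ε z 2 * gD ε z 3))
  -- `∑ z_n D_n = 0`, between `d_{ij}` and two further factors
  have hS : ∀ a x, ∑ n, z n • (a * (gD ε z n * x)) = 0 := by
    intro a x
    have h := congrArg (a * ·) (sum_smul_gD_mul ε z x)
    simpa only [Finset.mul_sum, mul_smul_comm, mul_zero] using h
  have k12 := hS (emb ε (odd (dForm 1 2))) (gD ε z 3 * gD ε z 4)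
  have k13 := hS (emb ε (odd (dForm 1 3))) (gD ε z 2 * gD ε z 4)
  have k14 := hS (emb ε (odd (dForm 1 4))) (gD ε z 2 * gD ε z 3)
  have k23 := hS (emb ε (odd (dForm 2 3))) (gD ε z 1 * gD ε z 4)
  have k24 := hS (emb ε (odd (dForm 2 4))) (gD ε z 1 * gD ε z 3)
  have k34 := hS (emb ε (odd (dForm 3 4))) (gD ε z 1 * gD ε z 2)
  have sq : ∀ k y, gD ε z k * (gD ε z k * y) = 0 := by
    intro k y
    rw [← mul_assoc, gD_sq, zero_mul]
  have anti : ∀ k l y, gD ε z k * (gD ε z l * y) = - (gD ε z l * (gD ε z k * y)) := by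
    intro k l y
    rw [← mul_assoc, gD_gD, neg_mul, mul_assoc]
  have anti' := gD_gD ε z
  have sq' := gD_sq ε z
  have e := emb_dForm_swap ε
  have e0 := emb_dForm_self ε
  rw [gPsi, smul_comm, one_div, inv_smul_eq_iff₀ (by norm_num : (4 : ℂ) ≠ 0)]
  generalize gD ε z = D at *
  generalize hE : (fun i j => emb ε (odd (dForm i j))) = E
  have hE' : ∀ i j, emb ε (odd (dForm i j)) = E i j := fun i j => by rw [← hE]
  simp only [hE'] at *
  simp only [Fin.sum_univ_five, mul_assoc, e0, e 1 2, e 1 3, e 1 4,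
    e 2 3, e 2 4, e 3 4, sq, sq', anti 2 1, anti 3 1, anti 4 1, anti 3 2, anti 4 2, anti 4 3,
    anti' 3 2, anti' 4 2, anti' 4 3, mul_zero, zero_mul, smul_zero,
    neg_mul, mul_neg, neg_neg]
    at h1 h2 h3 h4 k12 k13 k14 k23 k24 k34 ⊢
  have e4 : ∀ x : R, (4 : ℂ) • x = x + x + x + x := fun x => by module
  rw [e4]
  linear_combination (norm := module) -h1 + h2 - h3 + h4 + k12 - k13 + k14 + k23 - k24 + k34

end Common


/-! ### The invariant pairing of polynomials -/

/-- The invariant pairing of polynomials: `⟨zˢ, zᵗ⟩ = s! δ_{st}`. -/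
def pair : Poly →ₗ[ℂ] Poly →ₗ[ℂ] ℂ :=
  (MvPolynomial.basisMonomials (Fin 5) ℂ).constr ℂ
    (fun s => ((∏ i, (s i).factorial : ℕ) : ℂ) • MvPolynomial.lcoeff ℂ s)

theorem pair_monomial (s : Fin 5 →₀ ℕ) (c : ℂ) (f : Poly) :
    pair (MvPolynomial.monomial s c) f
      = c * (((∏ i, (s i).factorial : ℕ) : ℂ) * f.coeff s) := by
  have h : MvPolynomial.monomial s c = c • MvPolynomial.basisMonomials (Fin 5) ℂ s := by
    rw [MvPolynomial.coe_basisMonomials, MvPolynomial.smul_monomial, smul_eq_mul, mul_one]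
  rw [h, map_smul, LinearMap.smul_apply, pair, Module.Basis.constr_basis]
  rfl

theorem prod_factorial_add_single (s : Fin 5 →₀ ℕ) (p : Fin 5) :
    ∏ i, ((s + Finsupp.single p 1 : Fin 5 →₀ ℕ) i).factorial
      = (s p + 1) * ∏ i, (s i).factorial := by
  rw [← Finset.mul_prod_erase _ _ (Finset.mem_univ p),
    ← Finset.mul_prod_erase _ (fun i => (s i).factorial) (Finset.mem_univ p), Finsupp.add_apply,
    Finsupp.single_eq_same, Nat.factorial_succ, mul_assoc]
  congr 2
  refine Finset.prod_congr rfl fun i hi => ?_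
  rw [Finsupp.add_apply, Finsupp.single_eq_of_ne (Finset.ne_of_mem_erase hi), add_zero]

theorem pair_X_mul (p : Fin 5) (g f : Poly) :
    pair (MvPolynomial.X p * g) f = pair g (MvPolynomial.pderiv p f) := by
  induction g using MvPolynomial.induction_on' with
  | monomial s c =>
    rw [MvPolynomial.X, MvPolynomial.monomial_mul, one_mul, add_comm, pair_monomial, pair_monomial,
      prod_factorial_add_single, MvPolynomial.coeff_pderiv]
    push_cast
    ring
  | add a b ha hb =>
    rw [mul_add, map_add, map_add, LinearMap.add_apply, LinearMap.add_apply, ha, hb]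

theorem pair_pderiv (p : Fin 5) (g f : Poly) :
    pair (MvPolynomial.pderiv p g) f = pair g (MvPolynomial.X p * f) := by
  induction g using MvPolynomial.induction_on' with
  | monomial s c =>
    rw [MvPolynomial.pderiv_monomial, pair_monomial, pair_monomial, MvPolynomial.coeff_X_mul']
    split_ifs with h
    · have h1 : s p ≠ 0 := Finsupp.mem_support_iff.mp h
      have h2 : s - Finsupp.single p 1 + Finsupp.single p 1 = s :=
        tsub_add_cancel_of_le (Finsupp.single_le_iff.mpr (Nat.one_le_iff_ne_zero.mpr h1))
      have h3 := prod_factorial_add_single (s - Finsupp.single p 1) p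
      have h4 : (s - Finsupp.single p 1 : Fin 5 →₀ ℕ) p + 1 = s p := by
        rw [Finsupp.tsub_apply, Finsupp.single_eq_same]
        omega
      rw [h2, h4] at h3
      rw [h3]
      push_cast
      ring
    · rw [Finsupp.notMem_support_iff.mp h]
      simp
  | add a b ha hb =>
    rw [map_add, map_add, map_add, LinearMap.add_apply, LinearMap.add_apply, ha, hb]

/-- The derivation of the polynomial ring by which `A ∈ sl₅` acts on `Sym(ℂ⁵*)`. -/
def dualDer (A : sl5) : Derivation ℂ Poly Poly := matDer (-A.1.transpose)

theorem pair_matDer (A : sl5) (g f : Poly) :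
    pair g (matDer A.1 f) = - pair (dualDer A g) f := by
  have e : ∀ (c : ℂ) (i j : Fin 5), pair g (c • (MvPolynomial.X i * MvPolynomial.pderiv j f))
      = c * pair (MvPolynomial.X j * MvPolynomial.pderiv i g) f := by
    intro c i j
    rw [map_smul, smul_eq_mul, pair_X_mul, pair_pderiv]
  have e2 : ∀ (c : ℂ) (i j : Fin 5), pair (c • (MvPolynomial.X i * MvPolynomial.pderiv j g)) f
      = c * pair (MvPolynomial.X i * MvPolynomial.pderiv j g) f := by
    intro c i j
    rw [map_smul, LinearMap.smul_apply, smul_eq_mul]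
  rw [dualDer, matDer_apply, matDer_apply]
  simp only [map_sum, LinearMap.sum_apply, e, e2, Matrix.neg_apply, Matrix.transpose_apply, neg_mul,
    Finset.sum_neg_distrib, neg_neg]
  exact Finset.sum_comm

theorem dualDer_X (A : sl5) (k : Fin 5) :
    dualDer A (MvPolynomial.X k) = - ∑ i, A.1 k i • MvPolynomial.X i := by
  rw [dualDer, matDer_X]
  simp [Finset.sum_neg_distrib]

theorem dxd_X (q k : Fin 5) : dxd q (MvPowerSeries.X k) = dForm q k := by
  refine Subtype.ext (funext fun a => funext fun b => ?_)
  rw [dxd_apply]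
  change _ = (if a = q ∧ b = k then (1 : PS) else 0) - (if a = k ∧ b = q then 1 else 0)
  have h : ∀ c, pd c (MvPowerSeries.X k : PS) = if c = k then 1 else 0 := by
    intro c
    split_ifs with hc
    · rw [hc]; exact MvPowerSeries.pderiv_X_self
    · exact MvPowerSeries.pderiv_X_of_ne (Ne.symm hc)
  rw [h, h, ite_and, ite_and]
  congr 1
  split_ifs <;> rfl

theorem emb_dxd_linField {R : Type} [Ring R] [Algebra ℂ R] (ε : UEA →ₐ[ℂ] R) (A : sl5)
    (q k : Fin 5) :
    emb ε (odd (dxd q ((linField A).1 k))) = ∑ i, A.1 i k • emb ε (odd (dForm q i)) := by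
  set T : PS →ₗ[ℂ] L := LinearMap.inr ℂ divFree closedForms ∘ₗ
    { toFun := dxd q, map_add' := dxd_add q, map_smul' := dxd_smul q } with hT
  have e : ∀ f, odd (dxd q f) = T f := fun _ => rfl
  have e2 : ∀ i, odd (dForm q i) = T (MvPowerSeries.X i) := fun i => by rw [← dxd_X, e]
  simp only [e, e2, ← map_smul, ← map_sum]
  rfl

section Common

set_option linter.unusedSectionVars false

variable {C R : Type} [CommRing C] [Ring R] [Algebra ℂ C] [Algebra ℂ R] [Algebra C R]
  [IsScalarTower ℂ C R] (ε : UEA →ₐ[ℂ] R) (z : Fin 5 → C)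

variable {A : sl5} {δ : C → C} {N : R →ₗ[ℂ] R}

/-- The elements `D_k` transform like the covectors `dx_k` under the diagonal action `N` of `sl₅`
on `R`. -/
theorem map_gD (hsmul : ∀ c x, N (c • x) = δ c • x + c • N x)
    (hemb : ∀ y, N (emb ε y) = emb ε (lieB (even (linField A)) y))
    (hz : ∀ p, δ (z p) = - ∑ i, A.1 p i • z i) (k : Fin 5) :
    N (gD ε z k) = ∑ i, A.1 i k • gD ε z i := by
  have h1 : ∀ p, δ (z p) • emb ε (odd (dForm p k))
      = - ∑ i, A.1 p i • z i • emb ε (odd (dForm p k)) := by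
    intro p
    rw [hz, neg_smul, Finset.sum_smul]
    simp only [smul_assoc]
  have h3 : ∀ p i, z p • A.1 i p • emb ε (odd (dForm k i))
      = - (A.1 i p • z p • emb ε (odd (dForm i k))) := by
    intro p i
    rw [emb_dForm_swap, smul_neg, smul_neg, smul_comm]
  simp only [gD, map_sum, hsmul, hemb, h1, odd_lieDeriv_dForm, map_sub, emb_dxd_linField, smul_sub,
    Finset.smul_sum, Finset.sum_add_distrib, Finset.sum_sub_distrib, Finset.sum_neg_distrib, h3]
  rw [Finset.sum_comm (f := fun p i => A.1 p i • z i • emb ε (odd (dForm p k))), sub_neg_eq_add,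
    add_comm, add_neg_cancel_right, Finset.sum_comm]
  exact Finset.sum_congr rfl fun p _ => Finset.sum_congr rfl fun i _ => smul_comm _ _ _

/-- `Ψ` is invariant under the diagonal action `N` of `sl₅`, up to torsion: by `z_0 Ψ = D₁ D₂ D₃ D₄`
and `∑ z_k D_k = 0`, this comes down to `tr A = 0`. -/
theorem smul_smul_map_gPsi (hmul : ∀ x y, N (x * y) = N x * y + x * N y)
    (hsmul : ∀ c x, N (c • x) = δ c • x + c • N x)
    (hemb : ∀ y, N (emb ε y) = emb ε (lieB (even (linField A)) y))
    (hz : ∀ p, δ (z p) = - ∑ i, A.1 p i • z i) :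
    z 0 • z 0 • N (gPsi ε z) = 0 := by
  have h := congrArg N (smul_gPsi ε z)
  rw [hsmul, hmul, hmul, hmul, map_gD ε z hsmul hemb hz, map_gD ε z hsmul hemb hz,
    map_gD ε z hsmul hemb hz, map_gD ε z hsmul hemb hz, hz] at h
  have hP := smul_gPsi ε z
  have sq : ∀ k y, gD ε z k * (gD ε z k * y) = 0 := by
    intro k y
    rw [← mul_assoc, gD_sq, zero_mul]
  have anti : ∀ k l y, gD ε z k * (gD ε z l * y) = - (gD ε z l * (gD ε z k * y)) := by
    intro k l y
    rw [← mul_assoc, gD_gD, neg_mul, mul_assoc]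
  have anti' := gD_gD ε z
  have sq' := gD_sq ε z
  have tr : A.1 0 0 = -(A.1 1 1 + A.1 2 2 + A.1 3 3 + A.1 4 4) := by
    have hA : ∑ i, A.1 i i = 0 := by
      have := A.2
      simpa [LieAlgebra.SpecialLinear.sl, Matrix.trace] using this
    rw [Fin.sum_univ_five] at hA
    linear_combination hA
  have k1 := sum_smul_gD_mul ε z (gD ε z 2 * (gD ε z 3 * gD ε z 4))
  have k2 := sum_smul_gD_mul ε z (gD ε z 1 * (gD ε z 3 * gD ε z 4))
  have k3 := sum_smul_gD_mul ε z (gD ε z 1 * (gD ε z 2 * gD ε z 4))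
  have k4 := sum_smul_gD_mul ε z (gD ε z 1 * (gD ε z 2 * gD ε z 3))
  generalize N (gPsi ε z) = T at *
  generalize gPsi ε z = S at *
  generalize gD ε z = D at *
  simp only [Fin.sum_univ_five, mul_assoc, add_mul, mul_add, smul_mul_assoc, mul_smul_comm, sq, sq',
    anti 1 0, anti 2 0, anti 2 1, anti 3 1, anti 4 1, anti 3 2, anti 4 2,
    anti 4 3, anti' 1 0, anti' 2 0, anti' 3 0, anti' 2 1, anti' 3 1, anti' 3 2,
    anti' 4 2, anti' 4 3, mul_neg, neg_mul, neg_neg, smul_neg, smul_zero, mul_zero, tr,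
    neg_zero, add_zero, neg_smul, add_smul, smul_assoc] at h k1 k2 k3 k4 hP
  linear_combination (norm := module) z 0 • h
    + A.1 0 1 • k1 - A.1 0 2 • k2 + A.1 0 3 • k3 - A.1 0 4 • k4
    - (A.1 1 1 + A.1 2 2 + A.1 3 3 + A.1 4 4) • z 0 • hP + A.1 0 1 • z 1 • hP
    + A.1 0 2 • z 2 • hP + A.1 0 3 • z 3 • hP + A.1 0 4 • z 4 • hP

end Common

/-! ### The generating element of the image of `ψ` -/

/-- The algebra of polynomials with coefficients in `U`. -/
abbrev PolyUEA : Type := Poly ⊗[ℂ] UEA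

/-- The inclusion of `U` into the polynomials with coefficients in `U`. -/
abbrev inclUEA : UEA →ₐ[ℂ] PolyUEA := Algebra.TensorProduct.includeRight

/-- The coordinates of the generic covector `∑ z_p dx_p`. -/
abbrev coord : Fin 5 → Poly := MvPolynomial.X

/-- The generating element `Ψ = ∑ u_a zᵃ` of the elements `u_a`. -/
def Psi : PolyUEA := gPsi inclUEA coord

theorem smul_Psi : coord 0 • Psi
    = gD inclUEA coord 1 * gD inclUEA coord 2 * gD inclUEA coord 3
      * gD inclUEA coord 4 := smul_gPsi inclUEA coord

theorem smul_X_injective (p : Fin 5) :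
    Function.Injective (fun x : PolyUEA => coord p • x) := by
  have h := Module.Flat.rTensor_preserves_injective_linearMap (M := UEA)
    (LinearMap.mulLeft ℂ (coord p))
    (fun f g (h : coord p * f = coord p * g) => mul_left_cancel₀ (MvPolynomial.X_ne_zero p) h)
  have e : ∀ x : PolyUEA, LinearMap.rTensor UEA (LinearMap.mulLeft ℂ (coord p)) x
      = coord p • x := by
    intro x
    induction x using TensorProduct.induction_on with
    | zero => rw [map_zero, smul_zero]
    | add a b ha hb => rw [map_add, smul_add, ha, hb]
    | tmul g u => rfl
  intro x y hxy
  exact h ((e x).trans (hxy.trans (e y).symm))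

/-- The diagonal action of `A ∈ sl₅` on polynomials with coefficients in `U`. -/
def nabla (A : sl5) : PolyUEA →ₗ[ℂ] PolyUEA :=
  LinearMap.mulLeft ℂ (emb inclUEA (even (linField A)))
    - LinearMap.mulRight ℂ (emb inclUEA (even (linField A)))
    + LinearMap.rTensor UEA (dualDer A).toLinearMap

theorem rTensor_derivation_mul (δ : Derivation ℂ Poly Poly) (x y : PolyUEA) :
    LinearMap.rTensor UEA δ.toLinearMap (x * y)
      = LinearMap.rTensor UEA δ.toLinearMap x * y
        + x * LinearMap.rTensor UEA δ.toLinearMap y := by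
  induction x using TensorProduct.induction_on with
  | zero => simp
  | add a b ha hb => rw [add_mul, map_add, map_add, ha, hb, add_mul, add_mul]; abel
  | tmul f u =>
    induction y using TensorProduct.induction_on with
    | zero => simp
    | add a b ha hb => rw [mul_add, map_add, map_add, ha, hb, mul_add, mul_add]; abel
    | tmul g v =>
      simp only [Algebra.TensorProduct.tmul_mul_tmul, LinearMap.rTensor_tmul,
        Derivation.coeFn_coe, Derivation.leibniz, smul_eq_mul,
        TensorProduct.add_tmul]
      rw [add_comm, mul_comm g]

theorem nabla_apply (A : sl5) (x : PolyUEA) :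
    nabla A x = emb inclUEA (even (linField A)) * x - x * emb inclUEA (even (linField A))
      + LinearMap.rTensor UEA (dualDer A).toLinearMap x := rfl

theorem nabla_mul (A : sl5) (x y : PolyUEA) :
    nabla A (x * y) = nabla A x * y + x * nabla A y := by
  simp only [nabla_apply, rTensor_derivation_mul]
  simp only [add_mul, mul_add, sub_mul, mul_sub, mul_assoc]
  abel

theorem nabla_smul (A : sl5) (f : Poly) (x : PolyUEA) :
    nabla A (f • x) = dualDer A f • x + f • nabla A x := by
  have h : LinearMap.rTensor UEA (dualDer A).toLinearMap (f • x)
      = dualDer A f • x + f • LinearMap.rTensor UEA (dualDer A).toLinearMap x := by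
    have e : ∀ g : Poly, ∀ y : PolyUEA, g • y = (g ⊗ₜ[ℂ] (1 : UEA)) * y := fun g y =>
      Algebra.smul_def g y
    rw [e f x, rTensor_derivation_mul, e, e]
    rfl
  rw [nabla_apply, nabla_apply, h, mul_smul_comm, smul_mul_assoc, smul_add, smul_sub]
  abel

theorem nabla_emb (A : sl5) (y : L) :
    nabla A (emb inclUEA y) = emb inclUEA (lieB (even (linField A)) y) := by
  have h : LinearMap.rTensor UEA (dualDer A).toLinearMap (emb inclUEA y) = 0 := by
    change (dualDer A) 1 ⊗ₜ[ℂ] ιU y = 0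
    rw [Derivation.map_one_eq_zero, TensorProduct.zero_tmul]
  rw [nabla_apply, h, add_zero, emb_even_comm]

/-- `Ψ` is invariant under `sl₅`. -/
theorem nabla_Psi (A : sl5) : nabla A Psi = 0 := by
  have h := smul_smul_map_gPsi inclUEA coord (A := A) (nabla_mul A) (nabla_smul A) (nabla_emb A)
    (dualDer_X A)
  refine smul_X_injective 0 (smul_X_injective 0 (h.trans ?_))
  simp only [smul_zero]


/-! ### The elements `u_a` and the map `ψ` -/

/-- Application of a linear functional to the polynomial factor. -/
def contract : (Poly →ₗ[ℂ] ℂ) →ₗ[ℂ] PolyUEA →ₗ[ℂ] UEA where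
  toFun ℓ := (TensorProduct.lid ℂ UEA).toLinearMap ∘ₗ LinearMap.rTensor UEA ℓ
  map_add' a b := by rw [LinearMap.rTensor_add, LinearMap.comp_add]
  map_smul' c a := by rw [LinearMap.rTensor_smul, LinearMap.comp_smul]; rfl

theorem contract_tmul (ℓ : Poly →ₗ[ℂ] ℂ) (f : Poly) (u : UEA) :
    contract ℓ (f ⊗ₜ u) = ℓ f • u := rfl

theorem mul_mem_uMinus {j k : ℕ} {u v : UEA} (hu : u ∈ uMinus j) (hv : v ∈ uMinus k) :
    u * v ∈ uMinus (j + k) := by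
  have h := Submodule.mul_mem_mul hu hv
  rw [uMinus, uMinus, Submodule.span_mul_span] at h
  refine Submodule.span_mono ?_ h
  rintro _ ⟨_, ⟨l, hl, rfl⟩, _, ⟨m, hm, rfl⟩, rfl⟩
  exact ⟨l ++ m, by rw [List.map_append, List.sum_append, hl, hm],
    by rw [List.map_append, List.prod_append]⟩

theorem d_mem_uMinus (i j : Fin 5) : d i j ∈ uMinus 1 :=
  Submodule.subset_span ⟨[Sum.inl (i, j)], rfl, by simp [negGen]⟩

/-- Polynomials of degree `j` whose coefficients lie in the component of degree `k` of `U₋`. -/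
def polyUMinus (j k : ℕ) : Submodule ℂ PolyUEA :=
  Submodule.span ℂ {t | ∃ (f : Poly) (u : UEA), f.IsHomogeneous j ∧ u ∈ uMinus k ∧ t = f ⊗ₜ u}

theorem mul_mem_polyUMinus {j k j' k' : ℕ} {s t : PolyUEA} (hs : s ∈ polyUMinus j k)
    (ht : t ∈ polyUMinus j' k') : s * t ∈ polyUMinus (j + j') (k + k') := by
  have h := Submodule.mul_mem_mul hs ht
  rw [polyUMinus, polyUMinus, Submodule.span_mul_span] at h
  refine Submodule.span_mono ?_ h
  rintro _ ⟨_, ⟨f, u, hf, hu, rfl⟩, _, ⟨g, v, hg, hv, rfl⟩, rfl⟩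
  exact ⟨f * g, u * v, hf.mul hg, mul_mem_uMinus hu hv, Algebra.TensorProduct.tmul_mul_tmul f g u v⟩

theorem emb_dForm_mem (i j : Fin 5) : emb inclUEA (odd (dForm i j)) ∈ polyUMinus 0 1 :=
  Submodule.subset_span ⟨1, d i j, MvPolynomial.isHomogeneous_one _ _, d_mem_uMinus i j, rfl⟩

theorem gD_eq (k : Fin 5) : gD inclUEA coord k = ∑ p, coord p ⊗ₜ d p k := by
  rw [gD]
  refine Finset.sum_congr rfl fun p _ => ?_
  have h : (coord p ⊗ₜ[ℂ] (1 : UEA)) * ((1 : Poly) ⊗ₜ[ℂ] d p k) = coord p ⊗ₜ[ℂ] d p k := by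
    rw [Algebra.TensorProduct.tmul_mul_tmul, mul_one, one_mul]
  exact (Algebra.smul_def (R := Poly) (A := PolyUEA) (coord p)
    (emb inclUEA (odd (dForm p k)))).trans h

theorem gD_mem (k : Fin 5) : gD inclUEA coord k ∈ polyUMinus 1 1 := by
  rw [gD_eq]
  exact Submodule.sum_mem _ fun p _ => Submodule.subset_span
    ⟨coord p, d p k, MvPolynomial.isHomogeneous_X ℂ p, d_mem_uMinus p k, rfl⟩

theorem gPsi_mem {C R : Type} [CommRing C] [Ring R] [Algebra ℂ C] [Algebra ℂ R] [Algebra C R]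
    [IsScalarTower ℂ C R] (ε : UEA →ₐ[ℂ] R) (z : Fin 5 → C) {S : ℕ → ℕ → Submodule ℂ R}
    (hmul : ∀ {j k j' k' : ℕ} {s t : R}, s ∈ S j k → t ∈ S j' k' → s * t ∈ S (j + j') (k + k'))
    (hd : ∀ i j, emb ε (odd (dForm i j)) ∈ S 0 1) (hD : ∀ k, gD ε z k ∈ S 1 1) :
    gPsi ε z ∈ S 3 4 := by
  have h : ∀ i j k l m, emb ε (odd (dForm i j)) * (gD ε z k * (gD ε z l * gD ε z m)) ∈ S 3 4 :=
    fun i j k l m => hmul (hd i j) (hmul (hD k) (hmul (hD l) (hD m)))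
  refine Submodule.smul_mem _ _ ?_
  exact Submodule.add_mem _ (Submodule.sub_mem _ (Submodule.add_mem _ (Submodule.add_mem _
    (Submodule.sub_mem _ (Submodule.add_mem _ (Submodule.sub_mem _ (Submodule.add_mem _
    (Submodule.sub_mem _ (h _ _ _ _ _) (h _ _ _ _ _)) (h _ _ _ _ _)) (h _ _ _ _ _))
    (h _ _ _ _ _)) (h _ _ _ _ _)) (h _ _ _ _ _)) (h _ _ _ _ _)) (h _ _ _ _ _)) (h _ _ _ _ _)

theorem Psi_mem : Psi ∈ polyUMinus 3 4 :=
  gPsi_mem inclUEA coord (S := polyUMinus) mul_mem_polyUMinus emb_dForm_mem gD_mem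

theorem contract_mem {j k : ℕ} (ℓ : Poly →ₗ[ℂ] ℂ) {t : PolyUEA} (ht : t ∈ polyUMinus j k) :
    contract ℓ t ∈ uMinus k := by
  induction ht using Submodule.span_induction with
  | mem t h =>
    obtain ⟨f, u, _, hu, rfl⟩ := h
    exact Submodule.smul_mem _ _ hu
  | zero => rw [map_zero]; exact Submodule.zero_mem _
  | add s t _ _ hs ht => rw [map_add]; exact Submodule.add_mem _ hs ht
  | smul c t _ ht => rw [map_smul]; exact Submodule.smul_mem _ _ ht

/-- The coefficient of the monomial `zᵃ`. -/
def monoCoeff (a : Fin 5 → ℕ) : Poly →ₗ[ℂ] ℂ :=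
  MvPolynomial.lcoeff ℂ (Finsupp.equivFunOnFinite.symm a)

/-- The monomial `zᵃ`. -/
def mono (a : Fin 5 → ℕ) : Poly := ∏ i, MvPolynomial.X i ^ a i

theorem mono_eq (a : Fin 5 → ℕ) :
    mono a = MvPolynomial.monomial (Finsupp.equivFunOnFinite.symm a) 1 := by
  rw [mono, MvPolynomial.monomial_eq, map_one, one_mul, Finsupp.prod_fintype _ _ (by simp)]
  rfl

theorem monoCoeff_mono (a b : Fin 5 → ℕ) : monoCoeff a (mono b) = if b = a then 1 else 0 := by
  rw [mono_eq]
  change MvPolynomial.coeff _ (MvPolynomial.monomial _ 1) = _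
  rw [MvPolynomial.coeff_monomial]
  simp only [EmbeddingLike.apply_eq_iff_eq]

/-- The expansion of a form of degree `k` in monomials. -/
theorem sum_monoCoeff {k : ℕ} {f : Poly} (hf : f.IsHomogeneous k) :
    ∑ a : MultiIndex k, monoCoeff a.1 f • mono a.1 = f := by
  ext s
  rw [MvPolynomial.coeff_sum]
  have h : ∀ a : MultiIndex k, MvPolynomial.coeff s (monoCoeff a.1 f • mono a.1)
      = if a.1 = s then f.coeff s else 0 := by
    intro a
    rw [MvPolynomial.coeff_smul, mono_eq, MvPolynomial.coeff_monomial, smul_eq_mul]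
    have e : Finsupp.equivFunOnFinite.symm a.1 = s ↔ a.1 = s :=
      Equiv.symm_apply_eq Finsupp.equivFunOnFinite
    by_cases ha : a.1 = s
    · rw [if_pos ha, if_pos (e.mpr ha), mul_one, ← e.mpr ha]
      rfl
    · rw [if_neg ha, if_neg (mt e.mp ha), mul_zero]
  simp only [h]
  by_cases hs : s.degree = k
  · have hm : (s : Fin 5 → ℕ) ∈ (Finset.univ : Finset (Fin 5)).piAntidiag k := by
      rw [Finset.mem_piAntidiag]
      exact ⟨by rw [← hs, Finsupp.degree_eq_sum], fun i _ => Finset.mem_univ i⟩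
    rw [Finset.sum_eq_single ⟨s, hm⟩]
    · exact if_pos rfl
    · intro a _ ha
      exact if_neg fun h => ha (Subtype.ext h)
    · simp
  · rw [hf.coeff_eq_zero hs]
    simp

theorem sum_mono_tmul {j k : ℕ} {t : PolyUEA} (ht : t ∈ polyUMinus j k) :
    t = ∑ a : MultiIndex j, mono a.1 ⊗ₜ contract (monoCoeff a.1) t := by
  induction ht using Submodule.span_induction with
  | mem t h =>
    obtain ⟨f, u, hf, _, rfl⟩ := h
    have h : ∀ a : MultiIndex j, mono a.1 ⊗ₜ[ℂ] contract (monoCoeff a.1) (f ⊗ₜ u)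
        = (monoCoeff a.1 f • mono a.1) ⊗ₜ[ℂ] u := fun a => by
      rw [contract_tmul, TensorProduct.tmul_smul, TensorProduct.smul_tmul']
    rw [Finset.sum_congr rfl fun a _ => h a, ← TensorProduct.sum_tmul, sum_monoCoeff hf]
  | zero => simp
  | add s t _ _ hs ht =>
    simp only [map_add, TensorProduct.tmul_add, Finset.sum_add_distrib]
    rw [← hs, ← ht]
  | smul c t _ ht =>
    simp only [map_smul, TensorProduct.tmul_smul, ← Finset.smul_sum]
    rw [← ht]

/-- The elements `u_a`: the coefficients of `Ψ`. -/
def uElt (a : Fin 5 → ℕ) : UEA := contract (monoCoeff a) Psi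

theorem uElt_mem (a : Fin 5 → ℕ) : uElt a ∈ uMinus 4 := contract_mem _ Psi_mem

theorem Psi_eq : Psi = ∑ a : MultiIndex 3, mono a.1 ⊗ₜ uElt a.1 := sum_mono_tmul Psi_mem

/-- The map `ψ : Sym³(ℂ⁵) → U`: the contraction of `Ψ` by the invariant pairing. -/
def psi : SymPow 3 →ₗ[ℂ] UEA where
  toFun f := (1 / 6 : ℂ) • contract (pair.flip f.1) Psi
  map_add' f g := by
    change (1 / 6 : ℂ) • contract (pair.flip (f.1 + g.1)) Psi = _
    rw [map_add, map_add, LinearMap.add_apply, smul_add]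
  map_smul' c f := by
    change (1 / 6 : ℂ) • contract (pair.flip (c • f.1)) Psi = _
    rw [map_smul, map_smul, LinearMap.smul_apply, smul_comm]
    rfl

theorem psi_apply (f : SymPow 3) : psi f = (1 / 6 : ℂ) • contract (pair.flip f.1) Psi := rfl

theorem psi_mem (f : SymPow 3) : psi f ∈ uMinus 4 :=
  Submodule.smul_mem _ _ (contract_mem _ Psi_mem)

theorem nabla_tmul (A : sl5) (f : Poly) (u : UEA) :
    nabla A (f ⊗ₜ u) = f ⊗ₜ (ιU (even (linField A)) * u)
      - f ⊗ₜ (u * ιU (even (linField A))) + dualDer A f ⊗ₜ u := by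
  rw [nabla_apply]
  change ((1 : Poly) ⊗ₜ[ℂ] ιU (even (linField A))) * (f ⊗ₜ[ℂ] u)
    - (f ⊗ₜ[ℂ] u) * ((1 : Poly) ⊗ₜ[ℂ] ιU (even (linField A))) + _ = _
  rw [Algebra.TensorProduct.tmul_mul_tmul, Algebra.TensorProduct.tmul_mul_tmul, one_mul, mul_one]
  rfl

theorem contract_nabla (A : sl5) (ℓ : Poly →ₗ[ℂ] ℂ) (t : PolyUEA) :
    contract ℓ (nabla A t) = ιU (even (linField A)) * contract ℓ t
      - contract ℓ t * ιU (even (linField A)) + contract (ℓ ∘ₗ (dualDer A).toLinearMap) t := by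
  induction t using TensorProduct.induction_on with
  | zero => simp
  | add s t hs ht =>
    simp only [map_add, hs, ht, mul_add, add_mul]
    abel
  | tmul f u =>
    rw [nabla_tmul, map_add, map_sub, contract_tmul, contract_tmul, contract_tmul, contract_tmul,
      contract_tmul, mul_smul_comm, smul_mul_assoc]
    rfl

theorem psi_lie (A : sl5) (f : SymPow 3) :
    psi ⁅A, f⁆ = ιU (even (linField A)) * psi f - psi f * ιU (even (linField A)) := by
  have h := contract_nabla A (pair.flip f.1) Psi
  have e : pair.flip (⁅A, f⁆ : SymPow 3).1 = - (pair.flip f.1 ∘ₗ (dualDer A).toLinearMap) := by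
    refine LinearMap.ext fun g => ?_
    exact pair_matDer A g f.1
  rw [nabla_Psi, map_zero] at h
  rw [psi_apply, psi_apply, e, map_neg, LinearMap.neg_apply, mul_smul_comm, smul_mul_assoc,
    ← smul_sub]
  congr 1
  rw [neg_eq_iff_add_eq_zero, add_comm]
  exact h.symm

theorem pair_flip_mono (a : Fin 5 → ℕ) :
    pair.flip (mono a) = ((∏ i, (a i).factorial : ℕ) : ℂ) • monoCoeff a := by
  refine (MvPolynomial.basisMonomials (Fin 5) ℂ).ext fun s => ?_
  rw [MvPolynomial.coe_basisMonomials, LinearMap.flip_apply, pair_monomial, mono_eq,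
    MvPolynomial.coeff_monomial, LinearMap.smul_apply, smul_eq_mul, one_mul, monoCoeff,
    MvPolynomial.lcoeff_apply, MvPolynomial.coeff_monomial]
  by_cases h : Finsupp.equivFunOnFinite.symm a = s
  · rw [if_pos h, if_pos h.symm, ← h]
    rfl
  · rw [if_neg h, if_neg (Ne.symm h), mul_zero, mul_zero]

theorem psi_dualMonomial (a : MultiIndex 3) : psi (dualMonomial a) = uElt a.1 := by
  have h := Nat.multinomial_spec Finset.univ a.1
  rw [a.sum_eq] at h
  have h2 : ((∏ i, (a.1 i).factorial : ℕ) : ℂ) * (Nat.multinomial Finset.univ a.1 : ℂ) = 6 := by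
    exact_mod_cast h
  have e : (monomial a).1 = mono a.1 := rfl
  rw [dualMonomial, map_smul, psi_apply, e, pair_flip_mono, map_smul, LinearMap.smul_apply,
    smul_smul, smul_smul, uElt]
  have h3 : (Nat.multinomial Finset.univ a.1 : ℂ) * (1 / 6 * ((∏ i, (a.1 i).factorial : ℕ) : ℂ))
      = 1 := by
    linear_combination (1 / 6 : ℂ) * h2
  rw [← mul_assoc] at h3
  rw [h3, one_smul]

/-- Evaluation of the polynomial coefficient at `z = (1, 0, 0, 0, 0)`. -/
def evalFirst : PolyUEA →ₐ[ℂ] UEA :=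
  (Algebra.TensorProduct.lid ℂ UEA).toAlgHom.comp
    (Algebra.TensorProduct.map (MvPolynomial.aeval (Pi.single 0 1 : Fin 5 → ℂ)) (AlgHom.id ℂ UEA))

theorem evalFirst_tmul (f : Poly) (u : UEA) :
    evalFirst (f ⊗ₜ u) = MvPolynomial.aeval (Pi.single 0 1 : Fin 5 → ℂ) f • u := rfl

theorem evalFirst_gD (k : Fin 5) : evalFirst (gD inclUEA coord k) = d 0 k := by
  rw [gD_eq, map_sum, Finset.sum_eq_single 0]
  · rw [evalFirst_tmul, MvPolynomial.aeval_X, Pi.single_eq_same, one_smul]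
  · intro p _ hp
    rw [evalFirst_tmul, MvPolynomial.aeval_X, Pi.single_eq_of_ne hp, zero_smul]
  · simp

theorem eq_firstIndex_iff {k : ℕ} (a : MultiIndex k) :
    a = firstIndex k ↔ a.1 1 = 0 ∧ a.1 2 = 0 ∧ a.1 3 = 0 ∧ a.1 4 = 0 := by
  have ha := a.sum_eq
  rw [Fin.sum_univ_five] at ha
  constructor
  · rintro rfl
    simp [firstIndex]
  · rintro ⟨h1, h2, h3, h4⟩
    refine Subtype.ext (funext fun i => ?_)
    fin_cases i <;> simp [firstIndex] <;> omega

theorem aeval_mono {k : ℕ} (a : MultiIndex k) :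
    MvPolynomial.aeval (Pi.single 0 1 : Fin 5 → ℂ) (mono a.1)
      = if a = firstIndex k then 1 else 0 := by
  rw [mono, map_prod]
  simp only [map_pow, MvPolynomial.aeval_X]
  rw [Fin.prod_univ_five]
  simp only [eq_firstIndex_iff, Pi.single_eq_same, one_pow, one_mul, Pi.single_apply]
  by_cases h1 : a.1 1 = 0 <;> by_cases h2 : a.1 2 = 0 <;> by_cases h3 : a.1 3 = 0 <;>
    by_cases h4 : a.1 4 = 0 <;> simp [h1, h2, h3, h4]

theorem map_gPsi_of_map_smul {C R S : Type} [CommRing C] [Ring R] [Ring S] [Algebra ℂ C]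
    [Algebra ℂ R] [Algebra ℂ S] [Algebra C R] [IsScalarTower ℂ C R] (ε : UEA →ₐ[ℂ] R)
    (z : Fin 5 → C) (η : R →ₐ[ℂ] S) (h : ∀ x, η (z 0 • x) = η x) :
    η (gPsi ε z) = η (gD ε z 1) * η (gD ε z 2) * η (gD ε z 3) * η (gD ε z 4) := by
  rw [← h, smul_gPsi, map_mul, map_mul, map_mul]

theorem evalFirst_smul (x : PolyUEA) : evalFirst (coord 0 • x) = evalFirst x := by
  induction x using TensorProduct.induction_on with
  | zero => rw [smul_zero]
  | add a b ha hb => rw [smul_add, map_add, map_add, ha, hb]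
  | tmul f u =>
    rw [TensorProduct.smul_tmul', evalFirst_tmul, evalFirst_tmul, smul_eq_mul, map_mul,
      MvPolynomial.aeval_X, Pi.single_eq_same, one_mul]

theorem uElt_firstIndex : uElt (firstIndex 3).1 = d 0 1 * d 0 2 * d 0 3 * d 0 4 := by
  have h : evalFirst Psi = d 0 1 * d 0 2 * d 0 3 * d 0 4 := by
    rw [← evalFirst_gD, ← evalFirst_gD, ← evalFirst_gD, ← evalFirst_gD]
    exact map_gPsi_of_map_smul inclUEA coord evalFirst evalFirst_smul
  have h2 : ∀ a : MultiIndex 3, evalFirst (mono a.1 ⊗ₜ uElt a.1)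
      = (if a = firstIndex 3 then (1 : ℂ) else 0) • uElt a.1 := fun a => by
    rw [evalFirst_tmul, aeval_mono]
  rw [← h, Psi_eq, map_sum, Finset.sum_congr rfl fun a _ => h2 a]
  generalize firstIndex 3 = b
  simp only [ite_smul, one_smul, zero_smul, Finset.sum_ite_eq', Finset.mem_univ, if_true]

theorem psi_firstIndex :
    psi (monomial (firstIndex 3)) = d 0 1 * d 0 2 * d 0 3 * d 0 4 := by
  have h : dualMonomial (firstIndex 3) = monomial (firstIndex 3) := by
    rw [dualMonomial]
    have h1 := Nat.multinomial_spec Finset.univ (firstIndex 3).1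
    have h2 : ∏ i, ((firstIndex 3).1 i).factorial = 6 := by
      rw [Fin.prod_univ_five]
      simp [firstIndex, Nat.factorial]
    rw [(firstIndex 3).sum_eq, h2] at h1
    have h3 : Nat.multinomial Finset.univ (firstIndex 3).1 = 1 := by
      have : Nat.factorial 3 = 6 := rfl
      omega
    rw [h3, Nat.cast_one, one_smul]
  rw [← h, psi_dualMonomial, uElt_firstIndex]


/-! ### Morphisms of generalized Verma modules -/

/-- The subalgebra `L₊` of elements of positive degree. -/
def posPart : Submodule ℂ L where
  carrier := {x | x ∈ nonnegPart ∧ linPart x = 0}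
  add_mem' := by
    rintro x y ⟨hx, hx2⟩ ⟨hy, hy2⟩
    refine ⟨nonnegPart.add_mem hx hy, ?_⟩
    rw [← linPartL_apply, map_add, linPartL_apply, linPartL_apply, hx2, hy2, add_zero]
  zero_mem' := ⟨nonnegPart.zero_mem, by rw [← linPartL_apply, map_zero]⟩
  smul_mem' := by
    rintro c x ⟨hx, hx2⟩
    refine ⟨nonnegPart.smul_mem c hx, ?_⟩
    rw [← linPartL_apply, map_smul, linPartL_apply, hx2, smul_zero]

theorem linField_mem (A : sl5) : even (linField A) ∈ nonnegPart := by
  refine ⟨fun j => ?_, fun i j => map_zero _⟩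
  change MvPowerSeries.constantCoeff (∑ i, A.1 i j • (MvPowerSeries.X i : PS)) = 0
  rw [map_sum]
  refine Finset.sum_eq_zero fun i _ => ?_
  rw [MvPowerSeries.smul_eq_C_mul, map_mul, MvPowerSeries.constantCoeff_X, mul_zero]

theorem linPart_linField (A : sl5) : linPart (even (linField A)) = A := by
  refine Subtype.ext (Matrix.ext fun k j => ?_)
  rw [linPart_apply]
  change MvPowerSeries.constantCoeff (pd k (∑ i, A.1 i j • (MvPowerSeries.X i : PS))) = A.1 k j
  rw [← lc_apply, map_sum, Finset.sum_eq_single k]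
  · rw [map_smul, lc_apply, MvPowerSeries.pderiv_X_self, map_one, smul_eq_mul, mul_one]
  · intro i _ hi
    rw [map_smul, lc_apply, MvPowerSeries.pderiv_X_of_ne hi, map_zero, smul_zero]
  · simp

theorem sub_linField_mem {x : L} (hx : x ∈ nonnegPart) :
    x - even (linField (linPart x)) ∈ posPart := by
  refine ⟨nonnegPart.sub_mem hx (linField_mem _), ?_⟩
  rw [← linPartL_apply, map_sub, linPartL_apply, linPartL_apply, linPart_linField, sub_self]

theorem lie_linField_mem (A : sl5) {x : L} (hx : x ∈ posPart) :
    lieB (even (linField A)) x ∈ posPart := by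
  refine ⟨lieB_mem_nonnegPart (linField_mem A) hx.1, ?_⟩
  rw [linPart_lieB (linField_mem A) hx.1, hx.2, lie_zero]

theorem even_mem_posPart {x : L} (hx : x ∈ posPart) : even x.1 ∈ posPart :=
  ⟨⟨hx.1.1, fun _ _ => map_zero _⟩, hx.2⟩

theorem odd_mem_posPart {x : L} (hx : x ∈ posPart) : odd x.2 ∈ posPart :=
  ⟨⟨fun _ => map_zero _, hx.1.2⟩, linPart_odd _⟩

section Morphism

set_option linter.unusedSectionVars false

variable {V W : Type} [AddCommGroup V] [Module ℂ V] [LieRingModule sl5 V] [LieModule ℂ sl5 V]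
  [AddCommGroup W] [Module ℂ W] [LieRingModule sl5 W] [LieModule ℂ sl5 W]

/-- A `g₀`-equivariant map from `V` to the vectors of `M(W)` annihilated by `L₊` extends to a
morphism `M(V) → M(W)`. -/
theorem exists_morphism (s : V →ₗ[ℂ] Verma W)
    (hlie : ∀ (A : sl5) (v : V), ιU (even (linField A)) • s v = s ⁅A, v⁆)
    (hpos : ∀ x ∈ posPart, ∀ v, ιU x • s v = 0) :
    ∃ t : Verma V →ₗ[UEA] Verma W, ∀ v, t (tmul 1 v) = s v := by
  set T₀ : UEA ⊗[ℂ] V →ₗ[ℂ] Verma W := TensorProduct.lift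
    (LinearMap.mk₂ ℂ (fun u v => u • s v) (fun a b v => add_smul a b _)
      (fun c u v => smul_assoc c u _) (fun u v w => by rw [map_add, smul_add])
      (fun c u v => by rw [map_smul, smul_comm])) with hT₀
  have hT₀_tmul : ∀ u v, T₀ (u ⊗ₜ v) = u • s v := fun u v => rfl
  let T : UEA ⊗[ℂ] V →ₗ[UEA] Verma W :=
    { toFun := T₀
      map_add' := map_add T₀
      map_smul' := fun u t => by
        induction t using TensorProduct.induction_on with
        | zero => simp
        | add a b ha hb => rw [smul_add, map_add, map_add, ha, hb, smul_add]
        | tmul u' v =>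
          rw [TensorProduct.smul_tmul', hT₀_tmul, hT₀_tmul, smul_eq_mul, mul_smul]
          rfl }
  have hT : vermaRel V ≤ LinearMap.ker T := by
    refine Submodule.span_le.mpr ?_
    rintro _ ⟨u, x, v, hx, rfl⟩
    change T₀ _ = 0
    have h1 : x = even (linField (linPart x)) + (x - even (linField (linPart x))) := by abel
    have h2 : ιU x • s v = s ⁅linPart x, v⁆ := by
      conv_lhs => rw [h1, map_add, add_smul, hpos _ (sub_linField_mem hx), add_zero]
      exact hlie _ v
    rw [map_sub, hT₀_tmul, hT₀_tmul, mul_smul, h2, sub_self]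
  refine ⟨(vermaRel V).liftQ T hT, fun v => ?_⟩
  exact one_smul UEA (s v)

variable (W) in
/-- The bilinear map `u ⊗ w ↦ u ⊗ w` from `U × W` to `M(W)`. -/
def tmulL : UEA →ₗ[ℂ] W →ₗ[ℂ] Verma W :=
  LinearMap.mk₂ ℂ tmul (fun u v w => tmul_add_left u v w) (fun c u w => rfl)
    (fun u v w => by rw [tmul, TensorProduct.tmul_add]; rfl)
    (fun c u w => by rw [tmul, TensorProduct.tmul_smul]; rfl)

theorem tmulL_apply (u : UEA) (w : W) : tmulL W u w = tmul u w := rfl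

/-- For a bilinear map `β` with values in `W`, the map `f ⊗ u ↦ u ⊗ β(f, v)`. -/
def actOn (β : Poly →ₗ[ℂ] V →ₗ[ℂ] W) : V →ₗ[ℂ] PolyUEA →ₗ[ℂ] Verma W where
  toFun v := TensorProduct.lift ((tmulL W).flip ∘ₗ β.flip v)
  map_add' v w := by
    refine TensorProduct.ext' fun f u => ?_
    simp
  map_smul' c v := by
    refine TensorProduct.ext' fun f u => ?_
    simp

theorem actOn_tmul (β : Poly →ₗ[ℂ] V →ₗ[ℂ] W) (v : V) (f : Poly) (u : UEA) :
    actOn β v (f ⊗ₜ u) = tmul u (β f v) := rfl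

theorem actOn_Psi (β : Poly →ₗ[ℂ] V →ₗ[ℂ] W) (v : V) :
    actOn β v Psi = ∑ a : MultiIndex 3, tmul (uElt a.1) (β (mono a.1) v) := by
  rw [Psi_eq, map_sum]
  rfl

theorem smul_actOn (β : Poly →ₗ[ℂ] V →ₗ[ℂ] W)
    (hβ : ∀ (A : sl5) f v, ⁅A, β f v⁆ = β (dualDer A f) v + β f ⁅A, v⁆) (A : sl5) (v : V)
    (t : PolyUEA) :
    ιU (even (linField A)) • actOn β v t = actOn β v (nabla A t) + actOn β ⁅A, v⁆ t := by
  induction t using TensorProduct.induction_on with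
  | zero => simp
  | add a b ha hb =>
    rw [map_add, map_add, map_add, map_add, smul_add, ha, hb]
    abel
  | tmul f u =>
    have h := tmul_nonneg (linField_mem A) u (β f v)
    rw [linPart_linField, hβ] at h
    rw [nabla_tmul, map_add, map_sub, actOn_tmul, actOn_tmul, actOn_tmul, actOn_tmul, actOn_tmul,
      smul_tmul_eq, h, ← tmulL_apply u (_ + _), map_add, tmulL_apply, tmulL_apply]
    abel

theorem smul_actOn_Psi (β : Poly →ₗ[ℂ] V →ₗ[ℂ] W)
    (hβ : ∀ (A : sl5) f v, ⁅A, β f v⁆ = β (dualDer A f) v + β f ⁅A, v⁆) (A : sl5) (v : V) :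
    ιU (even (linField A)) • actOn β v Psi = actOn β ⁅A, v⁆ Psi := by
  rw [smul_actOn β hβ, nabla_Psi, map_zero, zero_add]

/-- The morphism of degree `4` given by an equivariant bilinear map `β : Sym(ℂ⁵*) × V → W` for which
the vectors `∑ u_a ⊗ β(zᵃ, v)` are annihilated by `L₊`. -/
theorem exists_morphism_of_equivariant (β : Poly →ₗ[ℂ] V →ₗ[ℂ] W)
    (hβ : ∀ (A : sl5) f v, ⁅A, β f v⁆ = β (dualDer A f) v + β f ⁅A, v⁆)
    (hpos : ∀ x ∈ posPart, ∀ v, ιU x • actOn β v Psi = 0) :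
    ∃ t : Verma V →ₗ[UEA] Verma W, HasDegree t 4 ∧
      ∀ v, t (tmul 1 v) = ∑ a : MultiIndex 3, tmul (uElt a.1) (β (mono a.1) v) := by
  obtain ⟨t, ht⟩ := exists_morphism ((actOn β).flip Psi) (smul_actOn_Psi β hβ) hpos
  have h : ∀ v, t (tmul 1 v) = ∑ a : MultiIndex 3, tmul (uElt a.1) (β (mono a.1) v) :=
    fun v => (ht v).trans (actOn_Psi β v)
  refine ⟨t, ⟨Fintype.card (MultiIndex 3),
    fun i => uElt ((Fintype.equivFin (MultiIndex 3)).symm i).1,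
    fun i => β (mono ((Fintype.equivFin (MultiIndex 3)).symm i).1), fun i => uElt_mem _,
    fun v => ?_⟩, h⟩
  rw [h]
  exact (Equiv.sum_comp (Fintype.equivFin (MultiIndex 3)).symm
    (fun a : MultiIndex 3 => tmul (uElt a.1) (β (mono a.1) v))).symm

end Morphism


/-! ### Constant coefficient differential operators -/

theorem pderiv_commute (i j : Fin 5) :
    Commute ((MvPolynomial.pderiv i).toLinearMap : Module.End ℂ Poly)
      (MvPolynomial.pderiv j).toLinearMap := by
  refine LinearMap.ext fun f => ?_
  have h : ⁅(MvPolynomial.pderiv i : Derivation ℂ Poly Poly),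
      (MvPolynomial.pderiv j : Derivation ℂ Poly Poly)⁆ = 0 := by
    refine MvPolynomial.derivation_ext fun k => ?_
    rw [Derivation.commutator_apply, MvPolynomial.pderiv_X, MvPolynomial.pderiv_X]
    simp only [Pi.single_apply]
    split_ifs <;> simp
  have h2 := congrArg (fun D : Derivation ℂ Poly Poly => D f) h
  simp only [Derivation.commutator_apply, Derivation.zero_apply, sub_eq_zero] at h2
  exact h2

theorem diffPoly_eq (a : Fin 5 → ℕ) :
    diffPoly a = ((MvPolynomial.pderiv 0).toLinearMap : Module.End ℂ Poly) ^ a 0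
      * ((MvPolynomial.pderiv 1).toLinearMap ^ a 1 * ((MvPolynomial.pderiv 2).toLinearMap ^ a 2
      * ((MvPolynomial.pderiv 3).toLinearMap ^ a 3
          * (MvPolynomial.pderiv 4).toLinearMap ^ a 4))) := by
  simp [diffPoly, List.ofFn_succ]

theorem diffPoly_add_single (s : Fin 5 →₀ ℕ) (p : Fin 5) :
    diffPoly (s + Finsupp.single p 1 : Fin 5 →₀ ℕ)
      = (MvPolynomial.pderiv p).toLinearMap * diffPoly s := by
  have c := fun i j n => (pderiv_commute i j).pow_right n
  rw [diffPoly_eq, diffPoly_eq]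
  fin_cases p
  · simp [pow_succ', mul_assoc]
  · simp [pow_succ', mul_assoc]
    rw [(c 1 0 _).left_comm]
  · simp [pow_succ', mul_assoc]
    rw [(c 2 0 _).left_comm, (c 2 1 _).left_comm]
  · simp [pow_succ', mul_assoc]
    rw [(c 3 0 _).left_comm, (c 3 1 _).left_comm, (c 3 2 _).left_comm]
  · simp [pow_succ']
    rw [(c 4 0 _).left_comm, (c 4 1 _).left_comm, (c 4 2 _).left_comm, (c 4 3 _).left_comm]

/-- The differential operator with constant coefficients `f(∂/∂z₁, …, ∂/∂z₅)`. -/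
def theta : Poly →ₗ[ℂ] Module.End ℂ Poly :=
  (MvPolynomial.basisMonomials (Fin 5) ℂ).constr ℂ (fun s => diffPoly s)

theorem theta_monomial (s : Fin 5 →₀ ℕ) (c : ℂ) :
    theta (MvPolynomial.monomial s c) = c • diffPoly s := by
  have h : MvPolynomial.monomial s c = c • MvPolynomial.basisMonomials (Fin 5) ℂ s := by
    rw [MvPolynomial.coe_basisMonomials, MvPolynomial.smul_monomial, smul_eq_mul, mul_one]
  rw [h, map_smul, theta, Module.Basis.constr_basis]

theorem theta_mono (a : Fin 5 → ℕ) : theta (mono a) = diffPoly a := by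
  rw [mono_eq, theta_monomial, one_smul]
  rfl

theorem theta_C (c : ℂ) (f : Poly) : theta (MvPolynomial.C c) f = c • f := by
  rw [← MvPolynomial.monomial_zero', theta_monomial, LinearMap.smul_apply, diffPoly_eq]
  simp

theorem theta_mul_X (p : Fin 5) (g f : Poly) :
    theta (g * MvPolynomial.X p) f = MvPolynomial.pderiv p (theta g f) := by
  induction g using MvPolynomial.induction_on' with
  | monomial s c =>
    rw [MvPolynomial.X, MvPolynomial.monomial_mul, mul_one, theta_monomial, theta_monomial,
      diffPoly_add_single, LinearMap.smul_apply, LinearMap.smul_apply, Derivation.map_smul]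
    rfl
  | add a b ha hb =>
    rw [add_mul, map_add, map_add, LinearMap.add_apply, LinearMap.add_apply, ha, hb, map_add]

theorem matDer_pderiv (A : Matrix (Fin 5) (Fin 5) ℂ) (p : Fin 5) (f : Poly) :
    matDer A (MvPolynomial.pderiv p f)
      = MvPolynomial.pderiv p (matDer A f) - ∑ j, A p j • MvPolynomial.pderiv j f := by
  have h : ⁅matDer A, (MvPolynomial.pderiv p : Derivation ℂ Poly Poly)⁆
      = - ∑ j, A p j • (MvPolynomial.pderiv j : Derivation ℂ Poly Poly) := by
    refine MvPolynomial.derivation_ext fun k => ?_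
    rw [Derivation.commutator_apply, matDer_X, MvPolynomial.pderiv_X]
    have h1 : matDer A (Pi.single (M := fun _ => Poly) p 1 k) = 0 := by
      rw [Pi.single_apply]
      split_ifs <;> simp
    have h2 : (∑ j, A p j • (MvPolynomial.pderiv j : Derivation ℂ Poly Poly)) (MvPolynomial.X k)
        = A p k • (1 : Poly) := by
      simp only [← Derivation.coeFnAddMonoidHom_apply, map_sum, Finset.sum_apply]
      rw [Finset.sum_eq_single k]
      · simp
      · intro j _ hj
        simp [MvPolynomial.pderiv_X_of_ne hj.symm]
      · simp
    rw [h1, Derivation.neg_apply, h2, map_sum, Finset.sum_eq_single p]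
    · rw [Derivation.map_smul, MvPolynomial.pderiv_X_self, zero_sub]
    · intro i _ hi
      rw [Derivation.map_smul, MvPolynomial.pderiv_X_of_ne hi, smul_zero]
    · simp
  have h2 := congrArg (fun D : Derivation ℂ Poly Poly => D f) h
  simp only [Derivation.commutator_apply, Derivation.neg_apply,
    ← Derivation.coeFnAddMonoidHom_apply,
    map_sum, Finset.sum_apply] at h2
  simp only [Derivation.coeFnAddMonoidHom_apply, Derivation.smul_apply] at h2
  linear_combination h2

theorem matDer_theta (A : sl5) (g f : Poly) :
    matDer A.1 (theta g f) = theta (dualDer A g) f + theta g (matDer A.1 f) := by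
  induction g using MvPolynomial.induction_on with
  | C c =>
    rw [← MvPolynomial.algebraMap_eq, Derivation.map_algebraMap, map_zero, LinearMap.zero_apply,
      zero_add, MvPolynomial.algebraMap_eq, theta_C, theta_C, Derivation.map_smul]
  | add a b ha hb =>
    simp only [map_add, LinearMap.add_apply, ha, hb]
    abel
  | mul_X g p hg =>
    have h : theta (dualDer A (g * MvPolynomial.X p)) f
        = MvPolynomial.pderiv p (theta (dualDer A g) f)
          - ∑ i, A.1 p i • MvPolynomial.pderiv i (theta g f) := by
      rw [Derivation.leibniz, dualDer_X, smul_eq_mul, smul_eq_mul, mul_comm (MvPolynomial.X p),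
        map_add, LinearMap.add_apply, theta_mul_X, mul_neg, Finset.mul_sum, map_neg, map_sum,
        LinearMap.neg_apply, LinearMap.sum_apply, add_comm, ← sub_eq_add_neg]
      congr 1
      refine Finset.sum_congr rfl fun i _ => ?_
      rw [mul_smul_comm, map_smul, LinearMap.smul_apply, theta_mul_X]
    rw [theta_mul_X, theta_mul_X, matDer_pderiv, hg, h, map_add]
    ring

/-! ### Homogeneous components -/

theorem homogeneousComponent_matDer (A : Matrix (Fin 5) (Fin 5) ℂ) (m : ℕ) (f : Poly) :
    MvPolynomial.homogeneousComponent m (matDer A f)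
      = matDer A (MvPolynomial.homogeneousComponent m f) := by
  conv_lhs => rw [← MvPolynomial.sum_homogeneousComponent f]
  conv_rhs => rw [← MvPolynomial.sum_homogeneousComponent f]
  simp only [map_sum]
  refine Finset.sum_congr rfl fun i _ => ?_
  have h := MvPolynomial.homogeneousComponent_mem i f
  rw [MvPolynomial.homogeneousComponent_of_mem (matDer_mem A i h),
    MvPolynomial.homogeneousComponent_of_mem h]
  split_ifs
  · rfl
  · rw [map_zero]

/-- The projection to the homogeneous component of degree `m`, with values in `Symᵐ(ℂ⁵)`. -/
def SymPow.proj (m : ℕ) : Poly →ₗ[ℂ] SymPow m :=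
  (MvPolynomial.homogeneousComponent m).codRestrict (MvPolynomial.homogeneousSubmodule (Fin 5) ℂ m)
    (MvPolynomial.homogeneousComponent_mem m)

theorem SymPow.proj_matDer {m : ℕ} (A : sl5) (f : Poly) :
    SymPow.proj m (matDer A.1 f) = ⁅A, SymPow.proj m f⁆ :=
  Subtype.ext (homogeneousComponent_matDer A.1 m f)

theorem SymPow.proj_coe {m : ℕ} (f : SymPow m) : SymPow.proj m f.1 = f :=
  Subtype.ext ((MvPolynomial.homogeneousComponent_of_mem f.2).trans (if_pos rfl))

/-! ### The morphisms between the modules `M(n, 0, 0, 0)` -/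

/-- The bilinear map `Sym(ℂ⁵*) × Symⁿ(ℂ⁵) → Symᵐ(ℂ⁵)` given by the action of differential operators
with constant coefficients. -/
def diffBilin (n m : ℕ) : Poly →ₗ[ℂ] SymPow n →ₗ[ℂ] SymPow m :=
  LinearMap.mk₂ ℂ (fun g f => SymPow.proj m (theta g f.1))
    (fun g h f => by rw [map_add, LinearMap.add_apply, map_add])
    (fun c g f => by rw [map_smul, LinearMap.smul_apply, map_smul])
    (fun g f h => by
      change SymPow.proj m (theta g (f.1 + h.1)) = _
      rw [map_add, map_add])
    (fun c g f => by
      change SymPow.proj m (theta g (c • f.1)) = _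
      rw [map_smul, map_smul])

theorem diffBilin_apply (n m : ℕ) (g : Poly) (f : SymPow n) :
    diffBilin n m g f = SymPow.proj m (theta g f.1) := rfl

theorem diffBilin_lie (n m : ℕ) (A : sl5) (g : Poly) (f : SymPow n) :
    ⁅A, diffBilin n m g f⁆ = diffBilin n m (dualDer A g) f + diffBilin n m g ⁅A, f⁆ := by
  rw [diffBilin_apply, diffBilin_apply, diffBilin_apply, ← SymPow.proj_matDer, matDer_theta,
    map_add]
  rfl

theorem diffBilin_mono (n : ℕ) {k : ℕ} (a : MultiIndex k) (f : SymPow n) :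
    diffBilin n (n - k) (mono a.1) f = diffOp a n f := by
  rw [diffBilin_apply, theta_mono]
  exact SymPow.proj_coe (diffOp a n f)

theorem pderiv_pow_X_zero_pow {j : Fin 5} (hj : j ≠ 0) (k n : ℕ) :
    (((MvPolynomial.pderiv j).toLinearMap : Module.End ℂ Poly) ^ k) (MvPolynomial.X 0 ^ n)
      = if k = 0 then MvPolynomial.X 0 ^ n else 0 := by
  rcases k with _ | k
  · simp
  · rw [pow_succ, Module.End.mul_apply]
    have h : (MvPolynomial.pderiv j).toLinearMap ((MvPolynomial.X 0 : Poly) ^ n) = 0 :=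
      pderiv_X_pow_of_ne hj.symm n
    rw [h, map_zero, if_neg (Nat.succ_ne_zero k)]

theorem diffPoly_X_pow {k : ℕ} (a : MultiIndex k) (n : ℕ) (ha : a ≠ firstIndex k) :
    diffPoly a.1 (MvPolynomial.X 0 ^ n) = 0 := by
  rw [diffPoly_eq]
  simp only [Module.End.mul_apply]
  rw [pderiv_pow_X_zero_pow (by decide)]
  by_cases h4 : a.1 4 = 0
  · rw [if_pos h4, pderiv_pow_X_zero_pow (by decide)]
    by_cases h3 : a.1 3 = 0
    · rw [if_pos h3, pderiv_pow_X_zero_pow (by decide)]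
      by_cases h2 : a.1 2 = 0
      · rw [if_pos h2, pderiv_pow_X_zero_pow (by decide),
          if_neg fun h1 => ha ((eq_firstIndex_iff a).mpr ⟨h1, h2, h3, h4⟩), map_zero]
      · simp only [if_neg h2, map_zero]
    · simp only [if_neg h3, map_zero]
  · simp only [if_neg h4, map_zero]

theorem diffPoly_firstIndex_X_pow (n : ℕ) :
    diffPoly (firstIndex 3).1 (MvPolynomial.X 0 ^ n)
      = ((n : ℂ) * ((n - 1 : ℕ) : ℂ) * ((n - 2 : ℕ) : ℂ))
          • (MvPolynomial.X 0 : Poly) ^ (n - 3) := by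
  have h : ∀ m : ℕ, (MvPolynomial.pderiv 0).toLinearMap ((MvPolynomial.X 0 : Poly) ^ m)
      = (m : ℂ) • (MvPolynomial.X 0 : Poly) ^ (m - 1) := by
    intro m
    change MvPolynomial.pderiv 0 ((MvPolynomial.X 0 : Poly) ^ m) = _
    rw [MvPolynomial.pderiv_pow, MvPolynomial.pderiv_X_self, mul_one, MvPolynomial.smul_eq_C_mul,
      map_natCast]
  have e : diffPoly (firstIndex 3).1
      = ((MvPolynomial.pderiv 0).toLinearMap : Module.End ℂ Poly) ^ 3 := by
    rw [diffPoly_eq]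
    simp [firstIndex]
  rw [e, pow_succ, pow_succ, pow_one, Module.End.mul_apply, Module.End.mul_apply, h, map_smul, h,
    map_smul, map_smul, h, smul_smul, smul_smul]
  rfl

/-- On `z_0ⁿ` only the term of `a = (3, 0, 0, 0, 0)` contributes. -/
theorem actOn_diffBilin_pow (n : ℕ) :
    actOn (diffBilin n (n - 3)) (SymPow.pow 0 n) Psi
      = ((n : ℂ) * ((n - 1 : ℕ) : ℂ) * ((n - 2 : ℕ) : ℂ))
        • tmul (d 0 1 * d 0 2 * d 0 3 * d 0 4) (SymPow.pow 0 (n - 3)) := by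
  have h : ∀ a : MultiIndex 3, a ≠ firstIndex 3 →
      tmul (uElt a.1) (diffBilin n (n - 3) (mono a.1) (SymPow.pow 0 n)) = 0 := by
    intro a ha
    rw [diffBilin_apply, theta_mono]
    change tmul _ (SymPow.proj (n - 3) (diffPoly a.1 (MvPolynomial.X 0 ^ n))) = 0
    rw [diffPoly_X_pow a n ha, map_zero, ← tmulL_apply, map_zero]
  have h2 : diffBilin n (n - 3) (mono (firstIndex 3).1) (SymPow.pow 0 n)
      = ((n : ℂ) * ((n - 1 : ℕ) : ℂ) * ((n - 2 : ℕ) : ℂ)) • SymPow.pow 0 (n - 3) := by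
    rw [diffBilin_apply, theta_mono]
    change SymPow.proj (n - 3) (diffPoly (firstIndex 3).1 (MvPolynomial.X 0 ^ n)) = _
    rw [diffPoly_firstIndex_X_pow, map_smul]
    congr 1
    exact SymPow.proj_coe (SymPow.pow 0 (n - 3))
  rw [actOn_Psi, Finset.sum_eq_single (firstIndex 3) (fun a _ ha => h a ha)
    (fun h => absurd (Finset.mem_univ _) h), h2, uElt_firstIndex, ← tmulL_apply, map_smul]
  rfl


/-! ### Singular vectors in the modules `M(n, 0, 0, 0)` -/

theorem constantCoeff_formBracket_dForm {w : FormArray}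
    (hw : ∀ a b, MvPowerSeries.constantCoeff (w a b) = 0) (p k i : Fin 5) :
    MvPowerSeries.constantCoeff (formBracket w (dForm p k).1 i) = 0 := by
  have e : ∀ (c : ℂ) (f : PS), MvPowerSeries.constantCoeff (c • f)
      = c * MvPowerSeries.constantCoeff f := fun c f => by
    rw [MvPowerSeries.smul_eq_C_mul, map_mul, MvPowerSeries.constantCoeff_C]
  rw [formBracket_dForm, e, map_sum]
  simp only [map_sum, e, hw, mul_zero, Finset.sum_const_zero]

theorem constantCoeff_formBracket_dxd {f : PS} (hf : ∀ t, lc t f = 0) (k q l i : Fin 5) :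
    MvPowerSeries.constantCoeff (formBracket (dxd k f).1 (dForm q l).1 i) = 0 := by
  have e : ∀ (c : ℂ) (f : PS), MvPowerSeries.constantCoeff (c • f)
      = c * MvPowerSeries.constantCoeff f := fun c f => by
    rw [MvPowerSeries.smul_eq_C_mul, map_mul, MvPowerSeries.constantCoeff_C]
  rw [formBracket_dxd, map_sum]
  simp only [e, ← lc_apply, hf, mul_zero, Finset.sum_const_zero]

theorem lc_eq_zero {P : divFree} (h : even P ∈ posPart) (t p : Fin 5) : lc t (P.1 p) = 0 := by
  have h1 := congrArg (fun A : sl5 => A.1 t p) h.2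
  rw [lc_apply]
  exact (linPart_apply (even P) t p).symm.trans h1

section Common

set_option linter.unusedSectionVars false

variable {C R : Type} [CommRing C] [Ring R] [Algebra ℂ C] [Algebra ℂ R] [Algebra C R]
  [IsScalarTower ℂ C R] (ε : UEA →ₐ[ℂ] R) (z : Fin 5 → C)

/-- Elements of `L₊` annihilate `D₁ D₂ D₃ D₄` modulo a left ideal which contains `L₊`, the odd part
of `L₀` and the contractions with `z` of the families of fields in `L₀` that are alternating against
the generic covector. -/
theorem emb_mul_gD_mem {I : Submodule R R} (hI : ∀ v, odd v ∈ nonnegPart → emb ε (odd v) ∈ I)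
    (hpos : ∀ P, even P ∈ posPart → emb ε (even P) ∈ I)
    (hQ : ∀ Q : Fin 5 → divFree, (∀ p q, (Q p).1 q = - (Q q).1 p) →
      (∀ p, even (Q p) ∈ nonnegPart) → ∑ p, z p • emb ε (even (Q p)) ∈ I)
    {x : L} (hx : x ∈ posPart) :
    emb ε x * (gD ε z 1 * gD ε z 2 * gD ε z 3 * gD ε z 4) ∈ I := by
  rw [← even_add_odd x, map_add, add_mul]
  refine I.add_mem ?_ ?_
  · have hlc := lc_eq_zero (even_mem_posPart hx)
    refine even_mul_gD_mem ε z hI hlc (hpos _ (even_mem_posPart hx))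
      fun k l => I.neg_mem (I.sum_mem fun p _ => smul_mem_of_left_ideal _ ?_)
    exact hQ (fun q => ⟨formBracket (dxd k (x.1.1 p)).1 (dForm q l).1,
        formBracket_mem (dxd k (x.1.1 p)).2 (dForm q l).2⟩)
      (fun q r => formBracket_dForm_swap (dxd k (x.1.1 p)).1 q l r)
      fun q => ⟨fun i => constantCoeff_formBracket_dxd (fun t => hlc t p) k q l i,
        fun _ _ => map_zero _⟩
  · refine odd_mul_gD_mem ε z hI (odd_mem_posPart hx).1 fun k => ?_
    exact hQ (fun p => ⟨formBracket x.2.1 (dForm p k).1, formBracket_mem x.2.2 (dForm p k).2⟩)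
      (fun p q => formBracket_dForm_swap x.2.1 p k q)
      fun p => ⟨fun i => constantCoeff_formBracket_dForm hx.1.2 p k i, fun _ _ => map_zero _⟩

end Common

section Base

variable {W : Type} [AddCommGroup W] [Module ℂ W] [LieRingModule sl5 W] [LieModule ℂ sl5 W]

theorem tmul_eq_smul (u : UEA) (w : W) : tmul u w = u • tmul 1 w := by
  rw [smul_tmul_eq, mul_one]

theorem tmul_zero_right (u : UEA) : tmul u (0 : W) = 0 := by
  rw [← tmulL_apply, map_zero]

/-- The singular vector in its simplest form: if the fields in `L₀` without `∂_0`-component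
annihilate `w`, then `L₊` annihilates `d_{01} d_{02} d_{03} d_{04} ⊗ w`. -/
theorem smul_tmul_top {w : W}
    (hw : ∀ A : sl5, (∀ i, A.1 i 0 = 0) → ⁅A, w⁆ = 0) {x : L} (hx : x ∈ posPart) :
    ιU x • tmul (d 0 1 * d 0 2 * d 0 3 * d 0 4) w = 0 := by
  set z : Fin 5 → ℂ := Pi.single 0 1 with hz
  set ε : UEA →ₐ[ℂ] UEA := AlgHom.id ℂ UEA with hε
  set I : Submodule UEA UEA := LinearMap.ker (LinearMap.toSpanSingleton UEA (Verma W) (tmul 1 w))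
    with hIdef
  have hmem : ∀ u, u ∈ I ↔ tmul u w = 0 := fun u => by
    rw [tmul_eq_smul, hIdef, LinearMap.mem_ker, LinearMap.toSpanSingleton_apply]
  have hsum : ∀ F : Fin 5 → UEA, ∑ p, z p • F p = F 0 := by
    intro F
    rw [Finset.sum_eq_single 0, hz, Pi.single_eq_same, one_smul]
    · intro p _ hp
      rw [hz, Pi.single_eq_of_ne hp, zero_smul]
    · simp
  have hD : ∀ k, gD ε z k = d 0 k := fun k => hsum _
  have hnonneg : ∀ y ∈ nonnegPart, (∀ i, (linPart y).1 i 0 = 0) → ιU y ∈ I := by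
    intro y hy hy0
    rw [hmem, ← one_mul (ιU y), tmul_nonneg hy, hw _ hy0, tmul_zero_right]
  have h := emb_mul_gD_mem ε z (I := I)
    (fun v hv => hnonneg _ hv fun i => by rw [linPart_odd]; rfl)
    (fun P hP => hnonneg _ hP.1 fun i => by rw [hP.2]; rfl)
    (fun Q hQ hQ0 => by
      have h0 : (Q 0).1 0 = 0 := skew_self (v := fun p q => (Q p).1 q) hQ 0
      rw [hsum]
      refine hnonneg _ (hQ0 0) fun i => ?_
      rw [linPart_apply]
      change MvPowerSeries.constantCoeff (pd i ((Q 0).1 0)) = 0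
      rw [h0, map_zero, map_zero]) hx
  rw [hD, hD, hD, hD, hmem] at h
  exact h

end Base

theorem SymPow.lie_pow_eq_zero (n : ℕ) (A : sl5) (hA : ∀ i, A.1 i 0 = 0) :
    ⁅A, SymPow.pow 0 n⁆ = 0 := by
  refine Subtype.ext ?_
  rw [SymPow.coe_lie, matDer_apply]
  change ∑ i, ∑ j,
    A.1 i j • (MvPolynomial.X i * MvPolynomial.pderiv j ((MvPolynomial.X 0 : Poly) ^ n))
    = 0
  refine Finset.sum_eq_zero fun i _ => Finset.sum_eq_zero fun j _ => ?_
  by_cases hj : j = 0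
  · rw [hj, hA, zero_smul]
  · rw [pderiv_X_pow_of_ne (Ne.symm hj), mul_zero, smul_zero]

/-- The vectors `∑ u_a ⊗ ∂ᵃ f` are annihilated by `L₊`: this holds for `f = z_0ⁿ`, and the set of
such `f` is a submodule of the irreducible module `Symⁿ(ℂ⁵)`. -/
theorem smul_actOn_diffBilin (n : ℕ) {x : L} (hx : x ∈ posPart) (f : SymPow n) :
    ιU x • actOn (diffBilin n (n - 3)) f Psi = 0 := by
  set N : Submodule ℂ (SymPow n) :=
    { carrier := {f | ∀ x ∈ posPart, ιU x • actOn (diffBilin n (n - 3)) f Psi = 0}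
      add_mem' := fun {f g} hf hg x hx => by
        rw [map_add, LinearMap.add_apply, smul_add, hf x hx, hg x hx, add_zero]
      zero_mem' := fun x _ => by rw [map_zero, LinearMap.zero_apply, smul_zero]
      smul_mem' := fun c f hf x hx => by
        rw [map_smul, LinearMap.smul_apply, smul_comm, hf x hx, smul_zero] } with hN
  have htop : N = ⊤ := by
    refine SymPow.eq_top (fun i j hij f hf x hx => ?_) fun x hx => ?_
    · set A := matE i j hij
      have h : ιU x * ιU (even (linField A))
          = ιU (even (linField A)) * ιU x - ιU (lieB (even (linField A)) x) := by
        rw [← ιU_even_comm]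
        abel
      rw [← smul_actOn_Psi _ (diffBilin_lie n (n - 3)), ← mul_smul, h, sub_smul, mul_smul, hf x hx,
        hf _ (lie_linField_mem _ hx), smul_zero, sub_zero]
    · rw [actOn_diffBilin_pow, smul_comm,
        smul_tmul_top (fun A hA => SymPow.lie_pow_eq_zero _ A hA) hx, smul_zero]
  have h : f ∈ N := by
    rw [htop]
    trivial
  exact h x hx

theorem topCoeff_modelRep {W : Type} [AddCommGroup W] [Module ℂ W] [LieRingModule sl5 W]
    [LieModule ℂ sl5 W] (w : W) :
    modelRep W (d 0 1 * d 0 2 * d 0 3 * d 0 4) (1 ⊗ₜ w)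
      = (ng (Sum.inl (0, 1)) * ng (Sum.inl (0, 2)) * ng (Sum.inl (0, 3))
        * ng (Sum.inl (0, 4))) ⊗ₜ w := by
  simp only [map_mul, Module.End.mul_apply, d, modelRep_ιU, modelAct_dForm,
    TensorProduct.smul_tmul', smul_eq_mul, mul_one, mul_assoc]

theorem tmul_top_ne_zero {W : Type} [AddCommGroup W] [Module ℂ W] [LieRingModule sl5 W]
    [LieModule ℂ sl5 W] {w : W} (hw : w ≠ 0) : tmul (d 0 1 * d 0 2 * d 0 3 * d 0 4) w ≠ 0 := by
  intro h
  rw [tmul, mk_eq_zero_iff, toModel_tmul, topCoeff_modelRep] at h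
  have h2 := congrArg ((TensorProduct.lid ℂ W).toLinearMap ∘ₗ LinearMap.rTensor W topCoeff) h
  rw [map_zero] at h2
  change topCoeff _ • w = 0 at h2
  rw [topCoeff_top, one_smul] at h2
  exact hw h2

theorem d_prod_ne_zero : d 0 1 * d 0 2 * d 0 3 * d 0 4 ≠ 0 := by
  intro h
  refine tmul_top_ne_zero (SymPow.pow_ne_zero 0 0) ?_
  rw [h, ← tmulL_apply, map_zero, LinearMap.zero_apply]

/-- `ψ` is injective, as `Sym³(ℂ⁵)` is irreducible and `ψ(z_0³) ≠ 0`. -/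
theorem psi_injective : Function.Injective psi := by
  rw [← LinearMap.ker_eq_bot]
  let N : LieSubmodule ℂ sl5 (SymPow 3) :=
    { LinearMap.ker psi with
      lie_mem := fun {A f} hf => by
        have h : psi f = 0 := hf
        change psi ⁅A, f⁆ = 0
        rw [psi_lie, h, mul_zero, zero_mul, sub_zero] }
  rcases eq_bot_or_eq_top N with h | h
  · exact (LieSubmodule.toSubmodule_eq_bot N).mpr h
  · have h1 : monomial (firstIndex 3) ∈ N := by
      rw [h]
      trivial
    have h2 : psi (monomial (firstIndex 3)) = 0 := h1
    rw [psi_firstIndex] at h2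
    exact absurd h2 d_prod_ne_zero

theorem exists_morphism_symPow (n : ℕ) (hn : 3 ≤ n) :
    ∃ t : Verma (SymPow n) →ₗ[UEA] Verma (SymPow (n - 3)), t ≠ 0 ∧ HasDegree t 4 ∧
      ∀ f : SymPow n, t (tmul 1 f)
        = ∑ a : MultiIndex 3, tmul (psi (dualMonomial a)) (diffOp a n f) := by
  obtain ⟨t, ht, h⟩ := exists_morphism_of_equivariant (diffBilin n (n - 3))
    (diffBilin_lie n (n - 3)) fun x hx f => smul_actOn_diffBilin n hx f
  refine ⟨t, fun h0 => ?_, ht, fun f => ?_⟩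
  · have h1 := h (SymPow.pow 0 n)
    rw [← actOn_Psi, actOn_diffBilin_pow, h0, LinearMap.zero_apply] at h1
    have h2 : (n : ℂ) * ((n - 1 : ℕ) : ℂ) * ((n - 2 : ℕ) : ℂ) ≠ 0 := by
      refine mul_ne_zero (mul_ne_zero ?_ ?_) ?_ <;> exact Nat.cast_ne_zero.mpr (by omega)
    exact (smul_ne_zero h2 (tmul_top_ne_zero (SymPow.pow_ne_zero 0 (n - 3)))) h1.symm
  · rw [h]
    exact Finset.sum_congr rfl fun a _ => by rw [psi_dualMonomial, diffBilin_mono]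


/-! ### The morphisms between the modules `M(0, 0, 0, n)` -/

/-- The `sl₅`-module `Sym(ℂ⁵*)`, the sum of the `Symⁿ(ℂ⁵*)`. -/
instance : LieRingModule sl5 Poly where
  bracket A f := dualDer A f
  add_lie A B f := by
    change matDer (-(A.1 + B.1).transpose) f
      = matDer (-A.1.transpose) f + matDer (-B.1.transpose) f
    rw [Matrix.transpose_add, neg_add, matDer_add, Derivation.add_apply]
  lie_add A f g := map_add (dualDer A) f g
  leibniz_lie A B f := by
    change matDer (-A.1.transpose) (matDer (-B.1.transpose) f)
      = matDer (-(A.1 * B.1 - B.1 * A.1).transpose) f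
        + matDer (-B.1.transpose) (matDer (-A.1.transpose) f)
    have h : -(A.1 * B.1 - B.1 * A.1).transpose
        = (-A.1.transpose) * (-B.1.transpose) - (-B.1.transpose) * (-A.1.transpose) := by
      rw [Matrix.transpose_sub, Matrix.transpose_mul, Matrix.transpose_mul]
      noncomm_ring
    rw [h, matDer_lie, Derivation.commutator_apply]
    ring

instance : LieModule ℂ sl5 Poly where
  smul_lie c A f := by
    change matDer (-(c • A.1).transpose) f = c • matDer (-A.1.transpose) f
    rw [Matrix.transpose_smul, ← smul_neg, matDer_smul, Derivation.smul_apply]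
  lie_smul c A f := (dualDer A).map_smul c f

theorem Poly.lie_apply (A : sl5) (f : Poly) : ⁅A, f⁆ = dualDer A f := rfl

/-- The projection to the homogeneous component of degree `m`, with values in `Symᵐ(ℂ⁵*)`. -/
def SymDual.proj (m : ℕ) : Poly →ₗ[ℂ] SymDual m :=
  (MvPolynomial.homogeneousComponent m).codRestrict (MvPolynomial.homogeneousSubmodule (Fin 5) ℂ m)
    (MvPolynomial.homogeneousComponent_mem m)

theorem SymDual.proj_lie {m : ℕ} (A : sl5) (f : Poly) :
    SymDual.proj m ⁅A, f⁆ = ⁅A, SymDual.proj m f⁆ :=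
  Subtype.ext (homogeneousComponent_matDer _ m f)

theorem SymDual.proj_coe {m : ℕ} (f : SymDual m) : SymDual.proj m f.1 = f :=
  Subtype.ext ((MvPolynomial.homogeneousComponent_of_mem f.2).trans (if_pos rfl))

/-- Multiplication of polynomials, as a bilinear map `Sym(ℂ⁵*) × Sym(ℂ⁵*) → Sym(ℂ⁵*)`. -/
abbrev mulBilin : Poly →ₗ[ℂ] Poly →ₗ[ℂ] Poly := LinearMap.mul ℂ Poly

theorem actOn_mulBilin_smul (f g : Poly) (t : PolyUEA) :
    actOn mulBilin f (g • t) = actOn mulBilin (g * f) t := by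
  induction t using TensorProduct.induction_on with
  | zero => rw [smul_zero, map_zero, map_zero]
  | add a b ha hb => rw [smul_add, map_add, map_add, ha, hb]
  | tmul h u =>
    rw [TensorProduct.smul_tmul', actOn_tmul, actOn_tmul, LinearMap.mul_apply',
      LinearMap.mul_apply',
      smul_eq_mul, mul_comm g h, mul_assoc]

theorem actOn_mulBilin_tmul_mul (f g : Poly) (u : UEA) (t : PolyUEA) :
    actOn mulBilin f ((g ⊗ₜ u) * t) = u • actOn mulBilin (g * f) t := by
  induction t using TensorProduct.induction_on with
  | zero => rw [mul_zero, map_zero, map_zero, smul_zero]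
  | add a b ha hb => rw [mul_add, map_add, map_add, ha, hb, smul_add]
  | tmul h v =>
    rw [Algebra.TensorProduct.tmul_mul_tmul, actOn_tmul, actOn_tmul, LinearMap.mul_apply',
      LinearMap.mul_apply', smul_tmul_eq, mul_comm g h, mul_assoc]

/-- The left ideal of the polynomials with coefficients in `U` that annihilate all `1 ⊗ f`. -/
def annIdeal : Submodule PolyUEA PolyUEA where
  carrier := {r | ∀ f, actOn mulBilin f r = 0}
  add_mem' := fun hr hs f => by rw [map_add, hr f, hs f, add_zero]
  zero_mem' := fun f => map_zero _
  smul_mem' := fun c r hr f => by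
    change actOn mulBilin f (c * r) = 0
    induction c using TensorProduct.induction_on with
    | zero => rw [zero_mul, map_zero]
    | add a b ha hb => rw [add_mul, map_add, ha, hb, add_zero]
    | tmul g u => rw [actOn_mulBilin_tmul_mul, hr, smul_zero]

/-- For a family of fields in `L₀` which is alternating against the generic covector, the linear
parts `A_p` satisfy `∑ A_p (z_p f) = 0`, as the fields have divergence zero. -/
theorem sum_dualDer_mul {Q : Fin 5 → divFree} (hQ : ∀ p q, (Q p).1 q = - (Q q).1 p) (f : Poly) :
    ∑ p, dualDer (linPart (even (Q p))) (coord p * f) = 0 := by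
  have hA : ∀ p i j, (linPart (even (Q p))).1 i j = lc i ((Q p).1 j) := fun p i j => rfl
  have hskew : ∀ p i j, (linPart (even (Q p))).1 i j = - (linPart (even (Q j))).1 i p := by
    intro p i j
    rw [hA, hA, hQ, map_neg]
  have hdiv : ∀ p, ∑ i, (linPart (even (Q p))).1 i i = 0 := by
    intro p
    have h : ∑ i, pd i ((Q p).1 i) = 0 := (Q p).2
    have h2 := congrArg MvPowerSeries.constantCoeff h
    rw [map_sum, map_zero] at h2
    simpa only [hA, lc_apply] using h2
  have h1 : ∑ p, dualDer (linPart (even (Q p))) (coord p) = 0 := by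
    simp only [dualDer_X, Finset.sum_neg_distrib]
    rw [Finset.sum_comm, neg_eq_zero]
    refine Finset.sum_eq_zero fun i _ => ?_
    rw [← Finset.sum_smul, Finset.sum_congr rfl fun p _ => hskew p p i, Finset.sum_neg_distrib,
      hdiv, neg_zero, zero_smul]
  have h2 : ∑ p, coord p * dualDer (linPart (even (Q p))) f = 0 := by
    have e : ∀ p, coord p * dualDer (linPart (even (Q p))) f
        = ∑ i, coord p • coord i •
          (- ∑ k, (linPart (even (Q p))).1 k i • MvPolynomial.pderiv k f) := by
      intro p
      rw [dualDer, matDer_apply, Finset.mul_sum]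
      refine Finset.sum_congr rfl fun i _ => ?_
      simp only [Matrix.neg_apply, Matrix.transpose_apply, neg_smul, Finset.sum_neg_distrib,
        smul_eq_mul, mul_neg, Finset.mul_sum, mul_smul_comm]
    rw [Finset.sum_congr rfl fun p _ => e p]
    refine sum_alternating coord fun p i => ?_
    rw [neg_neg, ← Finset.sum_neg_distrib]
    refine Finset.sum_congr rfl fun k _ => ?_
    rw [hskew p k i, neg_smul, neg_neg]
  simp only [Derivation.leibniz, smul_eq_mul, Finset.sum_add_distrib]
  rw [h2, zero_add, ← Finset.mul_sum, h1, mul_zero]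

theorem actOn_emb {x : L} (hx : x ∈ nonnegPart) (f : Poly) :
    actOn mulBilin f (emb inclUEA x) = tmul 1 (dualDer (linPart x) f) := by
  change tmul (ιU x) (1 * f) = _
  rw [one_mul, ← one_mul (ιU x), tmul_nonneg hx, Poly.lie_apply]

theorem sum_smul_emb_mem {Q : Fin 5 → divFree} (hQ : ∀ p q, (Q p).1 q = - (Q q).1 p)
    (hQ0 : ∀ p, even (Q p) ∈ nonnegPart) :
    ∑ p, coord p • emb inclUEA (even (Q p)) ∈ annIdeal := by
  intro f
  rw [map_sum]
  have h : ∀ p, actOn mulBilin f (coord p • emb inclUEA (even (Q p)))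
      = tmulL Poly 1 (dualDer (linPart (even (Q p))) (coord p * f)) := fun p =>
    (actOn_mulBilin_smul f (coord p) (emb inclUEA (even (Q p)))).trans (actOn_emb (hQ0 p) _)
  rw [Finset.sum_congr rfl fun p _ => h p, ← map_sum, sum_dualDer_mul hQ, map_zero]

theorem emb_mul_smul_Psi_mem {x : L} (hx : x ∈ posPart) :
    emb inclUEA x * (coord 0 • Psi) ∈ annIdeal := by
  have h := emb_mul_gD_mem inclUEA coord (I := annIdeal)
    (fun v hv f => by rw [actOn_emb hv, linPart_odd, ← Poly.lie_apply, zero_lie, tmul_zero_right])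
    (fun P hP f => by rw [actOn_emb hP.1, hP.2, ← Poly.lie_apply, zero_lie, tmul_zero_right])
    (fun Q => sum_smul_emb_mem) hx
  rwa [← smul_Psi] at h

theorem smul_actOn_X_mul {x : L} (hx : x ∈ posPart) (f : Poly) :
    ιU x • actOn mulBilin (coord 0 * f) Psi = 0 := by
  have h := emb_mul_smul_Psi_mem hx f
  have e : actOn mulBilin f (emb inclUEA x * (coord 0 • Psi))
      = ιU x • actOn mulBilin (1 * f) (coord 0 • Psi) :=
    actOn_mulBilin_tmul_mul f 1 (ιU x) (coord 0 • Psi)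
  rw [e, one_mul, actOn_mulBilin_smul] at h
  exact h


theorem lTensor_ng_smul {V W : Type} [AddCommGroup V] [Module ℂ V] [AddCommGroup W]
    [Module ℂ W] (φ : V →ₗ[ℂ] W) (g : NegGen) (m : Model V) :
    LinearMap.lTensor NegUEA φ (ng g • m) = ng g • LinearMap.lTensor NegUEA φ m := by
  induction m using TensorProduct.induction_on with
  | zero => rw [smul_zero, map_zero, smul_zero]
  | add a b ha hb => rw [smul_add, map_add, map_add, smul_add, ha, hb]
  | tmul u v => rfl

section

set_option linter.unusedSectionVars false

variable {V W : Type} [AddCommGroup V] [Module ℂ V] [LieRingModule sl5 V] [LieModule ℂ sl5 V]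
  [AddCommGroup W] [Module ℂ W] [LieRingModule sl5 W] [LieModule ℂ sl5 W]

/-- `U₋` acts on the first factor of the model only. -/
theorem lTensor_modelRep (φ : V →ₗ[ℂ] W) {k : ℕ} {u : UEA} (hu : u ∈ uMinus k) (m : Model V) :
    LinearMap.lTensor NegUEA φ (modelRep V u m)
      = modelRep W u (LinearMap.lTensor NegUEA φ m) := by
  induction hu using Submodule.span_induction with
  | mem u h =>
    obtain ⟨l, hl, rfl⟩ := h
    clear hl
    have hneg : ∀ g, negGen g = ιU (negElt g) := by rintro (p | i) <;> rfl
    induction l with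
    | nil => simp
    | cons g l ih =>
      rw [List.map_cons, List.prod_cons, map_mul, map_mul, Module.End.mul_apply,
        Module.End.mul_apply, hneg, modelRep_ιU, modelRep_ιU, modelAct_negElt, modelAct_negElt,
        lTensor_ng_smul, ih]
  | zero => simp
  | add a b _ _ ha hb => simp only [map_add, LinearMap.add_apply, ha, hb]
  | smul c a _ ha => simp only [map_smul, LinearMap.smul_apply, ha]

/-- The vector `∑ u_a ⊗ w_a` in the model. -/
def modelSum {k : ℕ} (u : (Fin 5 → ℕ) → UEA) (w : MultiIndex k → W) : Model W :=
  ∑ a : MultiIndex k, modelRep W (u a.1) (1 ⊗ₜ w a)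

theorem lTensor_modelSum {k m : ℕ} (φ : V →ₗ[ℂ] W) {u : (Fin 5 → ℕ) → UEA}
    (hu : ∀ a, u a ∈ uMinus m) (w : MultiIndex k → V) :
    LinearMap.lTensor NegUEA φ (modelSum u w) = modelSum u fun a => φ (w a) := by
  rw [modelSum, map_sum]
  refine Finset.sum_congr rfl fun i _ => ?_
  rw [lTensor_modelRep φ (hu i), LinearMap.lTensor_tmul]

theorem sum_tmul_eq_mk {k : ℕ} (u : (Fin 5 → ℕ) → UEA) (w : MultiIndex k → W) :
    ∑ a, tmul (u a.1) (w a) = Submodule.Quotient.mk (∑ a, u a.1 ⊗ₜ w a) :=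
  (map_sum (vermaRel W).mkQ _ _).symm

theorem smul_sum_tmul_eq_zero_iff {k : ℕ} (x : L) (u : (Fin 5 → ℕ) → UEA)
    (β : Poly →ₗ[ℂ] V →ₗ[ℂ] W) (v : V) :
    ιU x • ∑ a : MultiIndex k, tmul (u a.1) (β (mono a.1) v) = 0
      ↔ modelAct W x (modelSum u fun a : MultiIndex k => β (mono a.1) v) = 0 := by
  rw [sum_tmul_eq_mk, ← Submodule.Quotient.mk_smul, mk_eq_zero_iff, toModel_smul, modelRep_ιU,
    map_sum]
  rfl

theorem sum_tmul_eq_zero_iff {k : ℕ} (u : (Fin 5 → ℕ) → UEA) (β : Poly →ₗ[ℂ] V →ₗ[ℂ] W) (v : V) :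
    ∑ a : MultiIndex k, tmul (u a.1) (β (mono a.1) v) = 0
      ↔ (modelSum u fun a : MultiIndex k => β (mono a.1) v) = 0 := by
  rw [sum_tmul_eq_mk, mk_eq_zero_iff, map_sum]
  rfl

theorem modelSum_eq_single {k : ℕ} (u : (Fin 5 → ℕ) → UEA) {w : MultiIndex k → W}
    (b : MultiIndex k) (h : ∀ a, a ≠ b → w a = 0) :
    modelSum u w = modelRep W (u b.1) (1 ⊗ₜ w b) := by
  rw [modelSum, Finset.sum_eq_single b]
  · intro a _ ha
    rw [h a ha, TensorProduct.tmul_zero, map_zero]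
  · exact fun h => absurd (Finset.mem_univ _) h

theorem smul_actOn_Psi_eq_zero_iff (x : L) (β : Poly →ₗ[ℂ] V →ₗ[ℂ] W) (v : V) :
    ιU x • actOn β v Psi = 0
      ↔ modelAct W x (modelSum uElt fun a : MultiIndex 3 => β (mono a.1) v) = 0 := by
  rw [actOn_Psi, smul_sum_tmul_eq_zero_iff x uElt β v]

/-- If `φ` annihilates all but one of the vectors `β(zᵃ, v)`, then only one summand of
`∑ u_a ⊗ β(zᵃ, v)` has to be known in order to see that this vector is not zero. -/
theorem modelSum_ne_zero {k m : ℕ} (φ : W →ₗ[ℂ] W) {u : (Fin 5 → ℕ) → UEA}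
    (hu : ∀ a, u a ∈ uMinus m) (β : Poly →ₗ[ℂ] V →ₗ[ℂ] W) (v : V) (b : MultiIndex k)
    (h : ∀ a : MultiIndex k, a ≠ b → φ (β (mono a.1) v) = 0)
    (hb : modelRep W (u b.1) (1 ⊗ₜ φ (β (mono b.1) v)) ≠ 0) :
    (modelSum u fun a : MultiIndex k => β (mono a.1) v) ≠ 0 := by
  intro h0
  have h2 := lTensor_modelSum φ hu fun a : MultiIndex k => β (mono a.1) v
  rw [h0, map_zero, modelSum_eq_single u b h] at h2
  exact hb h2.symm

theorem modelRep_top_ne_zero {w : W} (hw : w ≠ 0) :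
    modelRep W (d 0 1 * d 0 2 * d 0 3 * d 0 4) (1 ⊗ₜ w) ≠ 0 := fun h =>
  tmul_top_ne_zero hw ((mk_eq_zero_iff _).mpr h)

/-- A `g₀`-equivariant map `V → W` induces a morphism `M(V) → M(W)`. -/
theorem exists_map (φ : V →ₗ[ℂ] W) (hφ : ∀ (A : sl5) v, φ ⁅A, v⁆ = ⁅A, φ v⁆) :
    ∃ t : Verma V →ₗ[UEA] Verma W, ∀ u v, t (tmul u v) = tmul u (φ v) := by
  have h0 : ∀ {x : L}, x ∈ nonnegPart → ∀ w : W, ιU x • tmul 1 w = tmul 1 ⁅linPart x, w⁆ :=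
    fun hx w => by rw [smul_tmul_eq, mul_one, ← one_mul (ιU _), tmul_nonneg hx]
  obtain ⟨t, ht⟩ := exists_morphism (tmulL W 1 ∘ₗ φ)
    (fun A v => by
      rw [LinearMap.comp_apply, LinearMap.comp_apply, tmulL_apply, tmulL_apply,
        h0 (linField_mem A), linPart_linField, hφ])
    (fun x hx v => by
      rw [LinearMap.comp_apply, tmulL_apply, h0 hx.1, hx.2, zero_lie, tmul_zero_right])
  refine ⟨t, fun u v => ?_⟩
  rw [tmul_eq_smul, map_smul, ht, tmul_eq_smul u (φ v)]
  rfl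

end

/-- Multiplication by the polynomial `g` on the second factor of the model. -/
abbrev mulModel (g : Poly) : Model Poly →ₗ[ℂ] Model Poly :=
  LinearMap.lTensor NegUEA (mulBilin g)

/-- The operators by which `L` acts on the model are differential operators of order at most one
in the polynomial variables. -/
theorem modelAct_mulModel_mulModel (g : Poly) (x : L) (m : Model Poly) :
    modelAct Poly x (mulModel g (mulModel g m)) + mulModel g (mulModel g (modelAct Poly x m))
      = (2 : ℂ) • mulModel g (modelAct Poly x (mulModel g m)) := by
  revert x
  refine Model.induction (p := fun m => ∀ x : L,
    modelAct Poly x (mulModel g (mulModel g m)) + mulModel g (mulModel g (modelAct Poly x m))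
      = (2 : ℂ) • mulModel g (modelAct Poly x (mulModel g m))) ?_ ?_ ?_ ?_ m
  · intro w x
    have h : ⁅linPart x, g * (g * w)⁆ + g * (g * ⁅linPart x, w⁆)
        = (2 : ℂ) • (g * ⁅linPart x, g * w⁆) := by
      simp only [Poly.lie_apply, Derivation.leibniz, smul_eq_mul, two_smul]
      ring
    simp only [mulModel, LinearMap.lTensor_tmul, LinearMap.mul_apply', modelAct_one_tmul, map_add]
    rw [add_add_add_comm, ← TensorProduct.tmul_add, ← TensorProduct.tmul_add, h, smul_add,
      two_smul ℂ (constPart x ⊗ₜ[ℂ] (g * (g * w))), ← TensorProduct.tmul_smul,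
      TensorProduct.tmul_add]
  · intro a b ha hb x
    simp only [map_add, smul_add, ← ha, ← hb]
    abel
  · intro c a ha x
    simp only [map_smul, smul_comm (2 : ℂ) c, ← smul_add, ha]
  · intro e a ha x
    simp only [mulModel, lTensor_ng_smul, modelAct_smul, map_add] at ha ⊢
    rw [add_add_add_comm, ha, ← smul_add, ha, smul_add, smul_comm (2 : ℂ) (ng e)]

theorem mulModel_X_injective (p : Fin 5) : Function.Injective (mulModel (coord p)) :=
  Module.Flat.lTensor_preserves_injective_linearMap _
    fun f g (h : coord p * f = coord p * g) => mul_left_cancel₀ (MvPolynomial.X_ne_zero p) h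

/-- The vector `∑ u_a ⊗ zᵃ f` in the model. -/
def psiVec (f : Poly) : Model Poly := modelSum uElt fun a : MultiIndex 3 => mulBilin (mono a.1) f

theorem mulModel_psiVec (g f : Poly) : mulModel g (psiVec f) = psiVec (g * f) :=
  (lTensor_modelSum (mulBilin g) uElt_mem _).trans
    (congrArg (modelSum uElt) (funext fun a => mul_left_comm g (mono a.1) f))

theorem smul_actOn_mulBilin_eq_zero_iff (x : L) (f : Poly) :
    ιU x • actOn mulBilin f Psi = 0 ↔ modelAct Poly x (psiVec f) = 0 := by
  rw [psiVec]
  exact smul_actOn_Psi_eq_zero_iff x mulBilin f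

/-- The vectors `∑ u_a ⊗ zᵃ f` are annihilated by `L₊`: this holds for multiples `f` of `z_0`, and
second differences reduce the general case to this one. -/
theorem smul_actOn_mulBilin {x : L} (hx : x ∈ posPart) (f : Poly) :
    ιU x • actOn mulBilin f Psi = 0 := by
  have h : ∀ f, modelAct Poly x (mulModel (coord 0) (psiVec f)) = 0 := fun f => by
    rw [mulModel_psiVec]
    exact (smul_actOn_mulBilin_eq_zero_iff x _).mp (smul_actOn_X_mul hx f)
  rw [smul_actOn_mulBilin_eq_zero_iff]
  have h2 := modelAct_mulModel_mulModel (coord 0) x (psiVec f)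
  rw [mulModel_psiVec (coord 0) f, h, ← mulModel_psiVec, h, map_zero, smul_zero, zero_add] at h2
  refine mulModel_X_injective 0 (mulModel_X_injective 0 (h2.trans ?_))
  rw [map_zero, map_zero]

/-- The bilinear map `Sym(ℂ⁵*) × Symⁿ(ℂ⁵*) → Symᵐ(ℂ⁵*)`: multiplication, followed by the
projection to the component of degree `m`. -/
def mulProj (n m : ℕ) : Poly →ₗ[ℂ] SymDual n →ₗ[ℂ] SymDual m :=
  LinearMap.mk₂ ℂ (fun g f => SymDual.proj m (g * f.1))
    (fun g h f => by rw [add_mul, map_add])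
    (fun c g f => by rw [smul_mul_assoc, map_smul])
    (fun g f h => by
      change SymDual.proj m (g * (f.1 + h.1)) = _
      rw [mul_add, map_add])
    (fun c g f => by
      change SymDual.proj m (g * (c • f.1)) = _
      rw [mul_smul_comm, map_smul])

theorem mulProj_apply (n m : ℕ) (g : Poly) (f : SymDual n) :
    mulProj n m g f = SymDual.proj m (g * f.1) := rfl

theorem mulProj_lie (n m : ℕ) (A : sl5) (g : Poly) (f : SymDual n) :
    ⁅A, mulProj n m g f⁆ = mulProj n m (dualDer A g) f + mulProj n m g ⁅A, f⁆ := by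
  rw [mulProj_apply, mulProj_apply, mulProj_apply, ← SymDual.proj_lie, ← map_add]
  refine congrArg (SymDual.proj m) ?_
  rw [Poly.lie_apply, Derivation.leibniz, smul_eq_mul, smul_eq_mul, add_comm, mul_comm f.1]
  rfl

theorem mulProj_mono (n : ℕ) {k : ℕ} (a : MultiIndex k) (f : SymDual n) :
    mulProj n (n + k) (mono a.1) f = mulOp a n f := by
  rw [mulProj_apply, mul_comm]
  exact SymDual.proj_coe (mulOp a n f)

theorem smul_actOn_mulProj (n m : ℕ) {x : L} (hx : x ∈ posPart) (f : SymDual n) :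
    ιU x • actOn (mulProj n m) f Psi = 0 := by
  obtain ⟨t, ht⟩ := exists_map (SymDual.proj m) SymDual.proj_lie
  have h : t (actOn mulBilin f.1 Psi) = actOn (mulProj n m) f Psi := by
    rw [actOn_Psi, actOn_Psi, map_sum]
    exact Finset.sum_congr rfl fun a _ => ht _ _
  rw [← h, ← map_smul, smul_actOn_mulBilin hx, map_zero]

/-- The projection of `Symᵏ(ℂ⁵*)` to the line through `z_0ᵏ`. -/
def SymDual.projPow (k : ℕ) : SymDual k →ₗ[ℂ] SymDual k where
  toFun f := monoCoeff (firstIndex k).1 f.1 • SymDual.pow 0 k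
  map_add' f g := by
    change monoCoeff _ (f.1 + g.1) • SymDual.pow 0 k = _
    rw [map_add, add_smul]
  map_smul' c f := by
    change monoCoeff _ (c • f.1) • SymDual.pow 0 k = _
    rw [map_smul, smul_assoc]
    rfl

theorem projPow_mulProj {n k : ℕ} (a : MultiIndex k) :
    SymDual.projPow (n + k) (mulProj n (n + k) (mono a.1) (SymDual.pow 0 n))
      = if a = firstIndex k then SymDual.pow 0 (n + k) else 0 := by
  rw [mulProj_mono]
  have h : (mulOp a n (SymDual.pow 0 n)).1 = mono (a.1 + Pi.single (M := fun _ => ℕ) 0 n) := by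
    change (MvPolynomial.X 0 : Poly) ^ n * mono a.1 = _
    simp only [mono, Fin.prod_univ_five, Pi.add_apply]
    simp
    ring
  change monoCoeff _ (mulOp a n (SymDual.pow 0 n)).1 • SymDual.pow 0 (n + k) = _
  have h2 : a.1 + Pi.single (M := fun _ => ℕ) 0 n = (firstIndex (n + k)).1 ↔ a = firstIndex k := by
    have e : (firstIndex (n + k)).1 = (firstIndex k).1 + Pi.single (M := fun _ => ℕ) 0 n := by
      rw [add_comm n k]
      exact Pi.single_add (f := fun _ => ℕ) 0 k n
    rw [e, add_left_inj, Subtype.ext_iff]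
  rw [h, monoCoeff_mono]
  simp only [h2]
  split_ifs <;> simp

theorem exists_morphism_symDual (n : ℕ) :
    ∃ t : Verma (SymDual n) →ₗ[UEA] Verma (SymDual (n + 3)), t ≠ 0 ∧ HasDegree t 4 ∧
      ∀ f : SymDual n, t (tmul 1 f)
        = ∑ a : MultiIndex 3, tmul (psi (dualMonomial a)) (mulOp a n f) := by
  obtain ⟨t, ht, h⟩ := exists_morphism_of_equivariant (mulProj n (n + 3))
    (mulProj_lie n (n + 3)) fun x hx f => smul_actOn_mulProj n (n + 3) hx f
  refine ⟨t, fun h0 => ?_, ht, fun f => ?_⟩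
  · -- the component of `t(1 ⊗ z_0ⁿ)` along `z_0ⁿ⁺³` is `d_{01} d_{02} d_{03} d_{04} ⊗ z_0ⁿ⁺³`
    have h1 := h (SymDual.pow 0 n)
    rw [h0, LinearMap.zero_apply, eq_comm, sum_tmul_eq_zero_iff uElt] at h1
    refine modelSum_ne_zero (SymDual.projPow (n + 3)) uElt_mem (mulProj n (n + 3)) _ (firstIndex 3)
      (fun a ha => by rw [projPow_mulProj, if_neg ha]) ?_ h1
    rw [projPow_mulProj, if_pos rfl, uElt_firstIndex]
    exact modelRep_top_ne_zero (SymDual.pow_ne_zero 0 (n + 3))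
  · rw [h]
    exact Finset.sum_congr rfl fun a _ => by rw [psi_dualMonomial, mulProj_mono]

end E510

end

theorem theorem5p1 :
    (∀ n : ℕ, E510.IsIrreducibleOfHighestWeight ![n, 0, 0, 0] (E510.SymPow n)) ∧
    (∀ n : ℕ, E510.IsIrreducibleOfHighestWeight ![0, 0, 0, n] (E510.SymDual n)) ∧
    ∃ ψ : E510.SymPow 3 →ₗ[ℂ] E510.UEA,
      Function.Injective ψ ∧
      (∀ f, ψ f ∈ E510.uMinus 4) ∧
      (∀ (A : E510.sl5) (f : E510.SymPow 3),
        ψ ⁅A, f⁆ = E510.ιU (E510.even (E510.linField A)) * ψ f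
          - ψ f * E510.ιU (E510.even (E510.linField A))) ∧
      ψ (E510.monomial (E510.firstIndex 3)) = E510.d 0 1 * E510.d 0 2 * E510.d 0 3 * E510.d 0 4 ∧
      (∀ n₁ : ℕ, 3 ≤ n₁ →
        ∃ t : E510.Verma (E510.SymPow n₁) →ₗ[E510.UEA] E510.Verma (E510.SymPow (n₁ - 3)),
          t ≠ 0 ∧ E510.HasDegree t 4 ∧
          ∀ f : E510.SymPow n₁, t (E510.tmul 1 f) =
            ∑ a : E510.MultiIndex 3, E510.tmul (ψ (E510.dualMonomial a)) (E510.diffOp a n₁ f)) ∧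
      (∀ n₄ : ℕ,
        ∃ t : E510.Verma (E510.SymDual n₄) →ₗ[E510.UEA] E510.Verma (E510.SymDual (n₄ + 3)),
          t ≠ 0 ∧ E510.HasDegree t 4 ∧
          ∀ f : E510.SymDual n₄, t (E510.tmul 1 f) =
            ∑ a : E510.MultiIndex 3, E510.tmul (ψ (E510.dualMonomial a)) (E510.mulOp a n₄ f)) := by
  refine ⟨E510.SymPow.isIrreducibleOfHighestWeight, E510.SymDual.isIrreducibleOfHighestWeight, E510.psi,
    E510.psi_injective, E510.psi_mem, E510.psi_lie, E510.psi_firstIndex, E510.exists_morphism_symPow,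
    E510.exists_morphism_symDual⟩
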